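/- Let $\mathbb K=\mathbb R$ or $\mathbb C$. Consider the discrete equation $$t(u+1,v+1)=f\big(t(u,v),t(u+1,v),t(u,v+1)\big),\qquad (u,v)\in\mathbb Z^2,\qquad (1)$$ written $t_{uv}=f(t,t_u,t_v)$, with values in $\mathbb K$. Let $D,\bar D$ be the shifts in $u$ and $v$, and put $t_j=D^jt$, $\bar t_k=\bar D^kt$, $f_j=D^jf$. Let $\Gamma\subset\mathbb K^4$ be the domain of admissible quadruples $(t,t_u,t_v,t_{uv})$. Only solutions on $\mathbb Z^2$ all of whose quadruples lie in $\Gamma$ are considered. The equation is assumed to be hyperbolic: on $\Gamma$ it can be solved for each of its variables, $t_{uv}=f(t,t_u,t_v)$, $t_u=g(t,t_v,t_{uv})$, $t_v=r(t,t_{uv},t_u)$, $t=s(t_u,t_{uv},t_v)$, with $f,g,r,s$ analytic at the points concerned. The dynamical variables $t_j$ ($j\in\mathbb Z$), $\bar t_k$ ($k\in\mathbb Z\setminus\{0\}$) are assumed to be independent: any finitely many of them range, over the solutions, through a nonempty open connected set. (If $f,g,r,s$ are everywhere defined and $\Gamma$ is the graph of $f$ as well as of $g$, $r$ and $s$, this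 holds with the whole space as the range.) A $v$-invariant near a solution is a function $F(v,t,t_1,\dots,t_M,\bar t_1,\dots,\bar t_K)$ which, for every $v\in\mathbb Z$, is defined and smooth in a neighbourhood of the values of its arguments along that solution at $(0,v)$, and which satisfies $\bar DF=F$ there, that is, $$F(v+1,t_v,f,f_1,\dots,f_{M-1},\bar t_2,\dots,\bar t_{K+1})=F(v,t,t_1,\dots,t_M,\bar t_1,\dots,\bar t_K)$$ identically in $t,t_1,\dots,t_M,\bar t_1,\dots,\bar t_{K+1}$ near these values. It is nontrivial if $F(v,\cdot)$ is not constant near the solution for some $v$. For $k\ge 1$ the operator $X_k=\bar D^{-k}\frac{d}{dt_v}\bar D^{k}$, acting on functions of $t,t_1,t_2,\dots$, is a vector field $\sum_{j\ge0}x(j)\,\partial/\partial t_j$, where each $x(j)$ is a function of finitely many of the variables $t,t_1,t_2,\dots$ and $\bar t_{-1},\bar t_{-2},\dots$. Here $d/dt_v$ is taken with $t,t_1,t_2,\dots$ and $\bar t_2,\bar t_3,\dots$ fixed. Let $L_v$ be the Lie algebra generated by $X_1,X_2,\dots$ under the commutator of vector fields of this form. The dimension of $L_v$ is understood over the functions of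 the dynamical variables: it is finite if for some $N$ any $N+1$ elements of $L_v$ satisfy a linear relation whose coefficients are analytic functions of finitely many of the dynamical variables, not all identically zero. **Theorem.** Under these assumptions equation (1) admits a nontrivial $v$-invariant near some solution if and only if $L_v$ is of finite dimension. -/

import Mathlib

open scoped Topology ContDiff

namespace DiscreteHyperbolic

/-- Lattice solutions `τ u v` (`u, v` integers) of the quad-graph equation whose elementary
quadruples `(t, t_u, t_v, t_uv)` all lie in the domain `Γ`. -/
def solutions {𝕜 : Type*} (Γ : Set (𝕜 × 𝕜 × 𝕜 × 𝕜)) : Set (ℤ → ℤ → 𝕜) :=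
  {τ | ∀ u v : ℤ, (τ u v, τ (u + 1) v, τ u (v + 1), τ (u + 1) (v + 1)) ∈ Γ}

/-- On the domain `Γ` of quadruples `(t, t_u, t_v, t_uv)` the equation `t_uv = f (t, t_u, t_v)`
holds and is solved by each of `t_u = g (t, t_v, t_uv)`, `t_v = r (t, t_uv, t_u)`,
`t = s (t_u, t_uv, t_v)`, where `f`, `g`, `r`, `s` are analytic at the points concerned. -/
structure IsHyperbolic {𝕜 : Type*} [RCLike 𝕜] (f g r s : 𝕜 → 𝕜 → 𝕜 → 𝕜)
    (Γ : Set (𝕜 × 𝕜 × 𝕜 × 𝕜)) : Prop where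
  eq_f : ∀ t tu tv tuv, (t, tu, tv, tuv) ∈ Γ → tuv = f t tu tv
  eq_g : ∀ t tu tv tuv, (t, tu, tv, tuv) ∈ Γ → tu = g t tv tuv
  eq_r : ∀ t tu tv tuv, (t, tu, tv, tuv) ∈ Γ → tv = r t tuv tu
  eq_s : ∀ t tu tv tuv, (t, tu, tv, tuv) ∈ Γ → t = s tu tuv tv
  analytic_f : ∀ t tu tv tuv, (t, tu, tv, tuv) ∈ Γ →
    AnalyticAt 𝕜 (fun p : 𝕜 × 𝕜 × 𝕜 => f p.1 p.2.1 p.2.2) (t, tu, tv)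
  analytic_g : ∀ t tu tv tuv, (t, tu, tv, tuv) ∈ Γ →
    AnalyticAt 𝕜 (fun p : 𝕜 × 𝕜 × 𝕜 => g p.1 p.2.1 p.2.2) (t, tv, tuv)
  analytic_r : ∀ t tu tv tuv, (t, tu, tv, tuv) ∈ Γ →
    AnalyticAt 𝕜 (fun p : 𝕜 × 𝕜 × 𝕜 => r p.1 p.2.1 p.2.2) (t, tuv, tu)
  analytic_s : ∀ t tu tv tuv, (t, tu, tv, tuv) ∈ Γ →
    AnalyticAt 𝕜 (fun p : 𝕜 × 𝕜 × 𝕜 => s p.1 p.2.1 p.2.2) (tu, tuv, tv)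

/-- The dynamical variables, i.e. the values `t_j = τ j 0` and `t̄_k = τ 0 k` on the coordinate
cross, are independent: any finitely many of them range over a (nonempty) open connected set.
If `f`, `g`, `r`, `s` are defined everywhere and `Γ` is the graph of each, this set is the whole
space. -/
def HasIndependentVariables {𝕜 : Type*} [RCLike 𝕜] (Γ : Set (𝕜 × 𝕜 × 𝕜 × 𝕜)) : Prop :=
  ∀ S : Finset (ℤ × ℤ), (∀ p ∈ S, p.1 = 0 ∨ p.2 = 0) →
    IsOpen ((fun (τ : ℤ → ℤ → 𝕜) (p : S) => τ p.1.1 p.1.2) '' solutions Γ) ∧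
    IsConnected ((fun (τ : ℤ → ℤ → 𝕜) (p : S) => τ p.1.1 p.1.2) '' solutions Γ)

/-- The upper shift of a row: from `a = (t, t_1, t_2, …)` and `b = t_v` the row
`(t_v, f, f_1, f_2, …)`. -/
def nextRow {𝕜 : Type*} (f : 𝕜 → 𝕜 → 𝕜 → 𝕜) (a : ℕ → 𝕜) (b : 𝕜) : ℕ → 𝕜
  | 0 => b
  | j + 1 => f (a j) (a (j + 1)) (nextRow f a b j)

/-- The lower shift of a row: from `a = (t, t_1, t_2, …)` and `c = t_{-v}` the row below. -/
def prevRow {𝕜 : Type*} (g : 𝕜 → 𝕜 → 𝕜 → 𝕜) (a : ℕ → 𝕜) (c : 𝕜) : ℕ → 𝕜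
  | 0 => c
  | j + 1 => g (prevRow g a c j) (a j) (a (j + 1))

/-- The row at height `k` expressed through the row `a` at height `0` and the column
`b 1, …, b k` of values at `u = 0`. -/
def rowUp {𝕜 : Type*} (f : 𝕜 → 𝕜 → 𝕜 → 𝕜) (a b : ℕ → 𝕜) : ℕ → ℕ → 𝕜
  | 0 => a
  | k + 1 => nextRow f (rowUp f a b k) (b (k + 1))

/-- The coordinates in which the vector fields are written: `x j = t_j` for `j ≥ 0` and
`x (-k) = t̄_{-k}` for `k ≥ 1`.  This is the row at height `-k` in these coordinates. -/
def rowDown {𝕜 : Type*} (g : 𝕜 → 𝕜 → 𝕜 → 𝕜) (x : ℤ → 𝕜) : ℕ → ℕ → 𝕜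
  | 0 => fun j => x j
  | k + 1 => prevRow g (rowDown g x k) (x (-((k : ℤ) + 1)))

/-- The coordinates `(…, t̄_{-2}, t̄_{-1}, t, t_1, t_2, …)` of a lattice solution. -/
def stair {𝕜 : Type*} (τ : ℤ → ℤ → 𝕜) : ℤ → 𝕜 :=
  fun n => if 0 ≤ n then τ n 0 else τ 0 n

/-- The points of the domain of the dynamical variables, in the coordinates of the vector
fields. -/
def points {𝕜 : Type*} (Γ : Set (𝕜 × 𝕜 × 𝕜 × 𝕜)) : Set (ℤ → 𝕜) :=
  stair '' solutions Γ

/-- The operator `X_k = D̄^{-k} (d/dt_v) D̄^k` on functions `F (t, t_1, t_2, …)`.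
`D̄^k F` is `F` of the row at height `k`, a function of the row at height `0` and of
`t̄_1 = t_v, …, t̄_k`; it is differentiated with respect to `t_v`, and the result is shifted
down by `k`: the row at height `0` becomes the row at height `-k`, and `t̄_i` becomes
`t̄_{i-k}` for `i ≤ k`. -/
noncomputable def charOp {𝕜 : Type*} [RCLike 𝕜] (f g : 𝕜 → 𝕜 → 𝕜 → 𝕜) (k : ℕ)
    (F : (ℕ → 𝕜) → 𝕜) (x : ℤ → 𝕜) : 𝕜 :=
  deriv (fun y : 𝕜 =>
      F (rowUp f (rowDown g x k) (Function.update (fun i : ℕ => x ((i : ℤ) - k)) 1 y) k))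
    (x (1 - (k : ℤ)))

/-- Formal vector fields `∑_{j ≥ 0} x(j) ∂/∂t_j`, given by their coefficients `x(j)`, which are
functions of the coordinates. -/
abbrev VField (𝕜 : Type*) := ℕ → (ℤ → 𝕜) → 𝕜

/-- The partial derivative `∂F/∂t_i`. -/
noncomputable def partialT {𝕜 : Type*} [RCLike 𝕜] (i : ℕ) (F : (ℤ → 𝕜) → 𝕜) (x : ℤ → 𝕜) : 𝕜 :=
  deriv (fun y : 𝕜 => F (Function.update x (i : ℤ) y)) (x i)

/-- The derivative `X F = ∑_i x(i) ∂F/∂t_i`.  The sum is finite, as every function concerned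
depends on finitely many variables. -/
noncomputable def VField.apply {𝕜 : Type*} [RCLike 𝕜] (X : VField 𝕜) (F : (ℤ → 𝕜) → 𝕜)
    (x : ℤ → 𝕜) : 𝕜 :=
  ∑ᶠ i : ℕ, X i x * partialT i F x

/-- The commutator `[X, Y] = XY - YX`. -/
noncomputable def VField.bracket {𝕜 : Type*} [RCLike 𝕜] (X Y : VField 𝕜) : VField 𝕜 :=
  fun j x => X.apply (Y j) x - Y.apply (X j) x

/-- The vector field `X_k = ∑_j X_k(t_j) ∂/∂t_j`. -/
noncomputable def charField {𝕜 : Type*} [RCLike 𝕜] (f g : 𝕜 → 𝕜 → 𝕜 → 𝕜) (k : ℕ) : VField 𝕜 :=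
  fun j => charOp f g k (fun t => t j)

/-- The characteristic Lie algebra `L_v`: the Lie algebra generated by `X_1, X_2, …`. -/
inductive CharAlgebra {𝕜 : Type*} [RCLike 𝕜] (f g : 𝕜 → 𝕜 → 𝕜 → 𝕜) : VField 𝕜 → Prop
  | gen (k : ℕ) (hk : 1 ≤ k) : CharAlgebra f g (charField f g k)
  | add (X Y : VField 𝕜) : CharAlgebra f g X → CharAlgebra f g Y → CharAlgebra f g (X + Y)
  | smul (c : 𝕜) (X : VField 𝕜) : CharAlgebra f g X → CharAlgebra f g (c • X)
  | bracket (X Y : VField 𝕜) :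
      CharAlgebra f g X → CharAlgebra f g Y → CharAlgebra f g (X.bracket Y)

/-- Analytic functions of finitely many of the variables, on the domain of these variables. -/
def IsDynamicalFunction {𝕜 : Type*} [RCLike 𝕜] (Γ : Set (𝕜 × 𝕜 × 𝕜 × 𝕜))
    (a : (ℤ → 𝕜) → 𝕜) : Prop :=
  ∃ (S : Finset ℤ) (φ : (S → 𝕜) → 𝕜), ∀ x ∈ points Γ,
    AnalyticAt 𝕜 φ (fun i : S => x i) ∧ a x = φ (fun i : S => x i)

/-- `L_v` has finite dimension over the functions of the dynamical variables: for some `N`, any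
`N + 1` of its elements satisfy a nontrivial linear relation with functions as coefficients. -/
def IsFiniteDimensional {𝕜 : Type*} [RCLike 𝕜] (f g : 𝕜 → 𝕜 → 𝕜 → 𝕜)
    (Γ : Set (𝕜 × 𝕜 × 𝕜 × 𝕜)) : Prop :=
  ∃ N : ℕ, ∀ Z : Fin (N + 1) → VField 𝕜, (∀ i, CharAlgebra f g (Z i)) →
    ∃ a : Fin (N + 1) → (ℤ → 𝕜) → 𝕜, (∀ i, IsDynamicalFunction Γ (a i)) ∧
      (∃ i, ∃ x ∈ points Γ, a i x ≠ 0) ∧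
      ∀ x ∈ points Γ, ∀ j : ℕ, ∑ i, a i x * Z i j x = 0

/-- `F (v, t, t_1, …, t_M, t̄_1, …, t̄_K)` is a `v`-invariant near the solution `τ`: for every
integer `v` it is smooth near the values of its arguments along `τ` at `(0, v)`, and there
`F (v + 1, t_v, f, f_1, …, f_{M-1}, t̄_2, …, t̄_{K+1}) = F (v, t, t_1, …, t_M, t̄_1, …, t̄_K)`
identically in the dynamical variables `q.1 j = t_j`, `q.2 k = t̄_{k+1}`. -/
def IsInvariantNear {𝕜 : Type*} [RCLike 𝕜] (f : 𝕜 → 𝕜 → 𝕜 → 𝕜) (τ : ℤ → ℤ → 𝕜) (M K : ℕ)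
    (F : ℤ → (Fin (M + 1) → 𝕜) × (Fin K → 𝕜) → 𝕜) : Prop :=
  (∀ v : ℤ, ContDiffAt 𝕜 ∞ (F v)
    (fun j => τ (j : ℕ) v, fun k => τ 0 (v + 1 + (k : ℕ)))) ∧
  ∀ v : ℤ, ∀ᶠ q : (ℕ → 𝕜) × (ℕ → 𝕜) in
      𝓝 (fun j : ℕ => τ j v, fun k : ℕ => τ 0 (v + 1 + k)),
    F (v + 1) (fun j => nextRow f q.1 (q.2 0) j, fun k => q.2 (k + 1)) =
      F v (fun j => q.1 j, fun k => q.2 k)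

/-- The equation admits a nontrivial `v`-invariant: near some solution there is a `v`-invariant
that is not a constant. -/
def AdmitsNontrivialInvariant {𝕜 : Type*} [RCLike 𝕜] (f : 𝕜 → 𝕜 → 𝕜 → 𝕜)
    (Γ : Set (𝕜 × 𝕜 × 𝕜 × 𝕜)) : Prop :=
  ∃ τ ∈ solutions Γ, ∃ (M K : ℕ) (F : ℤ → (Fin (M + 1) → 𝕜) × (Fin K → 𝕜) → 𝕜),
    IsInvariantNear f τ M K F ∧
    ∃ v : ℤ, ¬ Filter.EventuallyConst (F v)
      (𝓝 (fun j => τ (j : ℕ) v, fun k => τ 0 (v + 1 + (k : ℕ))))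

end DiscreteHyperbolic

set_option linter.unusedSectionVars false

/-! A row of values at one height is carried to the next height by the equation once the new value
in the column `u = 0` is given. A function of rows yields a `v`-invariant when its transported
values do not depend on these column values, and `X_k` is the derivative of the row with respect to
the column value `k - 1` steps below it.

From finite dimension to an invariant. If any `M + 1` elements of the algebra are dependent, the
generators `X_k`, truncated to `t, …, t_M`, have generic rank at most `M`; brackets play no role
here. A maximal independent choice of generators is a frame (`exists_isFrame`). Frobenius' theorem
is replaced by an explicit chart: rows near a solution are parametrised by the column values at
heights `-κ i`, `i ∈ I`, and by directions in the row at height `-n`. A coordinate `F₀` of the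
second kind is constant along the first ones, which are exactly the frame directions
(`IsFrame.exists_germ`). Two things remain. The span of the `X_k` might depend on values below the
row, which `F₀` does not see; and `F₀` must also be killed by derivatives with respect to values
above. Both follow from a dimension count, `IsFrame.mem_of_rowDeriv_mem`. The derivative `A` of the
upper shift maps the span at height `v` into the vectors of the span at `v + 1` with entry `0` zero.
These form a proper subspace, as `X_1` has entry `0` equal to one. Where the ranks agree, the span
at `v` must therefore contain the kernel of `A`, and it is the full preimage of the span at `v + 1`.
Climbing `n` steps and returning shows that values below do not matter
(`IsFrame.charVec_mem_of_row_eq`), and pulling back the kernel gives the derivatives from above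
(`IsFrame.charVecInv_mem`). Then `F₀` is spread to all heights by `transport`.

From an invariant to finite dimension. Applying the shift often enough removes the column variables
(`IsInvariantNear.eventually_eq`), leaving germs `G v` of functions of rows. Since `G 0` after `k`
upper shifts equals `G (-k)` of the initial row, every `X_k` kills `G 0`, and so does the whole
algebra, also for the horizontal translates of `G 0`. Among `M + 2` elements some nontrivial
combination `z`, with functions as coefficients, has vanishing components `0, …, M`. The translates
of `G 0`, whose last effective variable is `t_{m + j₀}`, then force all further components of `z` to
vanish one after another.

Passing from generic to all solutions always uses the identity theorem on the connected range of
finitely many variables (`IsCyl.eq_zero_of_eventually`). -/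

namespace DiscreteHyperbolic

/-! ### Translates of solutions and the one-step shifts of finite rows -/

section Basics

variable {𝕜 : Type*} [RCLike 𝕜] {f g r s : 𝕜 → 𝕜 → 𝕜 → 𝕜} {Γ : Set (𝕜 × 𝕜 × 𝕜 × 𝕜)}
  {τ : ℤ → ℤ → 𝕜}

/-- The translate of a lattice function by `(m, v)`. -/
def shift (m v : ℤ) (τ : ℤ → ℤ → 𝕜) : ℤ → ℤ → 𝕜 := fun i j => τ (i + m) (j + v)

theorem shift_mem (hτ : τ ∈ solutions Γ) (m v : ℤ) : shift m v τ ∈ solutions Γ := by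
  intro i j
  have := hτ (i + m) (j + v)
  simpa [shift, add_right_comm] using this

theorem nextRow_congr {a a' : ℕ → 𝕜} {b : 𝕜} {j : ℕ} (h : ∀ i ≤ j, a i = a' i) :
    nextRow f a b j = nextRow f a' b j := by
  induction j with
  | zero => rfl
  | succ j ih =>
    simp only [nextRow]
    rw [h j (by omega), h (j + 1) le_rfl, ih fun i hi => h i (by omega)]

theorem nextRow_solution (hyp : IsHyperbolic f g r s Γ) (hτ : τ ∈ solutions Γ) {v : ℤ}
    {a : ℕ → 𝕜} {b : 𝕜} {j : ℕ} (ha : ∀ i ≤ j, a i = τ i v) (hb : b = τ 0 (v + 1)) :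
    nextRow f a b j = τ j (v + 1) := by
  induction j with
  | zero => simpa [nextRow] using hb
  | succ j ih =>
    simp only [nextRow]
    rw [ih fun i hi => ha i (by omega), ha j (by omega), ha (j + 1) le_rfl]
    have := hyp.eq_f _ _ _ _ (hτ j v)
    push_cast
    exact this.symm

theorem prevRow_solution (hyp : IsHyperbolic f g r s Γ) (hτ : τ ∈ solutions Γ) {v : ℤ}
    {a : ℕ → 𝕜} {c : 𝕜} {j : ℕ} (ha : ∀ i ≤ j, a i = τ i (v + 1)) (hc : c = τ 0 v) :
    prevRow g a c j = τ j v := by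
  induction j with
  | zero => simpa [prevRow] using hc
  | succ j ih =>
    simp only [prevRow]
    rw [ih fun i hi => ha i (by omega), ha j (by omega), ha (j + 1) le_rfl]
    have := hyp.eq_g _ _ _ _ (hτ j v)
    push_cast
    exact this.symm

/-- A property of functions of a parameter that is stable under substitution into `f`
passes to the entries of `nextRow`. -/
theorem nextRow_property {P : Type*} (Q : (P → 𝕜) → Prop) (p₀ : P)
    (hQ : ∀ t tu tv tuv, (t, tu, tv, tuv) ∈ Γ → ∀ H₁ H₂ H₃ : P → 𝕜, Q H₁ → Q H₂ → Q H₃ →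
      H₁ p₀ = t → H₂ p₀ = tu → H₃ p₀ = tv → Q (fun p => f (H₁ p) (H₂ p) (H₃ p)))
    (hyp : IsHyperbolic f g r s Γ) (hτ : τ ∈ solutions Γ) {v : ℤ}
    {a : P → ℕ → 𝕜} {b : P → 𝕜} {j : ℕ} (ha : ∀ i ≤ j, Q (fun p => a p i)) (hb : Q b)
    (ha₀ : ∀ i ≤ j, a p₀ i = τ i v) (hb₀ : b p₀ = τ 0 (v + 1)) :
    Q (fun p => nextRow f (a p) (b p) j) := by
  induction j with
  | zero => exact hb
  | succ j ih =>
    refine hQ _ _ _ _ (hτ j v) _ _ _ (ha j (by omega)) (ha (j + 1) le_rfl)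
      (ih (fun i hi => ha i (by omega)) (fun i hi => ha₀ i (by omega))) (ha₀ j (by omega))
      (by simpa using ha₀ (j + 1) le_rfl)
      (nextRow_solution hyp hτ (fun i hi => ha₀ i (by omega)) hb₀)

/-- A property of functions of a parameter that is stable under substitution into `g`
passes to the entries of `prevRow`. -/
theorem prevRow_property {P : Type*} (Q : (P → 𝕜) → Prop) (p₀ : P)
    (hQ : ∀ t tu tv tuv, (t, tu, tv, tuv) ∈ Γ → ∀ H₁ H₂ H₃ : P → 𝕜, Q H₁ → Q H₂ → Q H₃ →
      H₁ p₀ = t → H₂ p₀ = tv → H₃ p₀ = tuv → Q (fun p => g (H₁ p) (H₂ p) (H₃ p)))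
    (hyp : IsHyperbolic f g r s Γ) (hτ : τ ∈ solutions Γ) {v : ℤ}
    {a : P → ℕ → 𝕜} {c : P → 𝕜} {j : ℕ} (ha : ∀ i ≤ j, Q (fun p => a p i)) (hc : Q c)
    (ha₀ : ∀ i ≤ j, a p₀ i = τ i (v + 1)) (hc₀ : c p₀ = τ 0 v) :
    Q (fun p => prevRow g (a p) (c p) j) := by
  induction j with
  | zero => exact hc
  | succ j ih =>
    refine hQ _ _ _ _ (hτ j v) _ _ _
      (ih (fun i hi => ha i (by omega)) (fun i hi => ha₀ i (by omega)))
      (ha j (by omega)) (ha (j + 1) le_rfl)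
      (prevRow_solution hyp hτ (fun i hi => ha₀ i (by omega)) hc₀)
      (ha₀ j (by omega)) (by simpa using ha₀ (j + 1) le_rfl)

section Substitution

variable {P : Type*} {p₀ : P} {H₁ H₂ H₃ : P → 𝕜} {t tu tv tuv : 𝕜}

theorem IsHyperbolic.analyticAt_comp_f [NormedAddCommGroup P] [NormedSpace 𝕜 P]
    (hyp : IsHyperbolic f g r s Γ) (h : (t, tu, tv, tuv) ∈ Γ)
    (h₁ : AnalyticAt 𝕜 H₁ p₀) (h₂ : AnalyticAt 𝕜 H₂ p₀) (h₃ : AnalyticAt 𝕜 H₃ p₀)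
    (e₁ : H₁ p₀ = t) (e₂ : H₂ p₀ = tu) (e₃ : H₃ p₀ = tv) :
    AnalyticAt 𝕜 (fun p => f (H₁ p) (H₂ p) (H₃ p)) p₀ := by
  subst e₁ e₂ e₃
  exact AnalyticAt.fun_comp (f := fun p => (H₁ p, H₂ p, H₃ p))
    (hyp.analytic_f _ _ _ _ h) (h₁.prod (h₂.prod h₃))

theorem IsHyperbolic.analyticAt_comp_g [NormedAddCommGroup P] [NormedSpace 𝕜 P]
    (hyp : IsHyperbolic f g r s Γ) (h : (t, tu, tv, tuv) ∈ Γ)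
    (h₁ : AnalyticAt 𝕜 H₁ p₀) (h₂ : AnalyticAt 𝕜 H₂ p₀) (h₃ : AnalyticAt 𝕜 H₃ p₀)
    (e₁ : H₁ p₀ = t) (e₂ : H₂ p₀ = tv) (e₃ : H₃ p₀ = tuv) :
    AnalyticAt 𝕜 (fun p => g (H₁ p) (H₂ p) (H₃ p)) p₀ := by
  subst e₁ e₂ e₃
  exact AnalyticAt.fun_comp (f := fun p => (H₁ p, H₂ p, H₃ p))
    (hyp.analytic_g _ _ _ _ h) (h₁.prod (h₂.prod h₃))

theorem IsHyperbolic.continuousAt_comp_g [TopologicalSpace P]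
    (hyp : IsHyperbolic f g r s Γ) (h : (t, tu, tv, tuv) ∈ Γ)
    (h₁ : ContinuousAt H₁ p₀) (h₂ : ContinuousAt H₂ p₀) (h₃ : ContinuousAt H₃ p₀)
    (e₁ : H₁ p₀ = t) (e₂ : H₂ p₀ = tv) (e₃ : H₃ p₀ = tuv) :
    ContinuousAt (fun p => g (H₁ p) (H₂ p) (H₃ p)) p₀ := by
  subst e₁ e₂ e₃
  exact ContinuousAt.comp (f := fun p => (H₁ p, H₂ p, H₃ p))
    (g := fun p : 𝕜 × 𝕜 × 𝕜 => g p.1 p.2.1 p.2.2)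
    (hyp.analytic_g _ _ _ _ h).continuousAt (h₁.prodMk (h₂.prodMk h₃))

end Substitution

/-- The extension by zero of a finite row. -/
def extendRow {M : ℕ} (a : Fin (M + 1) → 𝕜) : ℕ → 𝕜 :=
  fun i => if h : i < M + 1 then a ⟨i, h⟩ else 0

theorem extendRow_apply {M : ℕ} (a : Fin (M + 1) → 𝕜) {i : ℕ} (h : i < M + 1) :
    extendRow a i = a ⟨i, h⟩ := by
  simp [extendRow, h]

/-- The upper shift of the first `M + 1` entries of a row. -/
def rowMap (f : 𝕜 → 𝕜 → 𝕜 → 𝕜) {M : ℕ} (p : (Fin (M + 1) → 𝕜) × 𝕜) : Fin (M + 1) → 𝕜 :=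
  fun j => nextRow f (extendRow p.1) p.2 j

/-- The lower shift of the first `M + 1` entries of a row. -/
def rowMapInv (g : 𝕜 → 𝕜 → 𝕜 → 𝕜) {M : ℕ} (p : (Fin (M + 1) → 𝕜) × 𝕜) : Fin (M + 1) → 𝕜 :=
  fun j => prevRow g (extendRow p.1) p.2 j

/-- The first `M + 1` entries of the row of `τ` at height `v`. -/
def row (τ : ℤ → ℤ → 𝕜) (M : ℕ) (v : ℤ) : Fin (M + 1) → 𝕜 := fun j => τ (j : ℕ) v

/-- Padding with zeros is harmless: entry `j` of the shifted row reads only the entries `0, …, j` of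
the given one. This is why finite rows can be shifted on their own. -/
theorem rowMap_eq {M : ℕ} (a : ℕ → 𝕜) (b : 𝕜) :
    rowMap f ((fun j : Fin (M + 1) => a j), b) = fun j : Fin (M + 1) => nextRow f a b j := by
  funext j
  refine nextRow_congr fun i hi => ?_
  rw [extendRow_apply _ (by omega)]

@[simp] theorem rowMap_zero {M : ℕ} (p : (Fin (M + 1) → 𝕜) × 𝕜) : rowMap f p 0 = p.2 := by
  simp [rowMap, nextRow]

theorem extendRow_row {M : ℕ} {v : ℤ} {i : ℕ} (h : i < M + 1) :
    extendRow (row τ M v) i = τ i v := by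
  rw [extendRow_apply _ h]; rfl

theorem rowMap_row (hyp : IsHyperbolic f g r s Γ) (hτ : τ ∈ solutions Γ) (M : ℕ) (v : ℤ) :
    rowMap f (row τ M v, τ 0 (v + 1)) = row τ M (v + 1) := by
  funext j
  exact nextRow_solution hyp hτ (fun i hi => extendRow_row (by omega)) rfl

theorem rowMapInv_row (hyp : IsHyperbolic f g r s Γ) (hτ : τ ∈ solutions Γ) (M : ℕ) (v : ℤ) :
    rowMapInv g (row τ M (v + 1), τ 0 v) = row τ M v := by
  funext j
  exact prevRow_solution hyp hτ (fun i hi => extendRow_row (by omega)) rfl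

theorem analyticAt_extendRow {M : ℕ} {i : ℕ} (h : i < M + 1) (p : (Fin (M + 1) → 𝕜) × 𝕜) :
    AnalyticAt 𝕜 (fun p : (Fin (M + 1) → 𝕜) × 𝕜 => extendRow p.1 i) p := by
  simp only [extendRow_apply _ h]
  exact ((ContinuousLinearMap.proj (R := 𝕜) (φ := fun _ : Fin (M + 1) => 𝕜) ⟨i, h⟩).comp
    (ContinuousLinearMap.fst 𝕜 _ 𝕜)).analyticAt p

theorem analyticAt_rowMap (hyp : IsHyperbolic f g r s Γ) (hτ : τ ∈ solutions Γ) (M : ℕ) (v : ℤ) :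
    AnalyticAt 𝕜 (rowMap f (M := M)) (row τ M v, τ 0 (v + 1)) := by
  refine analyticAt_pi_iff.2 fun j => ?_
  refine nextRow_property (AnalyticAt 𝕜 · (row τ M v, τ 0 (v + 1))) _
    (fun _ _ _ _ h _ _ _ => hyp.analyticAt_comp_f h) hyp hτ
    (fun i hi => analyticAt_extendRow (by omega) _) analyticAt_snd
    (fun i hi => extendRow_row (by omega)) rfl

theorem analyticAt_rowMapInv (hyp : IsHyperbolic f g r s Γ) (hτ : τ ∈ solutions Γ) (M : ℕ)
    (v : ℤ) : AnalyticAt 𝕜 (rowMapInv g (M := M)) (row τ M (v + 1), τ 0 v) := by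
  refine analyticAt_pi_iff.2 fun j => ?_
  refine prevRow_property (AnalyticAt 𝕜 · (row τ M (v + 1), τ 0 v)) _
    (fun _ _ _ _ h _ _ _ => hyp.analyticAt_comp_g h) hyp hτ
    (fun i hi => analyticAt_extendRow (by omega) _) analyticAt_snd
    (fun i hi => extendRow_row (by omega)) rfl

end Basics

/-! ### Analytic functions of the dynamical variables and the identity theorem -/

section Cylinder

variable {𝕜 : Type*} [RCLike 𝕜] {f g r s : 𝕜 → 𝕜 → 𝕜 → 𝕜} {Γ : Set (𝕜 × 𝕜 × 𝕜 × 𝕜)}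
  {τ : ℤ → ℤ → 𝕜} {V V' : Type*} [NormedAddCommGroup V] [NormedSpace 𝕜 V]
  [NormedAddCommGroup V'] [NormedSpace 𝕜 V']

/-- The values of `τ` on a finite subset of the lattice. -/
def restr (S : Finset (ℤ × ℤ)) (τ : ℤ → ℤ → 𝕜) : S → 𝕜 := fun p => τ p.1.1 p.1.2

/-- Functions of a solution that are analytic functions of finitely many of its values on the
coordinate cross. -/
def IsCyl (Γ : Set (𝕜 × 𝕜 × 𝕜 × 𝕜)) (H : (ℤ → ℤ → 𝕜) → V) : Prop :=
  ∃ S : Finset (ℤ × ℤ), (∀ p ∈ S, p.1 = 0 ∨ p.2 = 0) ∧ ∃ φ : (S → 𝕜) → V,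
    ∀ τ ∈ solutions Γ, AnalyticAt 𝕜 φ (restr S τ) ∧ H τ = φ (restr S τ)

/-- Restriction of families to a smaller finite set, as a continuous linear map. -/
def subRestr (𝕜 : Type*) [RCLike 𝕜] {α : Type*} {S S' : Finset α} (h : S ⊆ S') :
    (S' → 𝕜) →L[𝕜] (S → 𝕜) :=
  ContinuousLinearMap.pi fun p => ContinuousLinearMap.proj (⟨p.1, h p.2⟩ : S')

theorem IsCyl.comp {H : (ℤ → ℤ → 𝕜) → V} (hH : IsCyl Γ H) {h : V → V'}
    (hh : ∀ τ ∈ solutions Γ, AnalyticAt 𝕜 h (H τ)) : IsCyl Γ (fun τ => h (H τ)) := by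
  obtain ⟨S, hS, φ, hφ⟩ := hH
  refine ⟨S, hS, fun z => h (φ z), fun τ hτ => ⟨?_, congrArg h (hφ τ hτ).2⟩⟩
  have := hh τ hτ
  rw [(hφ τ hτ).2] at this
  exact this.fun_comp (hφ τ hτ).1

theorem IsCyl.prodMk {H : (ℤ → ℤ → 𝕜) → V} {G : (ℤ → ℤ → 𝕜) → V'} (hH : IsCyl Γ H)
    (hG : IsCyl Γ G) : IsCyl Γ (fun τ => (H τ, G τ)) := by
  obtain ⟨S, hS, φ, hφ⟩ := hH
  obtain ⟨S', hS', ψ, hψ⟩ := hG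
  classical
  refine ⟨S ∪ S', fun p hp => ?_, fun z => (φ (subRestr 𝕜 Finset.subset_union_left z),
    ψ (subRestr 𝕜 Finset.subset_union_right z)), fun τ hτ => ⟨?_, ?_⟩⟩
  · rcases Finset.mem_union.1 hp with h | h
    · exact hS p h
    · exact hS' p h
  · exact (AnalyticAt.fun_comp (f := subRestr 𝕜 Finset.subset_union_left) (hφ τ hτ).1
      (ContinuousLinearMap.analyticAt _ _)).prod
      (AnalyticAt.fun_comp (f := subRestr 𝕜 Finset.subset_union_right) (hψ τ hτ).1
      (ContinuousLinearMap.analyticAt _ _))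
  · exact Prod.ext (hφ τ hτ).2 (hψ τ hτ).2

theorem IsCyl.const (c : V) : IsCyl Γ (fun _ : ℤ → ℤ → 𝕜 => c) :=
  ⟨∅, by simp, fun _ => c, fun _ _ => ⟨analyticAt_const, rfl⟩⟩

theorem IsCyl.eval {p : ℤ × ℤ} (hp : p.1 = 0 ∨ p.2 = 0) :
    IsCyl Γ (fun τ : ℤ → ℤ → 𝕜 => τ p.1 p.2) := by
  refine ⟨{p}, by simpa using hp, fun z => z ⟨p, by simp⟩, fun τ _ => ⟨?_, rfl⟩⟩
  exact (ContinuousLinearMap.proj (R := 𝕜) (φ := fun _ : ({p} : Finset (ℤ × ℤ)) => 𝕜)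
    ⟨p, by simp⟩).analyticAt _

theorem IsCyl.pi {ι : Type*} [Fintype ι] {H : ι → (ℤ → ℤ → 𝕜) → 𝕜} (hH : ∀ i, IsCyl Γ (H i)) :
    IsCyl Γ (fun τ i => H i τ) := by
  choose S hS φ hφ using hH
  classical
  have hsub : ∀ i, S i ⊆ Finset.univ.biUnion S := fun i =>
    Finset.subset_biUnion_of_mem S (Finset.mem_univ i)
  refine ⟨Finset.univ.biUnion S, fun p hp => ?_, fun z i => φ i (subRestr 𝕜 (hsub i) z),
    fun τ hτ => ⟨analyticAt_pi_iff.2 fun i => ?_, ?_⟩⟩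
  · obtain ⟨i, -, hi⟩ := Finset.mem_biUnion.1 hp
    exact hS i p hi
  · exact AnalyticAt.fun_comp (f := subRestr 𝕜 (hsub i)) (hφ i τ hτ).1
      (ContinuousLinearMap.analyticAt _ _)
  · funext i
    exact (hφ i τ hτ).2

/-- The identity theorem: an analytic function of the dynamical variables that vanishes near some
values of finitely many of them vanishes identically. -/
theorem IsCyl.eq_zero_of_eventually (hind : HasIndependentVariables Γ) {H : (ℤ → ℤ → 𝕜) → 𝕜}
    (hH : IsCyl Γ H) {S : Finset (ℤ × ℤ)} (hS : ∀ p ∈ S, p.1 = 0 ∨ p.2 = 0)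
    {τ₀ : ℤ → ℤ → 𝕜} (hτ₀ : τ₀ ∈ solutions Γ)
    (h : ∀ᶠ z in 𝓝 (restr S τ₀), ∀ τ ∈ solutions Γ, restr S τ = z → H τ = 0) :
    ∀ τ ∈ solutions Γ, H τ = 0 := by
  obtain ⟨S', hS', φ, hφ⟩ := hH
  classical
  have hU : ∀ p ∈ S ∪ S', p.1 = 0 ∨ p.2 = 0 := by
    intro p hp
    rcases Finset.mem_union.1 hp with h | h
    · exact hS p h
    · exact hS' p h
  -- Both the variables of `H` and those of the hypothesis are placed in one finite set, whose range
  -- of values is open and connected; the identity theorem is applied there.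
  obtain ⟨ho, hc⟩ := hind (S ∪ S') hU
  set Ω : Set ((S ∪ S' : Finset (ℤ × ℤ)) → 𝕜) := restr (S ∪ S') '' solutions Γ with hΩ
  set ψ : ((S ∪ S' : Finset (ℤ × ℤ)) → 𝕜) → 𝕜 :=
    fun z => φ (subRestr 𝕜 Finset.subset_union_right z) with hψ
  have hψa : AnalyticOnNhd 𝕜 ψ Ω := by
    rintro _ ⟨τ, hτ, rfl⟩
    exact AnalyticAt.fun_comp (f := subRestr 𝕜 Finset.subset_union_right) (hφ τ hτ).1
      (ContinuousLinearMap.analyticAt _ _)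
  have hψτ : ∀ τ ∈ solutions Γ, H τ = ψ (restr (S ∪ S') τ) := fun τ hτ => (hφ τ hτ).2
  have hev : ψ =ᶠ[𝓝 (restr (S ∪ S') τ₀)] 0 := by
    have h1 : Filter.Tendsto (subRestr 𝕜 (Finset.subset_union_left (s₁ := S) (s₂ := S')))
        (𝓝 (restr (S ∪ S') τ₀)) (𝓝 (restr S τ₀)) :=
      (ContinuousLinearMap.continuous _).tendsto _
    filter_upwards [h1.eventually h, ho.mem_nhds ⟨τ₀, hτ₀, rfl⟩] with z hz hzΩ
    obtain ⟨τ, hτ, rfl⟩ := hzΩ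
    have := hz τ hτ rfl
    rw [hψτ τ hτ] at this
    exact this
  have := hψa.eqOn_zero_of_preconnected_of_eventuallyEq_zero hc.isPreconnected
    ⟨τ₀, hτ₀, rfl⟩ hev
  intro τ hτ
  rw [hψτ τ hτ]
  exact this ⟨τ, hτ, rfl⟩

/-- The functions of the dynamical variables have no zero divisors: `H` vanishes wherever `G` does
not, in particular near `τ₀`, hence everywhere. -/
theorem IsCyl.eq_zero_of_mul_eq_zero (hind : HasIndependentVariables Γ)
    {H G : (ℤ → ℤ → 𝕜) → 𝕜} (hH : IsCyl Γ H) (hG : IsCyl Γ G)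
    (h : ∀ τ ∈ solutions Γ, H τ * G τ = 0) {τ₀ : ℤ → ℤ → 𝕜} (hτ₀ : τ₀ ∈ solutions Γ)
    (hG₀ : G τ₀ ≠ 0) : ∀ τ ∈ solutions Γ, H τ = 0 := by
  obtain ⟨S, hS, φ, hφ⟩ := hG
  refine hH.eq_zero_of_eventually hind hS hτ₀ ?_
  rw [(hφ τ₀ hτ₀).2] at hG₀
  filter_upwards [(hφ τ₀ hτ₀).1.continuousAt.eventually_ne hG₀] with z hz τ hτ hzτ
  have h1 := h τ hτ
  rw [(hφ τ hτ).2, hzτ] at h1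
  exact (mul_eq_zero.1 h1).resolve_right hz

theorem solutions_nonempty (hind : HasIndependentVariables Γ) : (solutions Γ).Nonempty :=
  (hind ∅ (by simp)).2.nonempty.of_image

/-- Values of finitely many dynamical variables close to those of a solution are values of a
solution. -/
theorem eventually_exists_solution (hind : HasIndependentVariables Γ) (hτ : τ ∈ solutions Γ)
    {P : Type*} [TopologicalSpace P] {p₀ : P} (S : Finset (ℤ × ℤ))
    (hS : ∀ q ∈ S, q.1 = 0 ∨ q.2 = 0) (c : P → ℤ × ℤ → 𝕜)
    (hc : ∀ q ∈ S, ContinuousAt (fun p => c p q) p₀) (hc₀ : ∀ q ∈ S, c p₀ q = τ q.1 q.2) :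
    ∀ᶠ p in 𝓝 p₀, ∃ τ' ∈ solutions Γ, ∀ q ∈ S, τ' q.1 q.2 = c p q := by
  have h1 : Filter.Tendsto (fun p (q : S) => c p q) (𝓝 p₀) (𝓝 (restr S τ)) := by
    rw [tendsto_pi_nhds]
    intro q
    have := (hc q q.2).tendsto
    rw [hc₀ q q.2] at this
    exact this
  filter_upwards [h1.eventually ((hind S hS).1.mem_nhds ⟨τ, hτ, rfl⟩)] with p hp
  obtain ⟨τ', hτ', h⟩ := hp
  exact ⟨τ', hτ', fun q hq => congrFun h ⟨q, hq⟩⟩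

/-- A row at height `v` and finitely many values of the column `u = 0`, close to those of a
solution, belong to a solution. -/
theorem eventually_exists_row (hind : HasIndependentVariables Γ) (hτ : τ ∈ solutions Γ)
    {P : Type*} [TopologicalSpace P] {p₀ : P} (M n : ℕ) (v : ℤ)
    {a : P → Fin (M + 1) → 𝕜} {b : P → ℤ → 𝕜} (ha : ContinuousAt a p₀)
    (hb : ∀ i, |i - v| ≤ n → ContinuousAt (fun p => b p i) p₀) (ha₀ : a p₀ = row τ M v)
    (hb₀ : ∀ i, |i - v| ≤ n → b p₀ i = τ 0 i) (hab : ∀ p, a p 0 = b p v) :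
    ∀ᶠ p in 𝓝 p₀, ∃ τ' ∈ solutions Γ, row τ' M v = a p ∧ ∀ i, |i - v| ≤ n → τ' 0 i = b p i := by
  classical
  let S : Finset (ℤ × ℤ) := (Finset.range (M + 1)).image (fun j : ℕ => ((j : ℤ), (0 : ℤ))) ∪
    (Finset.Icc (-(n : ℤ)) n).image (fun i : ℤ => ((0 : ℤ), i))
  have hS : ∀ q ∈ S, (q.2 = 0 ∧ ∃ j : ℕ, j < M + 1 ∧ q.1 = j) ∨ (q.1 = 0 ∧ |q.2| ≤ n) := by
    intro q hq
    rcases Finset.mem_union.1 hq with h | h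
    · obtain ⟨j, hj, rfl⟩ := Finset.mem_image.1 h
      exact Or.inl ⟨rfl, j, by simpa using hj, rfl⟩
    · obtain ⟨i, hi, rfl⟩ := Finset.mem_image.1 h
      exact Or.inr ⟨rfl, by simpa [abs_le] using hi⟩
  -- Independence is assumed on the cross through the origin only, so the solution is translated
  -- vertically by `v` and the result translated back. The corner belongs to both arms; the column
  -- value is prescribed there, and `hab` makes it agree with the row.
  have key := eventually_exists_solution (p₀ := p₀) hind (shift_mem hτ 0 v) S
    (fun q hq => (hS q hq).elim (fun h => Or.inr h.1) (fun h => Or.inl h.1))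
    (fun p q => if q.1 = 0 then b p (q.2 + v) else extendRow (a p) q.1.toNat) ?_ ?_
  · filter_upwards [key] with p hp
    obtain ⟨τ', hτ', h⟩ := hp
    have hcol : ∀ i, |i - v| ≤ n → shift 0 (-v) τ' 0 i = b p i := by
      intro i hi
      have := h (0, i - v) (Finset.mem_union_right _ (Finset.mem_image.2
        ⟨i - v, by simpa [abs_le] using hi, rfl⟩))
      simpa [shift, sub_eq_add_neg] using this
    refine ⟨shift 0 (-v) τ', shift_mem hτ' 0 (-v), ?_, hcol⟩
    funext j
    by_cases hj : j = 0
    · subst hj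
      rw [hab]
      exact hcol v (by simp)
    · have := h ((j : ℕ), 0) (Finset.mem_union_left _ (Finset.mem_image.2
        ⟨j, Finset.mem_range.2 j.2, rfl⟩))
      have hj' : ((j : ℕ) : ℤ) ≠ 0 := fun h0 => hj (by exact_mod_cast h0)
      simp only [hj', if_false, Int.toNat_natCast, extendRow_apply _ j.2] at this
      simpa [row, shift] using this
  · intro q hq
    by_cases h0 : q.1 = 0
    · simp only [h0, if_true]
      refine hb _ ?_
      rcases hS q hq with h | h
      · simp [h.1]
      · simpa using h.2
    · simp only [h0, if_false]
      obtain ⟨j, hj, hj'⟩ := ((hS q hq).resolve_right fun h => h0 h.1).2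
      rw [hj']
      simp only [Int.toNat_natCast, extendRow_apply _ hj]
      exact continuousAt_pi.1 ha _
  · intro q hq
    by_cases h0 : q.1 = 0
    · simp only [h0, if_true]
      rw [hb₀]
      · simp [shift]
      rcases hS q hq with h | h
      · simp [h.1]
      · simpa using h.2
    · simp only [h0, if_false]
      obtain ⟨h2, j, hj, hj'⟩ := (hS q hq).resolve_right fun h => h0 h.1
      rw [hj', h2]
      simp only [Int.toNat_natCast, extendRow_apply _ hj, ha₀]
      simp [row, shift]

/-- Each step up or down from height `0` is an analytic map that reads one further value of the
column `u = 0`. -/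
theorem IsCyl.row (hyp : IsHyperbolic f g r s Γ) (M : ℕ) (v : ℤ) :
    IsCyl Γ (fun τ : ℤ → ℤ → 𝕜 => row τ M v) := by
  have congr : ∀ {H G : (ℤ → ℤ → 𝕜) → Fin (M + 1) → 𝕜}, IsCyl Γ H →
      (∀ τ ∈ solutions Γ, G τ = H τ) → IsCyl Γ G := by
    rintro H G ⟨S, hS, φ, hφ⟩ h
    exact ⟨S, hS, φ, fun τ hτ => ⟨(hφ τ hτ).1, (h τ hτ).trans (hφ τ hτ).2⟩⟩
  induction v using Int.induction_on with
  | zero =>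
    exact IsCyl.pi (H := fun (j : Fin (M + 1)) (τ : ℤ → ℤ → 𝕜) => τ (j : ℕ) 0) fun j => IsCyl.eval (p := ((j : ℕ), 0)) (Or.inr rfl)
  | succ i ih =>
    refine congr (H := fun τ => rowMap f (DiscreteHyperbolic.row τ M i, τ 0 (i + 1))) ?_
      fun τ hτ => (rowMap_row hyp hτ M i).symm
    exact (ih.prodMk (IsCyl.eval (p := (0, (i : ℤ) + 1)) (Or.inl rfl))).comp
      fun τ hτ => analyticAt_rowMap hyp hτ M i
  | pred i ih =>
    refine congr
      (H := fun τ => rowMapInv g (DiscreteHyperbolic.row τ M (-i), τ 0 (-i - 1))) ?_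
      fun τ hτ => ?_
    · exact (ih.prodMk (IsCyl.eval (p := (0, -(i : ℤ) - 1)) (Or.inl rfl))).comp
        fun τ hτ => by simpa using analyticAt_rowMapInv hyp hτ M (-i - 1)
    · simpa using (rowMapInv_row hyp hτ M (-i - 1)).symm

theorem IsCyl.col (v : ℤ) : IsCyl Γ (fun τ : ℤ → ℤ → 𝕜 => τ 0 v) :=
  IsCyl.eval (p := (0, v)) (Or.inl rfl)

end Cylinder

/-! ### Derivatives of the row shifts and the vectors of the fields `X_k` -/

section Vectors

variable {𝕜 : Type*} [RCLike 𝕜] {f g r s : 𝕜 → 𝕜 → 𝕜 → 𝕜} {Γ : Set (𝕜 × 𝕜 × 𝕜 × 𝕜)}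
  {τ : ℤ → ℤ → 𝕜} {M : ℕ}

/-- The derivative of the upper shift of rows with respect to the row, along `τ`. -/
noncomputable def rowDeriv (f : 𝕜 → 𝕜 → 𝕜 → 𝕜) (τ : ℤ → ℤ → 𝕜) (M : ℕ) (v : ℤ) :
    (Fin (M + 1) → 𝕜) →L[𝕜] (Fin (M + 1) → 𝕜) :=
  (fderiv 𝕜 (rowMap f) (row τ M v, τ 0 (v + 1))).comp (ContinuousLinearMap.inl 𝕜 _ 𝕜)

/-- The derivative of the upper shift of rows with respect to `t_v`, along `τ`. -/
noncomputable def colDeriv (f : 𝕜 → 𝕜 → 𝕜 → 𝕜) (τ : ℤ → ℤ → 𝕜) (M : ℕ) (v : ℤ) :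
    Fin (M + 1) → 𝕜 :=
  fderiv 𝕜 (rowMap f) (row τ M v, τ 0 (v + 1)) (0, 1)

/-- The derivative of the lower shift of rows with respect to the row, along `τ`. -/
noncomputable def rowDerivInv (g : 𝕜 → 𝕜 → 𝕜 → 𝕜) (τ : ℤ → ℤ → 𝕜) (M : ℕ) (v : ℤ) :
    (Fin (M + 1) → 𝕜) →L[𝕜] (Fin (M + 1) → 𝕜) :=
  (fderiv 𝕜 (rowMapInv g) (row τ M (v + 1), τ 0 v)).comp (ContinuousLinearMap.inl 𝕜 _ 𝕜)

/-- The derivative of the lower shift of rows with respect to the new value, along `τ`. -/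
noncomputable def colDerivInv (g : 𝕜 → 𝕜 → 𝕜 → 𝕜) (τ : ℤ → ℤ → 𝕜) (M : ℕ) (v : ℤ) :
    Fin (M + 1) → 𝕜 :=
  fderiv 𝕜 (rowMapInv g) (row τ M (v + 1), τ 0 v) (0, 1)

/-- The first `M + 1` coefficients of `X_{k+1}` at height `v` along `τ`: the derivative of the row
at height `v` with respect to the value of the column `u = 0` at height `v - k`. -/
noncomputable def charVec (f : 𝕜 → 𝕜 → 𝕜 → 𝕜) (τ : ℤ → ℤ → 𝕜) (M : ℕ) :
    ℕ → ℤ → Fin (M + 1) → 𝕜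
  | 0, v => colDeriv f τ M (v - 1)
  | k + 1, v => rowDeriv f τ M (v - 1) (charVec f τ M k (v - 1))

/-- The derivative of the row at height `v` with respect to the value of the column `u = 0` at
height `v + k`, with the row at height `v + k + 1` fixed. -/
noncomputable def charVecInv (g : 𝕜 → 𝕜 → 𝕜 → 𝕜) (τ : ℤ → ℤ → 𝕜) (M : ℕ) :
    ℕ → ℤ → Fin (M + 1) → 𝕜
  | 0, v => colDerivInv g τ M v
  | k + 1, v => rowDerivInv g τ M v (charVecInv g τ M k (v + 1))

theorem fderiv_rowMap_apply (v : ℤ) (w : Fin (M + 1) → 𝕜) (β : 𝕜) :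
    fderiv 𝕜 (rowMap f) (row τ M v, τ 0 (v + 1)) (w, β) =
      rowDeriv f τ M v w + β • colDeriv f τ M v := by
  simp only [rowDeriv, colDeriv, ← map_smul, ContinuousLinearMap.comp_apply,
    ContinuousLinearMap.inl_apply, ← map_add]
  simp

theorem fderiv_rowMapInv_apply (v : ℤ) (w : Fin (M + 1) → 𝕜) (β : 𝕜) :
    fderiv 𝕜 (rowMapInv g) (row τ M (v + 1), τ 0 v) (w, β) =
      rowDerivInv g τ M v w + β • colDerivInv g τ M v := by
  simp only [rowDerivInv, colDerivInv, ← map_smul, ContinuousLinearMap.comp_apply,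
    ContinuousLinearMap.inl_apply, ← map_add]
  simp

theorem hasFDerivAt_rowMap (hyp : IsHyperbolic f g r s Γ) (hτ : τ ∈ solutions Γ) (M : ℕ) (v : ℤ) :
    HasFDerivAt (rowMap f (M := M))
      (fderiv 𝕜 (rowMap f) (row τ M v, τ 0 (v + 1))) (row τ M v, τ 0 (v + 1)) :=
  (analyticAt_rowMap hyp hτ M v).differentiableAt.hasFDerivAt

theorem hasFDerivAt_rowMapInv (hyp : IsHyperbolic f g r s Γ) (hτ : τ ∈ solutions Γ) (M : ℕ)
    (v : ℤ) : HasFDerivAt (rowMapInv g (M := M))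
      (fderiv 𝕜 (rowMapInv g) (row τ M (v + 1), τ 0 v)) (row τ M (v + 1), τ 0 v) :=
  (analyticAt_rowMapInv hyp hτ M v).differentiableAt.hasFDerivAt

/-- The chain rule for the upper shift along a curve of rows. -/
theorem hasDerivAt_rowMap (hyp : IsHyperbolic f g r s Γ) (hτ : τ ∈ solutions Γ) {v : ℤ}
    {a : 𝕜 → Fin (M + 1) → 𝕜} {b : 𝕜 → 𝕜} {a' : Fin (M + 1) → 𝕜} {b' y : 𝕜}
    (ha : HasDerivAt a a' y) (hb : HasDerivAt b b' y) (ha₀ : a y = row τ M v)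
    (hb₀ : b y = τ 0 (v + 1)) :
    HasDerivAt (fun y => rowMap f (a y, b y)) (rowDeriv f τ M v a' + b' • colDeriv f τ M v) y := by
  rw [← fderiv_rowMap_apply]
  have h := hasFDerivAt_rowMap hyp hτ M v
  rw [← ha₀, ← hb₀] at h ⊢
  exact h.comp_hasDerivAt y (ha.prodMk hb)

/-- The chain rule for the lower shift along a curve of rows. -/
theorem hasDerivAt_rowMapInv (hyp : IsHyperbolic f g r s Γ) (hτ : τ ∈ solutions Γ) {v : ℤ}
    {a : 𝕜 → Fin (M + 1) → 𝕜} {b : 𝕜 → 𝕜} {a' : Fin (M + 1) → 𝕜} {b' y : 𝕜}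
    (ha : HasDerivAt a a' y) (hb : HasDerivAt b b' y) (ha₀ : a y = row τ M (v + 1))
    (hb₀ : b y = τ 0 v) :
    HasDerivAt (fun y => rowMapInv g (a y, b y))
      (rowDerivInv g τ M v a' + b' • colDerivInv g τ M v) y := by
  rw [← fderiv_rowMapInv_apply]
  have h := hasFDerivAt_rowMapInv hyp hτ M v
  rw [← ha₀, ← hb₀] at h ⊢
  exact h.comp_hasDerivAt y (ha.prodMk hb)

/-- That `f` and `g` undo each other is known only on `Γ`. Near `τ`, however, every pair of a row
and a next value belongs to a solution, along which the two shifts are inverse. The lower shift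
needs the first value of the row it restores, hence `p.1 0`. -/
theorem eventually_rowMapInv_rowMap (hyp : IsHyperbolic f g r s Γ)
    (hind : HasIndependentVariables Γ) (hτ : τ ∈ solutions Γ) (M : ℕ) (v : ℤ) :
    ∀ᶠ p in 𝓝 (row τ M v, τ 0 (v + 1)), rowMapInv g (rowMap f p, p.1 0) = p.1 := by
  have hc : Continuous (fun p : (Fin (M + 1) → 𝕜) × 𝕜 => p.1 0) := by fun_prop
  refine Filter.Eventually.mono (eventually_exists_row (p₀ := (row τ M v, τ 0 (v + 1))) hind hτ M 1 v
    (a := Prod.fst) (b := fun p i => if i = v then p.1 0 else if i = v + 1 then p.2 else τ 0 i)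
    continuousAt_fst ?_ rfl ?_ ?_) fun p hp => ?_
  rotate_left 3
  · obtain ⟨τ', hτ', h1, h2⟩ := hp
    have e1 := h2 v (by simp)
    have e2 := h2 (v + 1) (by simp)
    simp only [if_true] at e1
    simp only [add_eq_left, one_ne_zero, if_false, if_true] at e2
    have := rowMapInv_row hyp hτ' M v
    rw [← rowMap_row hyp hτ' M v, h1, e1, e2] at this
    exact this
  · intro i hi
    by_cases h1 : i = v
    · simpa [h1] using hc.continuousAt
    · by_cases h2 : i = v + 1
      · simpa [h2] using continuousAt_snd
      · simpa [h1, h2] using continuousAt_const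
  · intro i hi
    by_cases h1 : i = v
    · simp [h1, row]
    · by_cases h2 : i = v + 1
      · simp [h2]
      · simp [h1, h2]
  · intro p
    simp

theorem eventually_rowMap_rowMapInv (hyp : IsHyperbolic f g r s Γ)
    (hind : HasIndependentVariables Γ) (hτ : τ ∈ solutions Γ) (M : ℕ) (v : ℤ) :
    ∀ᶠ p in 𝓝 (row τ M (v + 1), τ 0 v), rowMap f (rowMapInv g p, p.1 0) = p.1 := by
  have hc : Continuous (fun p : (Fin (M + 1) → 𝕜) × 𝕜 => p.1 0) := by fun_prop
  refine Filter.Eventually.mono (eventually_exists_row (p₀ := (row τ M (v + 1), τ 0 v)) hind hτ M 1 (v + 1)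
    (a := Prod.fst) (b := fun p i => if i = v + 1 then p.1 0 else if i = v then p.2 else τ 0 i)
    continuousAt_fst ?_ rfl ?_ ?_) fun p hp => ?_
  rotate_left 3
  · obtain ⟨τ', hτ', h1, h2⟩ := hp
    have e1 := h2 (v + 1) (by simp)
    have e2 := h2 v (by simp)
    simp only [if_true] at e1
    simp only [left_eq_add, one_ne_zero, if_false, if_true] at e2
    have := rowMap_row hyp hτ' M v
    rw [← rowMapInv_row hyp hτ' M v, h1, e1, e2] at this
    exact this
  · intro i hi
    by_cases h1 : i = v + 1
    · simpa [h1] using hc.continuousAt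
    · by_cases h2 : i = v
      · simpa [h2] using continuousAt_snd
      · simpa [h1, h2] using continuousAt_const
  · intro i hi
    by_cases h1 : i = v + 1
    · simp [h1, row]
    · by_cases h2 : i = v
      · simp [h2]
      · simp [h1, h2]
  · intro p
    simp

theorem hasDerivAt_line (a w : Fin (M + 1) → 𝕜) :
    HasDerivAt (fun y : 𝕜 => a + y • w) w 0 := by
  simpa using ((hasDerivAt_id (0 : 𝕜)).smul_const w).const_add a

theorem hasDerivAt_line' (a w : 𝕜) : HasDerivAt (fun y : 𝕜 => a + y * w) w 0 := by
  simpa using ((hasDerivAt_id (0 : 𝕜)).mul_const w).const_add a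

/-- The chain rule for the inverse relation along a line. The extra term in `w 0` arises because the
first entry of the restored row is itself an argument of the lower shift. -/
theorem rowDerivInv_rowDeriv (hyp : IsHyperbolic f g r s Γ)
    (hind : HasIndependentVariables Γ) (hτ : τ ∈ solutions Γ) (v : ℤ) (w : Fin (M + 1) → 𝕜)
    (β : 𝕜) :
    rowDerivInv g τ M v (rowDeriv f τ M v w + β • colDeriv f τ M v) +
      w 0 • colDerivInv g τ M v = w := by
  have h1 := hasDerivAt_line (row τ M v) w
  have h2 := hasDerivAt_line' (τ 0 (v + 1)) β
  have h3 := hasDerivAt_rowMap hyp hτ (v := v) h1 h2 (by simp) (by simp)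
  have h4 := hasDerivAt_rowMapInv hyp hτ (v := v) h3 (hasDerivAt_pi.1 h1 0)
    (by simpa using rowMap_row hyp hτ M v) (by simp [row])
  refine h4.unique (h1.congr_of_eventuallyEq ?_)
  have hc : Filter.Tendsto (fun y : 𝕜 => (row τ M v + y • w, τ 0 (v + 1) + y * β)) (𝓝 0)
      (𝓝 (row τ M v, τ 0 (v + 1))) := by
    have : Continuous (fun y : 𝕜 => (row τ M v + y • w, τ 0 (v + 1) + y * β)) := by fun_prop
    simpa using this.tendsto 0
  exact hc.eventually (eventually_rowMapInv_rowMap hyp hind hτ M v)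

theorem rowDeriv_rowDerivInv (hyp : IsHyperbolic f g r s Γ)
    (hind : HasIndependentVariables Γ) (hτ : τ ∈ solutions Γ) (v : ℤ) (w : Fin (M + 1) → 𝕜)
    (β : 𝕜) :
    rowDeriv f τ M v (rowDerivInv g τ M v w + β • colDerivInv g τ M v) +
      w 0 • colDeriv f τ M v = w := by
  have h1 := hasDerivAt_line (row τ M (v + 1)) w
  have h2 := hasDerivAt_line' (τ 0 v) β
  have h3 := hasDerivAt_rowMapInv hyp hτ (v := v) h1 h2 (by simp) (by simp)
  have h4 := hasDerivAt_rowMap hyp hτ (v := v) h3 (hasDerivAt_pi.1 h1 0)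
    (by simpa using rowMapInv_row hyp hτ M v) (by simp [row])
  refine h4.unique (h1.congr_of_eventuallyEq ?_)
  have hc : Filter.Tendsto (fun y : 𝕜 => (row τ M (v + 1) + y • w, τ 0 v + y * β)) (𝓝 0)
      (𝓝 (row τ M (v + 1), τ 0 v)) := by
    have : Continuous (fun y : 𝕜 => (row τ M (v + 1) + y • w, τ 0 v + y * β)) := by fun_prop
    simpa using this.tendsto 0
  exact hc.eventually (eventually_rowMap_rowMapInv hyp hind hτ M v)

/-- The first entry of the upper row is the free value `t_v`, so the old row does not influence it.
-/
theorem rowDeriv_apply_zero (hyp : IsHyperbolic f g r s Γ) (hτ : τ ∈ solutions Γ) (v : ℤ)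
    (w : Fin (M + 1) → 𝕜) : rowDeriv f τ M v w 0 = 0 := by
  have h := hasDerivAt_rowMap hyp hτ (v := v) (hasDerivAt_line (row τ M v) w)
    (hasDerivAt_const (0 : 𝕜) (τ 0 (v + 1))) (by simp) rfl
  have h' := hasDerivAt_pi.1 h 0
  simp only [rowMap_zero] at h'
  simpa using h'.unique (hasDerivAt_const _ _)

theorem colDeriv_apply_zero (hyp : IsHyperbolic f g r s Γ) (hτ : τ ∈ solutions Γ) (v : ℤ) :
    colDeriv f τ M v 0 = 1 := by
  have h := hasDerivAt_rowMap hyp hτ (v := v) (hasDerivAt_const (0 : 𝕜) (row τ M v))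
    (hasDerivAt_line' (τ 0 (v + 1)) 1) (by simp) (by simp)
  have h' := hasDerivAt_pi.1 h 0
  simp only [rowMap_zero] at h'
  simpa using h'.unique (hasDerivAt_line' _ _)

/-- Changing the new lower value while the upper row stays fixed is, by definition, invisible above.
Conversely `eq_smul_of_rowDeriv_eq_zero` shows that nothing else is, so the kernel of `rowDeriv` is
the line of this vector. -/
theorem rowDeriv_colDerivInv (hyp : IsHyperbolic f g r s Γ)
    (hind : HasIndependentVariables Γ) (hτ : τ ∈ solutions Γ) (v : ℤ) :
    rowDeriv f τ M v (colDerivInv g τ M v) = 0 := by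
  simpa using rowDeriv_rowDerivInv hyp hind hτ v (0 : Fin (M + 1) → 𝕜) 1

theorem eq_smul_of_rowDeriv_eq_zero (hyp : IsHyperbolic f g r s Γ)
    (hind : HasIndependentVariables Γ) (hτ : τ ∈ solutions Γ) (v : ℤ) {w : Fin (M + 1) → 𝕜}
    (h : rowDeriv f τ M v w = 0) : w = w 0 • colDerivInv g τ M v := by
  have := rowDerivInv_rowDeriv hyp hind hτ v w 0
  rw [h] at this
  simpa using this.symm

theorem charVec_succ (k : ℕ) (v : ℤ) :
    charVec f τ M (k + 1) (v + 1) = rowDeriv f τ M v (charVec f τ M k v) := by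
  rw [charVec, add_sub_cancel_right]

theorem charVec_zero (v : ℤ) : charVec f τ M 0 (v + 1) = colDeriv f τ M v := by
  rw [charVec, add_sub_cancel_right]

theorem row_shift (w v : ℤ) : row (shift 0 w τ) M v = row τ M (v + w) := by
  funext j; simp [row, shift]

theorem charVec_shift (w : ℤ) (k : ℕ) (v : ℤ) :
    charVec f (shift 0 w τ) M k v = charVec f τ M k (v + w) := by
  induction k generalizing v with
  | zero =>
    simp only [charVec, colDeriv, row_shift]
    simp only [shift, add_zero, sub_add_cancel, show v - 1 + w = v + w - 1 by ring]
  | succ k ih =>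
    simp only [charVec, rowDeriv, row_shift, ih]
    simp only [shift, add_zero, sub_add_cancel, show v - 1 + w = v + w - 1 by ring]

theorem IsCyl.clm_apply {V V' : Type*} [NormedAddCommGroup V] [NormedSpace 𝕜 V]
    [NormedAddCommGroup V'] [NormedSpace 𝕜 V'] {L : (ℤ → ℤ → 𝕜) → V →L[𝕜] V'}
    {w : (ℤ → ℤ → 𝕜) → V} (hL : IsCyl Γ L) (hw : IsCyl Γ w) : IsCyl Γ (fun τ => L τ (w τ)) :=
  (hL.prodMk hw).comp (h := fun p => p.1 p.2)
    fun _ _ => (ContinuousLinearMap.id 𝕜 (V →L[𝕜] V')).analyticAt_bilinear _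

theorem IsCyl.fderiv_rowMap (hyp : IsHyperbolic f g r s Γ) (M : ℕ) (v : ℤ) :
    IsCyl Γ (fun τ => fderiv 𝕜 (rowMap f) (DiscreteHyperbolic.row τ M v, τ 0 (v + 1))) :=
  ((IsCyl.row hyp M v).prodMk (IsCyl.col (v + 1))).comp
    fun _ hτ => (analyticAt_rowMap hyp hτ M v).fderiv

theorem IsCyl.fderiv_rowMapInv (hyp : IsHyperbolic f g r s Γ) (M : ℕ) (v : ℤ) :
    IsCyl Γ (fun τ => fderiv 𝕜 (rowMapInv g) (DiscreteHyperbolic.row τ M (v + 1), τ 0 v)) :=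
  ((IsCyl.row hyp M (v + 1)).prodMk (IsCyl.col v)).comp
    fun _ hτ => (analyticAt_rowMapInv hyp hτ M v).fderiv

theorem IsCyl.charVec (hyp : IsHyperbolic f g r s Γ) (M k : ℕ) (v : ℤ) :
    IsCyl Γ (fun τ => charVec f τ M k v) := by
  induction k generalizing v with
  | zero => exact (IsCyl.fderiv_rowMap hyp M (v - 1)).clm_apply (IsCyl.const _)
  | succ k ih =>
    exact (IsCyl.fderiv_rowMap hyp M (v - 1)).clm_apply ((ih (v - 1)).prodMk (IsCyl.const 0))

theorem IsCyl.charVecInv (hyp : IsHyperbolic f g r s Γ) (M k : ℕ) (v : ℤ) :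
    IsCyl Γ (fun τ => charVecInv g τ M k v) := by
  induction k generalizing v with
  | zero => exact (IsCyl.fderiv_rowMapInv hyp M v).clm_apply (IsCyl.const _)
  | succ k ih =>
    exact (IsCyl.fderiv_rowMapInv hyp M v).clm_apply ((ih (v + 1)).prodMk (IsCyl.const 0))

end Vectors

/-! ### Linear algebra: preimages under a map with small kernel, Cramer's rule -/

section LinearAlgebra

variable {K : Type*} [Field K]

/-- Let `A` map `W` into `W'`, where `W` and `W'` have the same dimension, and let `A` take its
values in a hyperplane that does not contain `W'`.  If the kernel of `A` is at most a line, then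
`W` is the full preimage of `W'`. -/
theorem mem_of_map_mem_of_finrank_eq {E : Type*} [AddCommGroup E] [Module K E]
    [FiniteDimensional K E] {W W' : Submodule K E} (hdim : Module.finrank K W = Module.finrank K W')
    (A : E →ₗ[K] E) (e : E →ₗ[K] K) {U B : E} (hAW : ∀ w ∈ W, A w ∈ W') (hB : B ∈ W')
    (heB : e B = 1) (heA : ∀ w, e (A w) = 0) (hker : ∀ w, A w = 0 → ∃ c : K, w = c • U)
    {w : E} (hw : A w ∈ W') : w ∈ W := by
  have hle : W.map A ≤ W' ⊓ LinearMap.ker e := by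
    rintro _ ⟨x, hx, rfl⟩
    exact ⟨hAW x hx, heA x⟩
  have hlt : W' ⊓ LinearMap.ker e < W' := by
    refine lt_of_le_of_ne inf_le_left fun h => ?_
    rw [← h] at hB
    have : e B = 0 := hB.2
    simp [heB] at this
  have h1 := Submodule.finrank_lt_finrank_of_lt hlt
  have h2 := Submodule.finrank_mono hle
  have h3 : Module.finrank K (LinearMap.range (A.domRestrict W)) +
      Module.finrank K (LinearMap.ker (A.domRestrict W)) = Module.finrank K W :=
    LinearMap.finrank_range_add_finrank_ker _
  have h4 : LinearMap.range (A.domRestrict W) = W.map A := by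
    rw [LinearMap.range_domRestrict]
  rw [h4] at h3
  -- The image of `W` lies in `W' ⊓ ker e`, which has smaller dimension than `W`; so `A` kills a
  -- nonzero vector of `W`, and this is a multiple of `U`.
  have hkerpos : 0 < Module.finrank K (LinearMap.ker (A.domRestrict W)) := by omega
  have hU : U ∈ W := by
    have : Nontrivial (LinearMap.ker (A.domRestrict W)) := Module.nontrivial_of_finrank_pos hkerpos
    obtain ⟨x, hx⟩ := exists_ne (0 : LinearMap.ker (A.domRestrict W))
    obtain ⟨c, hc⟩ := hker x.1.1 x.2
    have hc0 : c ≠ 0 := by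
      rintro rfl
      apply hx
      ext
      simpa using hc
    have : U = c⁻¹ • (x.1.1 : E) := by rw [hc, smul_smul, inv_mul_cancel₀ hc0, one_smul]
    rw [this]
    exact W.smul_mem _ x.1.2
  have hker1 : Module.finrank K (LinearMap.ker (A.domRestrict W)) ≤ 1 := by
    by_cases hAU : A U = 0
    · refine finrank_le_one (⟨⟨U, hU⟩, hAU⟩ : LinearMap.ker (A.domRestrict W)) fun x => ?_
      obtain ⟨c, hc⟩ := hker x.1.1 x.2
      exact ⟨c, by ext; exact hc.symm⟩
    · refine finrank_le_one 0 fun x => ⟨0, ?_⟩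
      obtain ⟨c, hc⟩ := hker x.1.1 x.2
      have hx0 : A x.1.1 = 0 := x.2
      rw [hc, map_smul, smul_eq_zero] at hx0
      have hc0 := hx0.resolve_right hAU
      ext
      simp [hc, hc0]
  -- As only one dimension is lost, the image is all of `W' ⊓ ker e`. Hence `A w` has a preimage in
  -- `W`, and it differs from `w` by a multiple of `U`, which also lies in `W`.
  have heq : W.map A = W' ⊓ LinearMap.ker e := Submodule.eq_of_le_of_finrank_le hle (by omega)
  have : A w ∈ W.map A := by
    rw [heq]
    exact ⟨hw, heA w⟩
  obtain ⟨x, hx, hxw⟩ := this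
  obtain ⟨c, hc⟩ := hker (w - x) (by rw [map_sub, hxw, sub_self])
  rw [← sub_add_cancel w x, hc]
  exact W.add_mem (W.smul_mem _ hU) hx

variable {n : Type*} [Fintype n] [DecidableEq n]

/-- By Cramer's rule the coefficient of `u` at row `j` is this determinant divided by `A.det`.
Membership in a span becomes the vanishing of analytic functions, to which the identity theorem
applies. -/
theorem mem_span_rows_of_det_updateRow_eq_zero {A : Matrix n n K} (hA : A.det ≠ 0) {u : n → K}
    {I : Finset n} (h : ∀ j ∉ I, (A.updateRow j u).det = 0) :
    u ∈ Submodule.span K ((fun i => A i) '' (I : Set n)) := by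
  have h1 := Matrix.mulVec_cramer A.transpose u
  rw [Matrix.det_transpose] at h1
  have h2 : u = A.det⁻¹ • ∑ i, (A.updateRow i u).det • A i := by
    rw [eq_inv_smul_iff₀ hA, ← h1]
    funext k
    simp only [Matrix.mulVec, dotProduct, Finset.sum_apply, Pi.smul_apply, smul_eq_mul,
      Matrix.cramer_transpose_apply, Matrix.transpose_apply]
    exact Finset.sum_congr rfl fun i _ => mul_comm _ _
  rw [h2]
  refine Submodule.smul_mem _ _ (Submodule.sum_mem _ fun i _ => ?_)
  by_cases hi : i ∈ I
  · exact Submodule.smul_mem _ _ (Submodule.subset_span ⟨i, hi, rfl⟩)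
  · rw [h i hi, zero_smul]
    exact Submodule.zero_mem _

theorem det_updateRow_eq_zero_of_mem_span {A : Matrix n n K} {u : n → K} {I : Finset n}
    (hu : u ∈ Submodule.span K ((fun i => A i) '' (I : Set n))) {j : n} (hj : j ∉ I) :
    (A.updateRow j u).det = 0 := by
  induction hu using Submodule.span_induction with
  | mem x hx =>
    obtain ⟨i, hi, rfl⟩ := hx
    have hij : i ≠ j := fun h => hj (h ▸ hi)
    refine Matrix.det_zero_of_row_eq hij ?_
    rw [Matrix.updateRow_ne hij, Matrix.updateRow_self]
  | zero => exact Matrix.det_eq_zero_of_row_eq_zero j (by simp)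
  | add x y _ _ hx hy => rw [Matrix.det_updateRow_add, hx, hy, add_zero]
  | smul c x _ hx => rw [Matrix.det_updateRow_smul, hx, mul_zero]

theorem finrank_span_rows {A : Matrix n n K} (hA : A.det ≠ 0) (I : Finset n) :
    Module.finrank K (Submodule.span K ((fun i => A i) '' (I : Set n))) = I.card := by
  have h1 : LinearIndependent K (fun i => A i) :=
    Matrix.linearIndependent_rows_iff_isUnit.2 ((Matrix.isUnit_iff_isUnit_det A).2 hA.isUnit)
  have h2 : LinearIndependent K (fun i : I => A i) := h1.comp _ Subtype.val_injective
  have h3 := finrank_span_eq_card h2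
  rw [Fintype.card_coe] at h3
  rw [← h3, Set.image_eq_range]
  rfl

end LinearAlgebra

/-! ### Frames: generic bases of the span of the `X_k`, and how the span moves with the height -/

section Frames

variable {𝕜 : Type*} [RCLike 𝕜] {f g r s : 𝕜 → 𝕜 → 𝕜 → 𝕜} {Γ : Set (𝕜 × 𝕜 × 𝕜 × 𝕜)}
  {τ : ℤ → ℤ → 𝕜} {M : ℕ} {I : Finset (Fin (M + 1))} {κ : Fin (M + 1) → ℕ}
  {w : Fin (M + 1) → Fin (M + 1) → 𝕜}

/-- The matrix with the rows `X_{κ i + 1}` for `i ∈ I` and constant rows `w i` for `i ∉ I`. -/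
noncomputable def charMat (f : 𝕜 → 𝕜 → 𝕜 → 𝕜) (I : Finset (Fin (M + 1))) (κ : Fin (M + 1) → ℕ)
    (w : Fin (M + 1) → Fin (M + 1) → 𝕜) (τ : ℤ → ℤ → 𝕜) (v : ℤ) :
    Matrix (Fin (M + 1)) (Fin (M + 1)) 𝕜 :=
  fun i => if i ∈ I then charVec f τ M (κ i) v else w i

/-- The span of the vectors `X_{κ i + 1}`, `i ∈ I`, at height `v` along `τ`. -/
noncomputable def charSpan (f : 𝕜 → 𝕜 → 𝕜 → 𝕜) (I : Finset (Fin (M + 1))) (κ : Fin (M + 1) → ℕ)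
    (τ : ℤ → ℤ → 𝕜) (v : ℤ) : Submodule 𝕜 (Fin (M + 1) → 𝕜) :=
  Submodule.span 𝕜 ((fun i => charVec f τ M (κ i) v) '' (I : Set (Fin (M + 1))))

/-- `X_{κ i + 1}` (`i ∈ I`) and `w i` (`i ∉ I`) form a basis at some solution, and wherever they
do, the former span all the `X_k`. -/
structure IsFrame (f : 𝕜 → 𝕜 → 𝕜 → 𝕜) (Γ : Set (𝕜 × 𝕜 × 𝕜 × 𝕜)) (I : Finset (Fin (M + 1)))
    (κ : Fin (M + 1) → ℕ) (w : Fin (M + 1) → Fin (M + 1) → 𝕜) : Prop where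
  exists_det_ne : ∃ τ ∈ solutions Γ, (charMat f I κ w τ 0).det ≠ 0
  mem_span : ∀ τ ∈ solutions Γ, (charMat f I κ w τ 0).det ≠ 0 →
    ∀ k, charVec f τ M k 0 ∈ charSpan f I κ τ 0

theorem span_charMat (v : ℤ) :
    Submodule.span 𝕜 ((fun i => charMat f I κ w τ v i) '' (I : Set (Fin (M + 1)))) =
      charSpan f I κ τ v := by
  unfold charSpan
  congr 1
  refine Set.image_congr fun i hi => ?_
  have : i ∈ I := hi
  simp [charMat, this]

theorem charMat_shift (u v : ℤ) :
    charMat f I κ w (shift 0 u τ) v = charMat f I κ w τ (v + u) := by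
  funext i
  simp only [charMat, charVec_shift]

theorem charSpan_shift (u v : ℤ) :
    charSpan f I κ (shift 0 u τ) v = charSpan f I κ τ (v + u) := by
  simp only [charSpan, charVec_shift]

/-- `I` is taken of maximal size among the sets of rows that can be filled with generators and
completed by constant vectors to a basis at some solution. A generator outside the span at a
solution where the determinant is nonzero would, by Cramer's rule, replace one more constant row.
`hdet` excludes that all rows are generators. -/
theorem exists_isFrame (hind : HasIndependentVariables Γ)
    (hdet : ∀ κ : Fin (M + 1) → ℕ, ∀ τ ∈ solutions Γ,
      Matrix.det (fun i => charVec f τ M (κ i) 0) = 0) :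
    ∃ (I : Finset (Fin (M + 1))) (κ : Fin (M + 1) → ℕ) (w : Fin (M + 1) → Fin (M + 1) → 𝕜),
      (∃ i, i ∉ I) ∧ IsFrame f Γ I κ w := by
  classical
  let 𝓘 : Finset (Finset (Fin (M + 1))) := Finset.univ.filter fun I =>
    ∃ (κ : Fin (M + 1) → ℕ) (w : Fin (M + 1) → Fin (M + 1) → 𝕜), ∃ τ ∈ solutions Γ,
      (charMat f I κ w τ 0).det ≠ 0
  have hne : 𝓘.Nonempty := by
    obtain ⟨τ, hτ⟩ := solutions_nonempty hind
    refine ⟨∅, Finset.mem_filter.2 ⟨Finset.mem_univ _, fun _ => 0,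
      (1 : Matrix (Fin (M + 1)) (Fin (M + 1)) 𝕜), τ, hτ, ?_⟩⟩
    have : charMat f ∅ (fun _ => 0) (1 : Matrix (Fin (M + 1)) (Fin (M + 1)) 𝕜) τ 0 = 1 := by
      funext i; simp [charMat]
    rw [this, Matrix.det_one]
    exact one_ne_zero
  obtain ⟨I, hI, hmax⟩ := Finset.exists_max_image 𝓘 Finset.card hne
  obtain ⟨κ, w, hex⟩ := (Finset.mem_filter.1 hI).2
  refine ⟨I, κ, w, ?_, hex, fun τ hτ hd k => ?_⟩
  · by_contra hall
    push Not at hall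
    obtain ⟨τ, hτ, h⟩ := hex
    apply h
    have : charMat f I κ w τ 0 = fun i => charVec f τ M (κ i) 0 := by
      funext i; simp [charMat, hall i]
    rw [this]
    exact hdet κ τ hτ
  · rw [← span_charMat (w := w)]
    refine mem_span_rows_of_det_updateRow_eq_zero hd fun j hj => ?_
    by_contra hne
    have hm : insert j I ∈ 𝓘 := by
      refine Finset.mem_filter.2 ⟨Finset.mem_univ _, Function.update κ j k, w, τ, hτ, ?_⟩
      have : charMat f (insert j I) (Function.update κ j k) w τ 0 =
          (charMat f I κ w τ 0).updateRow j (charVec f τ M k 0) := by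
        funext i
        by_cases hij : i = j
        · subst hij
          rw [Matrix.updateRow_self]
          simp [charMat]
        · rw [Matrix.updateRow_ne hij]
          simp [charMat, hij]
      rwa [this]
    have := hmax _ hm
    rw [Finset.card_insert_of_notMem hj] at this
    omega

theorem IsFrame.charVec_mem (hF : IsFrame f Γ I κ w) (hτ : τ ∈ solutions Γ) {v : ℤ}
    (hd : (charMat f I κ w τ v).det ≠ 0) (k : ℕ) :
    charVec f τ M k v ∈ charSpan f I κ τ v := by
  have := hF.mem_span _ (shift_mem hτ 0 v)
  rw [charMat_shift, charSpan_shift, zero_add] at this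
  simpa only [charVec_shift, zero_add] using this hd k

/-- Where the frame is a basis, the span of the `X_k` at height `v` is the preimage of the span
at height `v + 1`. -/
theorem IsFrame.mem_of_rowDeriv_mem (hF : IsFrame f Γ I κ w) (hyp : IsHyperbolic f g r s Γ)
    (hind : HasIndependentVariables Γ) (hτ : τ ∈ solutions Γ) {v : ℤ}
    (hd : (charMat f I κ w τ v).det ≠ 0) (hd' : (charMat f I κ w τ (v + 1)).det ≠ 0)
    {x : Fin (M + 1) → 𝕜} (hx : rowDeriv f τ M v x ∈ charSpan f I κ τ (v + 1)) :
    x ∈ charSpan f I κ τ v := by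
  -- The dimensions agree because the frame is a basis at both heights. The hyperplane is given by
  -- entry `0`, which vanishes on the values of `rowDeriv` and is `1` on `colDeriv`, that is, on
  -- `X_1` at height `v + 1`.
  refine mem_of_map_mem_of_finrank_eq (W := charSpan f I κ τ v) (W' := charSpan f I κ τ (v + 1))
    ?_ (rowDeriv f τ M v).toLinearMap (LinearMap.proj 0) (U := colDerivInv g τ M v)
    (B := colDeriv f τ M v) ?_ ?_ (colDeriv_apply_zero hyp hτ v) (rowDeriv_apply_zero hyp hτ v)
    (fun y hy => ⟨y 0, eq_smul_of_rowDeriv_eq_zero hyp hind hτ v hy⟩) hx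
  · rw [← span_charMat (w := w), ← span_charMat (w := w), finrank_span_rows hd,
      finrank_span_rows hd']
  · intro y hy
    change y ∈ (charSpan f I κ τ (v + 1)).comap (rowDeriv f τ M v).toLinearMap
    refine (Submodule.span_le.2 ?_) hy
    rintro _ ⟨i, -, rfl⟩
    have := hF.charVec_mem hτ hd' (κ i + 1)
    rwa [charVec_succ] at this
  · have := hF.charVec_mem hτ hd' 0
    rwa [charVec_zero] at this

theorem IsCyl.det {A : (ℤ → ℤ → 𝕜) → Matrix (Fin (M + 1)) (Fin (M + 1)) 𝕜}
    (hA : ∀ i, IsCyl Γ (fun τ => (A τ i : Fin (M + 1) → 𝕜))) : IsCyl Γ (fun τ => (A τ).det) := by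
  have hij : ∀ i j, IsCyl Γ (fun τ => A τ i j) := fun i j =>
    (hA i).comp (h := fun a => a j) fun τ _ =>
      (ContinuousLinearMap.proj (R := 𝕜) (φ := fun _ : Fin (M + 1) => 𝕜) j).analyticAt _
  have h := IsCyl.pi (H := fun (p : Fin (M + 1) × Fin (M + 1)) τ => A τ p.1 p.2)
    fun p => hij p.1 p.2
  refine h.comp (h := fun a => Matrix.det (Matrix.of fun i j => a (i, j))) fun τ _ => ?_
  simp only [Matrix.det_apply', Matrix.of_apply]
  refine Finset.analyticAt_fun_sum _ fun σ _ => ?_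
  refine analyticAt_const.mul ?_
  refine Finset.analyticAt_fun_prod _ fun i _ => ?_
  exact (ContinuousLinearMap.proj (R := 𝕜)
    (φ := fun _ : Fin (M + 1) × Fin (M + 1) => 𝕜) (σ i, i)).analyticAt _

theorem IsCyl.charMat_row (hyp : IsHyperbolic f g r s Γ) (v : ℤ) (i : Fin (M + 1)) :
    IsCyl Γ (fun τ => charMat f I κ w τ v i) := by
  by_cases hi : i ∈ I
  · simpa [charMat, hi] using IsCyl.charVec hyp M (κ i) v
  · simpa [charMat, hi] using IsCyl.const (w i)

theorem IsCyl.mul {H G : (ℤ → ℤ → 𝕜) → 𝕜} (hH : IsCyl Γ H) (hG : IsCyl Γ G) :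
    IsCyl Γ (fun τ => H τ * G τ) :=
  (hH.prodMk hG).comp (h := fun p => p.1 * p.2) fun _ _ => analyticAt_fst.mul analyticAt_snd

/-- A function of the dynamical variables that vanishes where the frame is a basis at the heights
`0, …, n - 1` vanishes identically. -/
theorem IsFrame.eq_zero_of_generic (hF : IsFrame f Γ I κ w) (hyp : IsHyperbolic f g r s Γ)
    (hind : HasIndependentVariables Γ) (n : ℕ) {H : (ℤ → ℤ → 𝕜) → 𝕜} (hH : IsCyl Γ H)
    (h : ∀ τ ∈ solutions Γ, (∀ i < n, (charMat f I κ w τ i).det ≠ 0) → H τ = 0) :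
    ∀ τ ∈ solutions Γ, H τ = 0 := by
  induction n generalizing H with
  | zero => exact fun τ hτ => h τ hτ (by simp)
  | succ n ih =>
    have hG : IsCyl Γ (fun τ => (charMat f I κ w τ n).det) :=
      IsCyl.det fun i => IsCyl.charMat_row hyp _ i
    obtain ⟨τ₀, hτ₀, h₀⟩ := hF.exists_det_ne
    -- `H` times the determinant at height `n` already vanishes where the lower heights are generic.
    -- The factor is cancelled because it is nonzero at a translate of `τ₀`.
    refine hH.eq_zero_of_mul_eq_zero hind hG (ih (hH.mul hG) fun τ hτ hd => ?_)
      (shift_mem hτ₀ 0 (-n)) ?_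
    · by_cases hn : (charMat f I κ w τ n).det = 0
      · simp [hn]
      · rw [h τ hτ fun i hi => ?_, zero_mul]
        rcases Nat.lt_succ_iff_lt_or_eq.1 hi with h' | rfl
        · exact hd i h'
        · exact hn
    · simpa [charMat_shift] using h₀

/-- Otherwise `IsFrame.eq_zero_of_generic` would apply to the constant `1`. -/
theorem IsFrame.exists_generic (hF : IsFrame f Γ I κ w) (hyp : IsHyperbolic f g r s Γ)
    (hind : HasIndependentVariables Γ) (n : ℕ) :
    ∃ τ ∈ solutions Γ, ∀ i < n, (charMat f I κ w τ i).det ≠ 0 := by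
  by_contra hcon
  push Not at hcon
  obtain ⟨τ, hτ⟩ := solutions_nonempty hind
  refine one_ne_zero (α := 𝕜) (hF.eq_zero_of_generic hyp hind n (IsCyl.const 1)
    (fun τ hτ h => ?_) τ hτ)
  obtain ⟨i, hi, h'⟩ := hcon τ hτ
  exact absurd h' (h i hi)

/-- `rowDeriv` kills the vector with index `0` and lowers any other index by one, up to a multiple
of `X_1`. So membership at height `v + 1` pulls back to height `v`; each of these steps needs the
frame to be a basis at both heights. -/
theorem IsFrame.charVecInv_mem_of_generic (hF : IsFrame f Γ I κ w)
    (hyp : IsHyperbolic f g r s Γ) (hind : HasIndependentVariables Γ) (hτ : τ ∈ solutions Γ)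
    (k : ℕ) {v : ℤ} (hd : ∀ i < k + 2, (charMat f I κ w τ (v + (i : ℕ))).det ≠ 0) :
    charVecInv g τ M k v ∈ charSpan f I κ τ v := by
  have hd0 := hd 0 (by omega)
  have hd1 := hd 1 (by omega)
  simp only [Nat.cast_zero, add_zero, Nat.cast_one] at hd0 hd1
  induction k generalizing v with
  | zero =>
    refine hF.mem_of_rowDeriv_mem hyp hind hτ hd0 hd1 ?_
    rw [charVecInv, rowDeriv_colDerivInv hyp hind hτ]
    exact Submodule.zero_mem _
  | succ k ih =>
    refine hF.mem_of_rowDeriv_mem hyp hind hτ hd0 hd1 ?_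
    have hd2 := hd 2 (by omega)
    have h1 : charVecInv g τ M k (v + 1) ∈ charSpan f I κ τ (v + 1) := by
      refine ih (fun i hi => ?_) hd1 (by convert hd2 using 3; push_cast; ring)
      have := hd (i + 1) (by omega)
      convert this using 3
      push_cast; ring
    have h2 := rowDeriv_rowDerivInv hyp hind hτ v (charVecInv g τ M k (v + 1)) 0
    rw [zero_smul, add_zero] at h2
    rw [charVecInv, eq_sub_of_add_eq h2]
    refine Submodule.sub_mem _ h1 (Submodule.smul_mem _ _ ?_)
    rw [← charVec_zero]
    exact hF.charVec_mem hτ hd1 0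

/-- Where the frame is a basis, it spans the derivatives of the row with respect to values above
it. -/
theorem IsFrame.charVecInv_mem (hF : IsFrame f Γ I κ w) (hyp : IsHyperbolic f g r s Γ)
    (hind : HasIndependentVariables Γ) (hτ : τ ∈ solutions Γ)
    (hd : (charMat f I κ w τ 0).det ≠ 0) (k : ℕ) :
    charVecInv g τ M k 0 ∈ charSpan f I κ τ 0 := by
  rw [← span_charMat (w := w)]
  refine mem_span_rows_of_det_updateRow_eq_zero hd fun j hj => ?_
  -- The determinants of Cramer's rule vanish at solutions generic at the heights `0, …, k + 1`,
  -- hence identically; genericity is then needed at height `0` only.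
  refine hF.eq_zero_of_generic hyp hind (k + 2)
    (H := fun τ => ((charMat f I κ w τ 0).updateRow j (charVecInv g τ M k 0)).det) ?_ ?_ τ hτ
  · refine IsCyl.det fun i => ?_
    by_cases hij : i = j
    · subst hij
      simpa only [Matrix.updateRow_self] using IsCyl.charVecInv hyp M k 0
    · simpa only [Matrix.updateRow_ne hij] using IsCyl.charMat_row hyp 0 i
  · intro τ hτ hd
    refine det_updateRow_eq_zero_of_mem_span ?_ hj
    rw [span_charMat]
    exact hF.charVecInv_mem_of_generic hyp hind hτ k (by simpa using hd)

/-- Where the frame is a basis, the span of the `X_k` depends only on the row and the values above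
it, and not on the values below. -/
theorem IsFrame.charVec_mem_of_row_eq (hF : IsFrame f Γ I κ w) (hyp : IsHyperbolic f g r s Γ)
    (hind : HasIndependentVariables Γ) {τ' : ℤ → ℤ → 𝕜} (hτ : τ ∈ solutions Γ)
    (hτ' : τ' ∈ solutions Γ) {n : ℕ} (hn : ∀ i ∈ I, κ i < n)
    (hd : ∀ i < n + 1, (charMat f I κ w τ i).det ≠ 0) (hrow : row τ' M 0 = row τ M 0)
    (hcol : ∀ i : ℕ, i < n → τ' 0 (i + 1) = τ 0 (i + 1)) (k : ℕ) :
    charVec f τ' M k 0 ∈ charSpan f I κ τ 0 := by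
  have hrows : ∀ i : ℕ, i ≤ n → row τ' M i = row τ M i := by
    intro i hi
    induction i with
    | zero => exact hrow
    | succ i ih =>
      push_cast
      rw [← rowMap_row hyp hτ, ← rowMap_row hyp hτ', ih (by omega), hcol i (by omega)]
  have hA : ∀ i : ℕ, i < n → rowDeriv f τ' M i = rowDeriv f τ M i := by
    intro i hi
    rw [rowDeriv, rowDeriv, hrows i hi.le, hcol i hi]
  -- The vector with index `k` at height `i` involves the rows at heights `i - k - 1, …, i - 1` and
  -- the column up to `i`. For `k < i` none of this lies below height `0`, so it is common to `τ`
  -- and `τ'`.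
  have hvec : ∀ k (i : ℕ), k < i → i ≤ n → charVec f τ' M k i = charVec f τ M k i := by
    intro k
    induction k with
    | zero =>
      rintro (_ | i) h0 hi
      · omega
      · push_cast
        rw [charVec_zero, charVec_zero, colDeriv, colDeriv, hrows i (by omega),
          hcol i (by omega)]
    | succ k ih =>
      rintro (_ | i) h0 hi
      · omega
      · push_cast
        rw [charVec_succ, charVec_succ, hA i (by omega), ih i (by omega) (by omega)]
  have hmat : charMat f I κ w τ' n = charMat f I κ w τ n := by
    funext i
    by_cases hi : i ∈ I
    · simp only [charMat, hi, if_true]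
      exact hvec _ _ (hn i hi) le_rfl
    · simp [charMat, hi]
  have hspan : charSpan f I κ τ' n = charSpan f I κ τ n := by
    rw [← span_charMat (w := w), hmat, span_charMat]
  -- Descent from height `n`, where the two spans coincide because `κ i < n`. The vector with index
  -- `k` at height `0` is raised by `n` upper shifts to index `k + n`; each membership is pulled
  -- back by `IsFrame.mem_of_rowDeriv_mem`.
  have hup : ∀ i : ℕ, i ≤ n → charVec f τ' M (k + (n - i)) (n - i : ℕ) ∈
      charSpan f I κ τ (n - i : ℕ) := by
    intro i
    induction i with
    | zero =>
      intro _
      rw [Nat.sub_zero, ← hspan]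
      refine hF.charVec_mem hτ' ?_ _
      rw [hmat]
      exact hd n (by omega)
    | succ i ih =>
      intro hi
      obtain ⟨m, rfl⟩ : ∃ m, n = m + (i + 1) := ⟨n - (i + 1), by omega⟩
      have h := ih (by omega)
      have e1 : m + (i + 1) - i = m + 1 := by omega
      have e2 : m + (i + 1) - (i + 1) = m := by omega
      rw [e1] at h
      rw [e2]
      push_cast at h
      rw [← add_assoc, charVec_succ, hA m (by omega)] at h
      refine hF.mem_of_rowDeriv_mem hyp hind hτ (hd m (by omega)) ?_ h
      simpa using hd (m + 1) (by omega)
  simpa using hup n le_rfl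

end Frames

/-! ### Iterated shifts, and the coefficients of `X_k` as derivatives along solutions -/

section Iteration

variable {𝕜 : Type*} [RCLike 𝕜] {f g r s : 𝕜 → 𝕜 → 𝕜 → 𝕜} {Γ : Set (𝕜 × 𝕜 × 𝕜 × 𝕜)}
  {τ : ℤ → ℤ → 𝕜} {M : ℕ}

/-- The row obtained from the row `a` by `n` upper shifts, the new values being `b 0, b 1, …`. -/
def rowIter (f : 𝕜 → 𝕜 → 𝕜 → 𝕜) (a : Fin (M + 1) → 𝕜) (b : ℕ → 𝕜) : ℕ → Fin (M + 1) → 𝕜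
  | 0 => a
  | n + 1 => rowMap f (rowIter f a b n, b n)

/-- The derivative of `rowIter` along `τ`, starting at height `v`, in the direction `(a', b')`. -/
noncomputable def propagate (f : 𝕜 → 𝕜 → 𝕜 → 𝕜) (τ : ℤ → ℤ → 𝕜) (v : ℤ) (a' : Fin (M + 1) → 𝕜)
    (b' : ℕ → 𝕜) : ℕ → Fin (M + 1) → 𝕜
  | 0 => a'
  | n + 1 => rowDeriv f τ M (v + n) (propagate f τ v a' b' n) + b' n • colDeriv f τ M (v + n)

theorem rowIter_congr {a : Fin (M + 1) → 𝕜} {b b' : ℕ → 𝕜} {n : ℕ} (h : ∀ i < n, b i = b' i) :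
    rowIter f a b n = rowIter f a b' n := by
  induction n with
  | zero => rfl
  | succ n ih => rw [rowIter, rowIter, ih fun i hi => h i (by omega), h n (by omega)]

theorem rowUp_eq_rowIter (a b : ℕ → 𝕜) (k : ℕ) :
    (fun j : Fin (M + 1) => rowUp f a b k j) =
      rowIter f (fun j : Fin (M + 1) => a j) (fun i => b (i + 1)) k := by
  induction k with
  | zero => rfl
  | succ k ih =>
    rw [rowIter, ← ih, rowMap_eq]
    rfl

theorem rowIter_row (hyp : IsHyperbolic f g r s Γ) (hτ : τ ∈ solutions Γ) {v : ℤ}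
    {a : Fin (M + 1) → 𝕜} {b : ℕ → 𝕜} {n : ℕ} (ha : a = row τ M v)
    (hb : ∀ i < n, b i = τ 0 (v + i + 1)) : rowIter f a b n = row τ M (v + n) := by
  induction n with
  | zero => simpa [rowIter] using ha
  | succ n ih =>
    rw [rowIter, ih fun i hi => hb i (by omega), hb n (by omega), rowMap_row hyp hτ]
    push_cast
    rw [add_assoc]

theorem hasDerivAt_rowIter (hyp : IsHyperbolic f g r s Γ) (hτ : τ ∈ solutions Γ) {v : ℤ}
    {a : 𝕜 → Fin (M + 1) → 𝕜} {b : 𝕜 → ℕ → 𝕜} {a' : Fin (M + 1) → 𝕜} {b' : ℕ → 𝕜} {y : 𝕜}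
    (n : ℕ) (ha : HasDerivAt a a' y) (hb : ∀ i < n, HasDerivAt (fun y => b y i) (b' i) y)
    (ha₀ : a y = row τ M v) (hb₀ : ∀ i < n, b y i = τ 0 (v + i + 1)) :
    HasDerivAt (fun y => rowIter f (a y) (b y) n) (propagate f τ v a' b' n) y := by
  induction n with
  | zero => exact ha
  | succ n ih =>
    exact hasDerivAt_rowMap hyp hτ (ih (fun i hi => hb i (by omega)) fun i hi => hb₀ i (by omega))
      (hb n (by omega)) (rowIter_row hyp hτ ha₀ fun i hi => hb₀ i (by omega)) (hb₀ n (by omega))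

theorem analyticAt_rowIter (hyp : IsHyperbolic f g r s Γ) (hτ : τ ∈ solutions Γ) {v : ℤ}
    {P : Type*} [NormedAddCommGroup P] [NormedSpace 𝕜 P] {a : P → Fin (M + 1) → 𝕜}
    {b : P → ℕ → 𝕜} {p₀ : P} (n : ℕ) (ha : AnalyticAt 𝕜 a p₀)
    (hb : ∀ i < n, AnalyticAt 𝕜 (fun p => b p i) p₀)
    (ha₀ : a p₀ = row τ M v) (hb₀ : ∀ i < n, b p₀ i = τ 0 (v + i + 1)) :
    AnalyticAt 𝕜 (fun p => rowIter f (a p) (b p) n) p₀ := by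
  induction n with
  | zero => exact ha
  | succ n ih =>
    have h1 := ih (fun i hi => hb i (by omega)) fun i hi => hb₀ i (by omega)
    have h2 := analyticAt_rowMap hyp hτ M (v + n)
    rw [← rowIter_row hyp hτ ha₀ fun i hi => hb₀ i (by omega), ← hb₀ n (by omega)] at h2
    exact AnalyticAt.fun_comp (f := fun p => (rowIter f (a p) (b p) n, b p n)) h2
      (h1.prod (hb n (by omega)))

/-- The value `b h`, at height `v + h + 1`, enters through `colDeriv`, and its effect is then
carried up by `rowDeriv` in the remaining `n - 1 - h` steps. -/
theorem propagate_single (v : ℤ) (h n : ℕ) :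
    propagate f τ v (0 : Fin (M + 1) → 𝕜) (fun i => if i = h then 1 else 0) n =
      if h < n then charVec f τ M (n - 1 - h) (v + n) else 0 := by
  induction n with
  | zero => simp [propagate]
  | succ n ih =>
    rw [propagate, ih]
    rcases lt_trichotomy h n with hn | rfl | hn
    · obtain ⟨m, rfl⟩ : ∃ m, n = m + h + 1 := ⟨n - h - 1, by omega⟩
      have e1 : m + h + 1 + 1 - 1 - h = m + 1 := by omega
      have e2 : m + h + 1 - 1 - h = m := by omega
      simp only [hn, show h < m + h + 1 + 1 by omega, if_true, e1, e2, hn.ne', if_false, zero_smul,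
        add_zero]
      rw [← charVec_succ]
      push_cast
      ring_nf
    · simp only [lt_irrefl, if_false, map_zero, zero_add, if_true, one_smul, Nat.lt_succ_self,
        ← charVec_zero]
      have e : h + 1 - 1 - h = 0 := by omega
      rw [e]
      push_cast
      rw [add_assoc]
    · simp [hn.ne, show ¬ h < n by omega, show ¬ h < n + 1 by omega]

theorem stair_neg_succ (k : ℕ) : stair τ (-((k : ℤ) + 1)) = τ 0 (-((k : ℤ) + 1)) := by
  rw [stair, if_neg (by omega)]

theorem stair_natCast (j : ℕ) : stair τ (j : ℤ) = τ j 0 := by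
  rw [stair, if_pos (by omega)]

theorem stair_of_nonpos {i : ℤ} (h : i ≤ 0) : stair τ i = τ 0 i := by
  rcases h.lt_or_eq with h | rfl
  · rw [stair, if_neg (by omega)]
  · simp [stair]

theorem rowDown_solution (hyp : IsHyperbolic f g r s Γ) (hτ : τ ∈ solutions Γ) {x : ℤ → 𝕜}
    {k j : ℕ} (hx : ∀ i : ℤ, -(k : ℤ) ≤ i → i ≤ j → x i = stair τ i) :
    rowDown g x k j = τ j (-(k : ℤ)) := by
  induction k generalizing j with
  | zero =>
    have := hx j (by simp) le_rfl
    rw [stair_natCast] at this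
    simpa [rowDown] using this
  | succ k ih =>
    rw [rowDown]
    push_cast
    push_cast at hx
    refine prevRow_solution hyp hτ (fun i hi => ?_) ?_
    · rw [ih fun l hl hl' => hx l (by omega) (by omega)]
      congr 1
      ring
    · rw [hx _ (by omega) (by omega), stair_neg_succ]

/-- `rowUp` reads its column from index `1` on and `rowIter` from index `0` on, so the varied value
`t_v` becomes the one of step `0`. -/
theorem rowUp_update_eq_rowIter (a : ℕ → 𝕜) (x : ℤ → 𝕜) (k n : ℕ) (y : 𝕜) :
    (fun j : Fin (M + 1) => rowUp f a
      (Function.update (fun i : ℕ => x ((i : ℤ) - (k + 1 : ℕ))) 1 y) n j) =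
      rowIter f (fun j : Fin (M + 1) => a j)
        (fun i : ℕ => if i = 0 then y else x ((i : ℤ) - k)) n := by
  rw [rowUp_eq_rowIter]
  congr 1
  funext i
  rcases i with _ | i
  · simp
  · rw [Function.update_of_ne (by omega), if_neg (by omega)]
    congr 1
    push_cast
    ring

theorem column_eq {x : ℤ → 𝕜} {k i : ℕ}
    (hx : ∀ l : ℤ, -((k : ℤ) + 1) ≤ l → l ≤ 0 → x l = stair τ l) (hi : i < k + 1) :
    (if i = 0 then x (1 - ((k + 1 : ℕ) : ℤ)) else x ((i : ℤ) - k)) =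
      τ 0 (-((k : ℤ) + 1) + i + 1) := by
  have : (if i = 0 then x (1 - ((k + 1 : ℕ) : ℤ)) else x ((i : ℤ) - k)) = x ((i : ℤ) - k) := by
    split_ifs with h0
    · subst h0
      congr 1
      push_cast
      ring
    · rfl
  rw [this, hx _ (by omega) (by omega), stair_of_nonpos (by omega)]
  congr 1
  ring

theorem rowUp_rowDown_solution (hyp : IsHyperbolic f g r s Γ) (hτ : τ ∈ solutions Γ)
    {x : ℤ → 𝕜} {k n j : ℕ} (hn : n ≤ k + 1)
    (hx : ∀ i : ℤ, -((k : ℤ) + 1) ≤ i → i ≤ j → x i = stair τ i) :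
    rowUp f (rowDown g x (k + 1)) (Function.update (fun i : ℕ => x ((i : ℤ) - (k + 1 : ℕ))) 1
      (x (1 - ((k + 1 : ℕ) : ℤ)))) n j = τ j (-((k : ℤ) + 1) + n) := by
  refine (congrFun (rowUp_update_eq_rowIter (M := j) (f := f) _ x k n _) (Fin.last j)).trans ?_
  rw [rowIter_row hyp hτ (v := -((k : ℤ) + 1)) (funext fun l => ?_)
    fun i hi => column_eq (fun l h1 h2 => hx l h1 (by omega)) (by omega)]
  · simp [row]
  · rw [rowDown_solution hyp hτ fun i h1 h2 => hx i (by push_cast at h1; omega) (by omega)]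
    simp [row]

theorem hasDerivAt_rowUp (hyp : IsHyperbolic f g r s Γ) (hτ : τ ∈ solutions Γ) {x : ℤ → 𝕜}
    {M k : ℕ} (hx : ∀ i : ℤ, -((k : ℤ) + 1) ≤ i → i ≤ M → x i = stair τ i) :
    HasDerivAt (fun (y : 𝕜) (j : Fin (M + 1)) => rowUp f (rowDown g x (k + 1))
      (Function.update (fun i : ℕ => x ((i : ℤ) - (k + 1 : ℕ))) 1 y) (k + 1) j)
      (charVec f τ M k 0) (x (1 - ((k + 1 : ℕ) : ℤ))) := by
  refine HasDerivAt.congr_of_eventuallyEq ?_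
    (Filter.Eventually.of_forall fun y => rowUp_update_eq_rowIter _ _ _ _ y)
  have h := hasDerivAt_rowIter (M := M) hyp hτ (v := -((k : ℤ) + 1)) (k + 1)
    (a := fun _ : 𝕜 => fun j : Fin (M + 1) => rowDown g x (k + 1) j)
    (b := fun (y : 𝕜) (i : ℕ) => if i = 0 then y else x ((i : ℤ) - k))
    (b' := fun i => if i = 0 then 1 else 0) (y := x (1 - ((k + 1 : ℕ) : ℤ)))
    (hasDerivAt_const _ _) ?_ ?_ ?_
  · rw [propagate_single] at h
    simpa using h
  · intro i hi
    by_cases h0 : i = 0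
    · simpa [h0] using hasDerivAt_id' _
    · simpa [h0] using hasDerivAt_const _ _
  · funext j
    rw [rowDown_solution hyp hτ fun i hi hi' => hx i (by push_cast at hi; omega) (by omega)]
    simp [row]
  · exact fun i hi => column_eq (fun l h1 h2 => hx l h1 (by omega)) hi

/-- The point `x` has to match a solution only in the finitely many coordinates that are read. This
is essential: a neighbourhood in the product topology restricts no more than finitely many
coordinates. -/
theorem charField_eq_charVec (hyp : IsHyperbolic f g r s Γ) (hτ : τ ∈ solutions Γ) {x : ℤ → 𝕜}
    {M k : ℕ} (hx : ∀ i : ℤ, -((k : ℤ) + 1) ≤ i → i ≤ M → x i = stair τ i) (j : Fin (M + 1)) :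
    charField f g (k + 1) j x = charVec f τ M k 0 j :=
  (hasDerivAt_pi.1 (hasDerivAt_rowUp hyp hτ hx) j).deriv

/-- The position in the coordinate cross of the `n`-th coordinate of `stair`. -/
def stairPos (n : ℤ) : ℤ × ℤ := if 0 ≤ n then (n, 0) else (0, n)

theorem stair_eq (n : ℤ) : stair τ n = τ (stairPos n).1 (stairPos n).2 := by
  unfold stair stairPos
  split_ifs <;> rfl

theorem stairPos_cross (n : ℤ) : (stairPos n).1 = 0 ∨ (stairPos n).2 = 0 := by
  unfold stairPos
  split_ifs <;> simp

theorem stairPos_injective : Function.Injective stairPos := by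
  intro m n h
  unfold stairPos at h
  split_ifs at h <;> simp only [Prod.mk.injEq] at h <;> omega

theorem IsDynamicalFunction.isCyl {a : (ℤ → 𝕜) → 𝕜} (ha : IsDynamicalFunction Γ a) :
    IsCyl Γ (fun τ => a (stair τ)) := by
  obtain ⟨S, φ, hφ⟩ := ha
  have h := IsCyl.pi (Γ := Γ) (H := fun (i : S) (τ : ℤ → ℤ → 𝕜) => stair τ i) fun i => by
    simpa only [stair_eq] using IsCyl.eval (stairPos_cross i)
  obtain ⟨S', hS', ψ, hψ⟩ := h.comp (h := φ) fun τ hτ => (hφ _ ⟨τ, hτ, rfl⟩).1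
  exact ⟨S', hS', ψ, fun τ hτ => ⟨(hψ τ hτ).1, ((hφ _ ⟨τ, hτ, rfl⟩).2).trans (hψ τ hτ).2⟩⟩

/-- Where the determinant is nonzero, the relation between the generators forces all its
coefficients to vanish. So the determinant times a coefficient that is not identically zero is zero,
and the coefficient can be cancelled. -/
theorem det_charVec_eq_zero (hyp : IsHyperbolic f g r s Γ) (hind : HasIndependentVariables Γ)
    (hN : ∀ Z : Fin (M + 1) → VField 𝕜, (∀ i, CharAlgebra f g (Z i)) →
      ∃ a : Fin (M + 1) → (ℤ → 𝕜) → 𝕜, (∀ i, IsDynamicalFunction Γ (a i)) ∧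
        (∃ i, ∃ x ∈ points Γ, a i x ≠ 0) ∧
        ∀ x ∈ points Γ, ∀ j : ℕ, ∑ i, a i x * Z i j x = 0)
    (κ : Fin (M + 1) → ℕ) :
    ∀ τ ∈ solutions Γ, Matrix.det (fun i => charVec f τ M (κ i) 0) = 0 := by
  obtain ⟨a, ha, ⟨i₀, _, ⟨τ₀, hτ₀, rfl⟩, hne⟩, hrel⟩ := hN (fun i => charField f g (κ i + 1))
    fun i => CharAlgebra.gen _ (by omega)
  refine IsCyl.eq_zero_of_mul_eq_zero hind
    (H := fun τ => Matrix.det (fun i => charVec f τ M (κ i) 0))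
    (IsCyl.det fun i => IsCyl.charVec hyp M (κ i) 0) (ha i₀).isCyl ?_ hτ₀ hne
  intro τ hτ
  by_cases hd : Matrix.det (fun i => charVec f τ M (κ i) 0) = 0
  · rw [hd, zero_mul]
  · have : Matrix.vecMul (fun i => a i (stair τ)) (fun i => charVec f τ M (κ i) 0) = 0 := by
      funext j
      have h := hrel _ ⟨τ, hτ, rfl⟩ j
      simp only [charField_eq_charVec (M := M) hyp hτ fun i _ _ => rfl] at h
      exact h
    rw [congrFun (Matrix.eq_zero_of_vecMul_eq_zero hd this) i₀]
    simp

end Iteration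

/-! ### Solutions whose values on a finite part of the cross are near those of `τ` -/

section Near

variable {𝕜 : Type*} [RCLike 𝕜] {f g r s : 𝕜 → 𝕜 → 𝕜 → 𝕜} {Γ : Set (𝕜 × 𝕜 × 𝕜 × 𝕜)}
  {τ : ℤ → ℤ → 𝕜} {M n : ℕ}

/-- The row at height `0` and the values of the column `u = 0` at the heights `-n, …, n`. -/
def crossMap (M n : ℕ) (τ : ℤ → ℤ → 𝕜) :
    (Fin (M + 1) → 𝕜) × (Finset.Icc (-(n : ℤ)) n → 𝕜) :=
  (row τ M 0, fun i => τ 0 i)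

/-- The solutions with values on the cross near those of `τ`. -/
def nearSol (Γ : Set (𝕜 × 𝕜 × 𝕜 × 𝕜)) (M n : ℕ) (τ : ℤ → ℤ → 𝕜) : Filter (ℤ → ℤ → 𝕜) :=
  Filter.comap (crossMap M n) (𝓝 (crossMap M n τ)) ⊓ Filter.principal (solutions Γ)

theorem eventually_nearSol {P : (ℤ → ℤ → 𝕜) → Prop} :
    (∀ᶠ τ' in nearSol Γ M n τ, P τ') ↔
      ∀ᶠ p in 𝓝 (crossMap M n τ), ∀ τ' ∈ solutions Γ, crossMap M n τ' = p → P τ' := by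
  rw [nearSol, Filter.eventually_inf_principal, Filter.eventually_comap]
  refine Filter.eventually_congr (Filter.Eventually.of_forall fun p => ?_)
  exact ⟨fun h τ' hτ' e => h τ' e hτ', fun h τ' e hτ' => h τ' hτ' e⟩

theorem eventually_mem_nearSol : ∀ᶠ τ' in nearSol Γ M n τ, τ' ∈ solutions Γ :=
  Filter.mem_of_superset (Filter.mem_inf_of_right (Filter.mem_principal_self _)) fun _ h => h

theorem tendsto_crossMap :
    Filter.Tendsto (crossMap M n) (nearSol Γ M n τ) (𝓝 (crossMap M n τ)) :=
  Filter.tendsto_comap.mono_left inf_le_left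

theorem tendsto_row_zero :
    Filter.Tendsto (fun τ' => row τ' M 0) (nearSol Γ M n τ) (𝓝 (row τ M 0)) :=
  (continuous_fst.tendsto _).comp tendsto_crossMap

theorem tendsto_col {i : ℤ} (hi : -(n : ℤ) ≤ i) (hi' : i ≤ n) :
    Filter.Tendsto (fun τ' : ℤ → ℤ → 𝕜 => τ' 0 i) (nearSol Γ M n τ) (𝓝 (τ 0 i)) := by
  have : Continuous (fun p : (Fin (M + 1) → 𝕜) × (Finset.Icc (-(n : ℤ)) n → 𝕜) =>
    p.2 ⟨i, by simp [hi, hi']⟩) := by fun_prop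
  exact (this.tendsto (crossMap M n τ)).comp tendsto_crossMap

theorem tendsto_row (hyp : IsHyperbolic f g r s Γ) (hτ : τ ∈ solutions Γ) {v : ℤ}
    (hv : -(n : ℤ) ≤ v) (hv' : v ≤ n) :
    Filter.Tendsto (fun τ' => row τ' M v) (nearSol Γ M n τ) (𝓝 (row τ M v)) := by
  induction v using Int.induction_on with
  | zero => exact tendsto_row_zero
  | succ i ih =>
    have h1 := (ih (by omega) (by omega)).prodMk_nhds
      (tendsto_col (Γ := Γ) (M := M) (τ := τ) (i := (i : ℤ) + 1) hv hv')
    have h2 := (analyticAt_rowMap hyp hτ M i).continuousAt.tendsto.comp h1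
    rw [rowMap_row hyp hτ] at h2
    refine h2.congr' ?_
    filter_upwards [eventually_mem_nearSol] with τ' hτ'
    exact rowMap_row hyp hτ' M i
  | pred i ih =>
    have h1 := (ih (by omega) (by omega)).prodMk_nhds
      (tendsto_col (Γ := Γ) (M := M) (τ := τ) (i := -(i : ℤ) - 1) hv hv')
    have h2 := (analyticAt_rowMapInv hyp hτ M (-i - 1)).continuousAt.tendsto
    rw [sub_add_cancel] at h2
    have h3 := h2.comp h1
    have e := rowMapInv_row hyp hτ M (-i - 1)
    rw [sub_add_cancel] at e
    rw [e] at h3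
    refine h3.congr' ?_
    filter_upwards [eventually_mem_nearSol] with τ' hτ'
    have e' := rowMapInv_row hyp hτ' M (-i - 1)
    rw [sub_add_cancel] at e'
    exact e'

theorem tendsto_fderiv_rowMap (hyp : IsHyperbolic f g r s Γ) (hτ : τ ∈ solutions Γ) {v : ℤ}
    (hv : -(n : ℤ) ≤ v) (hv' : v < n) :
    Filter.Tendsto (fun τ' => fderiv 𝕜 (rowMap f) (row τ' M v, τ' 0 (v + 1))) (nearSol Γ M n τ)
      (𝓝 (fderiv 𝕜 (rowMap f) (row τ M v, τ 0 (v + 1)))) :=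
  (analyticAt_rowMap hyp hτ M v).fderiv.continuousAt.tendsto.comp
    ((tendsto_row hyp hτ hv hv'.le).prodMk_nhds (tendsto_col (by omega) (by omega)))

theorem tendsto_clm_apply {α V V' : Type*} [NormedAddCommGroup V] [NormedSpace 𝕜 V]
    [NormedAddCommGroup V'] [NormedSpace 𝕜 V'] {l : Filter α} {L : α → V →L[𝕜] V'}
    {L₀ : V →L[𝕜] V'} {x : α → V} {x₀ : V} (hL : Filter.Tendsto L l (𝓝 L₀))
    (hx : Filter.Tendsto x l (𝓝 x₀)) : Filter.Tendsto (fun a => L a (x a)) l (𝓝 (L₀ x₀)) :=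
  (isBoundedBilinearMap_apply.continuous.tendsto (L₀, x₀)).comp (hL.prodMk_nhds hx)

theorem tendsto_charVec (hyp : IsHyperbolic f g r s Γ) (hτ : τ ∈ solutions Γ) {v : ℤ} (k : ℕ)
    (hv : -(n : ℤ) ≤ v - k - 1) (hv' : v ≤ n) :
    Filter.Tendsto (fun τ' => charVec f τ' M k v) (nearSol Γ M n τ) (𝓝 (charVec f τ M k v)) := by
  induction k generalizing v with
  | zero =>
    have h := tendsto_fderiv_rowMap (M := M) hyp hτ (v := v - 1) (n := n)
      (by simpa using hv) (by omega)
    exact tendsto_clm_apply h tendsto_const_nhds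
  | succ k ih =>
    push_cast at hv
    have h := tendsto_fderiv_rowMap (M := M) hyp hτ (v := v - 1) (n := n) (by omega) (by omega)
    have h2 := tendsto_clm_apply h
      ((ih (v := v - 1) (by omega) (by omega)).prodMk_nhds
        (tendsto_const_nhds (x := (0 : 𝕜))))
    exact h2

theorem eventually_det_charMat_ne (hyp : IsHyperbolic f g r s Γ) (hτ : τ ∈ solutions Γ)
    {I : Finset (Fin (M + 1))} {κ : Fin (M + 1) → ℕ} {w : Fin (M + 1) → Fin (M + 1) → 𝕜} {v : ℤ}
    (hv : 0 ≤ v) (hv' : v ≤ n) (hκ : ∀ i ∈ I, κ i < n) (hd : (charMat f I κ w τ v).det ≠ 0) :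
    ∀ᶠ τ' in nearSol Γ M n τ, (charMat f I κ w τ' v).det ≠ 0 := by
  have h : Filter.Tendsto (fun τ' => charMat f I κ w τ' v) (nearSol Γ M n τ)
      (𝓝 (charMat f I κ w τ v)) := by
    refine tendsto_pi_nhds.2 fun i => ?_
    by_cases hi : i ∈ I
    · have := hκ i hi
      simpa [charMat, hi] using tendsto_charVec hyp hτ (κ i) (by omega) hv'
    · simpa [charMat, hi] using tendsto_const_nhds
  exact ((continuous_id.matrix_det.tendsto _).comp h).eventually_ne hd

end Near

/-! ### Local inverses and the chart of rows through nearby solutions -/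

section Germ

variable {𝕜 : Type*} [RCLike 𝕜] {f g r s : 𝕜 → 𝕜 → 𝕜 → 𝕜} {Γ : Set (𝕜 × 𝕜 × 𝕜 × 𝕜)}
  {τ : ℤ → ℤ → 𝕜} {M : ℕ}

/-- A coordinate of the local inverse of an analytic local diffeomorphism. -/
theorem exists_coordinate_germ {ι : Type*} [Fintype ι] {Ψ : (ι → 𝕜) → (ι → 𝕜)}
    (hΨ : AnalyticAt 𝕜 Ψ 0) (hsurj : Function.Surjective (fderiv 𝕜 Ψ 0)) (i₀ : ι) :
    ∃ F₀ : (ι → 𝕜) → 𝕜, ContDiffAt 𝕜 ∞ F₀ (Ψ 0) ∧ ¬ Filter.EventuallyConst F₀ (𝓝 (Ψ 0)) ∧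
      (∀ᶠ z in 𝓝 0, F₀ (Ψ z) = z i₀) ∧
      ∃ φ : (ι → 𝕜) → (ι → 𝕜), Filter.Tendsto φ (𝓝 (Ψ 0)) (𝓝 0) ∧
        ∀ᶠ a in 𝓝 (Ψ 0), Ψ (φ a) = a := by
  classical
  have hinj : Function.Injective (fderiv 𝕜 Ψ 0) :=
    (LinearMap.injective_iff_surjective (f := (fderiv 𝕜 Ψ 0).toLinearMap)).2 hsurj
  let e : (ι → 𝕜) ≃L[𝕜] (ι → 𝕜) := (LinearEquiv.ofBijective (fderiv 𝕜 Ψ 0).toLinearMap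
    ⟨hinj, hsurj⟩).toContinuousLinearEquiv
  have he : HasFDerivAt Ψ (e : (ι → 𝕜) →L[𝕜] (ι → 𝕜)) 0 := hΨ.differentiableAt.hasFDerivAt
  have hC : ContDiffAt 𝕜 ∞ Ψ 0 := hΨ.contDiffAt
  have hn : (∞ : WithTop ℕ∞) ≠ 0 := by simp
  have hstrict := hC.hasStrictFDerivAt' he hn
  have hleft : ∀ᶠ z in 𝓝 0, hC.localInverse he hn (Ψ z) = z := hstrict.eventually_left_inverse
  have hproj : ∀ z : ι → 𝕜, ContDiffAt 𝕜 ∞ (fun z : ι → 𝕜 => z i₀) z := fun z =>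
    (ContinuousLinearMap.proj (R := 𝕜) (φ := fun _ : ι => 𝕜) i₀).contDiff.contDiffAt
  have hF : ∀ᶠ z in 𝓝 0, hC.localInverse he hn (Ψ z) i₀ = z i₀ :=
    hleft.mono fun z hz => by rw [hz]
  refine ⟨fun a => hC.localInverse he hn a i₀, ?_, fun hconst => ?_, hF,
    hC.localInverse he hn, hstrict.localInverse_tendsto, hstrict.eventually_right_inverse⟩
  · exact ContDiffAt.comp (g := fun z : ι → 𝕜 => z i₀) _ (hproj _) (hC.to_localInverse he hn)
  · obtain ⟨c, hc⟩ := Filter.eventuallyConst_iff_exists_eventuallyEq.1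
      -- If the germ were constant, so would be its composition with `Ψ`, which is the coordinate `z
      -- i₀`.
      (hconst.comp_tendsto hΨ.continuousAt.tendsto)
    have h1 : ∀ᶠ z : ι → 𝕜 in 𝓝 0, z i₀ = c := by
      filter_upwards [hF, hc] with z h1 h2
      rw [← h1]
      exact h2
    have h2 : Filter.Tendsto (fun y : 𝕜 => Pi.single (M := fun _ : ι => 𝕜) i₀ y) (𝓝 0) (𝓝 0) := by
      have : Continuous (fun y : 𝕜 => Pi.single (M := fun _ : ι => 𝕜) i₀ y) :=
        (ContinuousLinearMap.single 𝕜 (fun _ : ι => 𝕜) i₀).continuous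
      simpa using this.tendsto 0
    have h3 : ∀ᶠ y : 𝕜 in 𝓝 0, y = c := by
      filter_upwards [h2.eventually h1] with y hy
      simpa using hy
    have h4 : (0 : 𝕜) = c := h3.self_of_nhds
    have h5 : ∀ᶠ y : 𝕜 in 𝓝[≠] 0, False := by
      filter_upwards [h3.filter_mono nhdsWithin_le_nhds, self_mem_nhdsWithin] with y h h'
      exact h' (h.trans h4.symm)
    simpa using h5.exists

variable {I : Finset (Fin (M + 1))} {κ : Fin (M + 1) → ℕ}
  {w : Fin (M + 1) → Fin (M + 1) → 𝕜}

/-- Every vector at height `v` is, up to the span of the `X_k`, the image of a vector at the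
height `v - n`. -/
theorem exists_propagate_sub_mem (hyp : IsHyperbolic f g r s Γ) (hind : HasIndependentVariables Γ)
    (hτ : τ ∈ solutions Γ) (n : ℕ) (v : ℤ) (x : Fin (M + 1) → 𝕜) :
    ∃ x' : Fin (M + 1) → 𝕜, propagate f τ (v - n) x' 0 n - x ∈
      Submodule.span 𝕜 (Set.range fun k => charVec f τ M k v) := by
  induction n generalizing v x with
  | zero => exact ⟨x, by simp [propagate]⟩
  | succ n ih =>
    -- The vector is pulled down one step by `rowDerivInv`; carrying it up again reproduces it up to
    -- a multiple of `X_1`, and `rowDeriv` maps the span of the `X_k` at `v - 1` into the span at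
    -- `v`.
    obtain ⟨x', hx'⟩ := ih (v - 1) (rowDerivInv g τ M (v - 1) x)
    refine ⟨x', ?_⟩
    have e1 : v - ((n + 1 : ℕ) : ℤ) = v - 1 - n := by push_cast; ring
    have e2 : v - 1 - (n : ℤ) + n = v - 1 := by ring
    have h := rowDeriv_rowDerivInv hyp hind hτ (v - 1) x 0
    rw [zero_smul, add_zero] at h
    rw [e1, propagate, e2, Pi.zero_apply, zero_smul, add_zero]
    have h2 : rowDeriv f τ M (v - 1) (propagate f τ (v - 1 - n) x' 0 n) - x =
        rowDeriv f τ M (v - 1) (propagate f τ (v - 1 - n) x' 0 n - rowDerivInv g τ M (v - 1) x) -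
          x 0 • colDeriv f τ M (v - 1) := by
      rw [map_sub, eq_sub_of_add_eq h]
      abel
    rw [h2]
    refine Submodule.sub_mem _ ?_ (Submodule.smul_mem _ _ (Submodule.subset_span ⟨0, rfl⟩))
    have h3 : Submodule.span 𝕜 (Set.range fun k => charVec f τ M k (v - 1)) ≤
        (Submodule.span 𝕜 (Set.range fun k => charVec f τ M k v)).comap
          (rowDeriv f τ M (v - 1)).toLinearMap := by
      rw [Submodule.span_le]
      rintro _ ⟨k, rfl⟩
      exact Submodule.subset_span ⟨k + 1, rfl⟩
    exact h3 hx'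

/-- A family of rows near the row of `τ` at height `0`: the coordinates `z i`, `i ∈ I`, change the
values of the column `u = 0` at the heights `-κ i`, the others change the row at height `-n`. -/
def chart (f : 𝕜 → 𝕜 → 𝕜 → 𝕜) (τ : ℤ → ℤ → 𝕜) (I : Finset (Fin (M + 1)))
    (κ : Fin (M + 1) → ℕ) (n : ℕ) (x : Fin (M + 1) → Fin (M + 1) → 𝕜)
    (z : Fin (M + 1) → 𝕜) : Fin (M + 1) → 𝕜 :=
  rowIter f (row τ M (-n) + ∑ i, if i ∈ I then 0 else z i • x i)
    (fun h => τ 0 (-n + h + 1) + ∑ i, if i ∈ I ∧ n = κ i + h + 1 then z i else 0) n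

theorem chart_zero (hyp : IsHyperbolic f g r s Γ) (hτ : τ ∈ solutions Γ) (n : ℕ)
    (x : Fin (M + 1) → Fin (M + 1) → 𝕜) : chart f τ I κ n x 0 = row τ M 0 := by
  unfold chart
  rw [rowIter_row hyp hτ (v := -n)]
  · simp
  · simp
  · simp

theorem analyticAt_chart (hyp : IsHyperbolic f g r s Γ) (hτ : τ ∈ solutions Γ) (n : ℕ)
    (x : Fin (M + 1) → Fin (M + 1) → 𝕜) : AnalyticAt 𝕜 (chart f τ I κ n x) 0 := by
  have hp : ∀ i, AnalyticAt 𝕜 (fun z : Fin (M + 1) → 𝕜 => z i) 0 := fun i =>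
    (ContinuousLinearMap.proj (R := 𝕜) (φ := fun _ : Fin (M + 1) => 𝕜) i).analyticAt _
  refine analyticAt_rowIter hyp hτ (v := -n) n ?_ ?_ ?_ ?_
  · refine analyticAt_const.add (Finset.analyticAt_fun_sum _ fun i _ => ?_)
    split_ifs
    · exact analyticAt_const
    · exact (hp i).smul analyticAt_const
  · intro h _
    refine analyticAt_const.add (Finset.analyticAt_fun_sum _ fun i _ => ?_)
    split_ifs
    · exact hp i
    · exact analyticAt_const
  · simp
  · simp

/-- The derivative of `chart` in the direction of a coordinate `z i`, `i ∈ I`. -/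
theorem hasDerivAt_chart_of_mem (hyp : IsHyperbolic f g r s Γ) {τ' : ℤ → ℤ → 𝕜}
    (hτ' : τ' ∈ solutions Γ) {n : ℕ} {x : Fin (M + 1) → Fin (M + 1) → 𝕜} {z : Fin (M + 1) → 𝕜}
    (hrow : row τ' M (-n) = row τ M (-n) + ∑ i, if i ∈ I then 0 else z i • x i)
    (hcol : ∀ h < n, τ' 0 (-n + (h : ℕ) + 1) =
      τ 0 (-n + (h : ℕ) + 1) + ∑ i, if i ∈ I ∧ n = κ i + h + 1 then z i else 0)
    {i : Fin (M + 1)} (hi : i ∈ I) (hn : κ i < n) :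
    HasDerivAt (fun y : 𝕜 => chart f τ I κ n x (z + y • Pi.single i 1))
      (charVec f τ' M (κ i) 0) 0 := by
  have h := hasDerivAt_rowIter (M := M) hyp hτ' (v := -n) n
    (a := fun _ : 𝕜 => row τ' M (-n))
    (b := fun (y : 𝕜) (h : ℕ) => τ' 0 (-n + h + 1) + y * if h = n - 1 - κ i then 1 else 0)
    (b' := fun h => if h = n - 1 - κ i then 1 else 0) (y := 0)
    (hasDerivAt_const _ _) (fun h _ => hasDerivAt_line' _ _) rfl (by simp)
  -- The height `-κ i` is reached in step `n - 1 - κ i`, which leaves `κ i` further steps.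
  rw [propagate_single, if_pos (by omega)] at h
  have e1 : n - 1 - (n - 1 - κ i) = κ i := by omega
  rw [e1, neg_add_cancel] at h
  refine h.congr_of_eventuallyEq (Filter.Eventually.of_forall fun y => ?_)
  dsimp only [chart]
  have e2 : (row τ M (-n) + ∑ l, if l ∈ I then 0 else (z + y • (Pi.single i 1 : Fin (M + 1) → 𝕜)) l • x l) =
      row τ' M (-n) := by
    rw [hrow]
    congr 1
    refine Finset.sum_congr rfl fun l _ => ?_
    by_cases hl : l ∈ I
    · simp [hl]
    · have : l ≠ i := fun e => hl (e ▸ hi)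
      simp [hl, this]
  rw [e2]
  refine rowIter_congr fun h hh => ?_
  rw [hcol h hh]
  refine Eq.trans (congrArg (_ + ·) ?_) (add_assoc _ _ _).symm
  by_cases hk : h = n - 1 - κ i
  · have hk' : n = κ i + h + 1 := by omega
    rw [if_pos hk, mul_one]
    have : y = ∑ l, if l = i then y else 0 := by simp
    conv_rhs => rw [this]
    rw [← Finset.sum_add_distrib]
    refine Finset.sum_congr rfl fun l _ => ?_
    by_cases hl : l = i
    · subst hl
      simp [hi, ← hk']
    · simp [hl]
  · rw [if_neg hk, mul_zero, add_zero]
    refine Finset.sum_congr rfl fun l _ => ?_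
    by_cases hl : l = i
    · subst hl
      rw [if_neg (by omega), if_neg (by omega)]
    · simp [hl]

/-- The derivative of `chart` at `0` in the direction of a coordinate `z i`, `i ∉ I`. -/
theorem hasDerivAt_chart_of_notMem (hyp : IsHyperbolic f g r s Γ)
    (hτ : τ ∈ solutions Γ) {n : ℕ} {x : Fin (M + 1) → Fin (M + 1) → 𝕜}
    {i : Fin (M + 1)} (hi : i ∉ I) :
    HasDerivAt (fun y : 𝕜 => chart f τ I κ n x ((0 : Fin (M + 1) → 𝕜) + y • Pi.single i 1))
      (propagate f τ (-n) (x i) 0 n) 0 := by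
  have h := hasDerivAt_rowIter (M := M) hyp hτ (v := -n) n
    (a := fun y : 𝕜 => row τ M (-n) + y • x i) (b := fun (_ : 𝕜) (h : ℕ) => τ 0 (-n + h + 1))
    (b' := 0) (y := 0)
    (hasDerivAt_line _ _) (fun h _ => hasDerivAt_const _ _) (by simp) (by simp)
  refine h.congr_of_eventuallyEq (Filter.Eventually.of_forall fun y => ?_)
  dsimp only [chart]
  congr 1
  · rw [Finset.sum_eq_single i]
    · simp [hi]
    · intro l _ hl
      simp [hl]
    · simp
  · funext h
    rw [Finset.sum_eq_zero, add_zero]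
    intro l _
    split_ifs with hl
    · have : l ≠ i := fun e => hi (e ▸ hl.1)
      simp [this]
    · rfl

end Germ

/-! ### A nonconstant germ of a function of the row killed by all the `X_k` -/

section Germ

variable {𝕜 : Type*} [RCLike 𝕜] {f g r s : 𝕜 → 𝕜 → 𝕜 → 𝕜} {Γ : Set (𝕜 × 𝕜 × 𝕜 × 𝕜)}
  {τ : ℤ → ℤ → 𝕜} {M : ℕ} {I : Finset (Fin (M + 1))} {κ : Fin (M + 1) → ℕ}
  {w : Fin (M + 1) → Fin (M + 1) → 𝕜}

theorem charSpan_eq_span_range (hF : IsFrame f Γ I κ w) (hτ : τ ∈ solutions Γ)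
    (hd : (charMat f I κ w τ 0).det ≠ 0) :
    Submodule.span 𝕜 (Set.range fun k => charVec f τ M k 0) = charSpan f I κ τ 0 := by
  refine le_antisymm (Submodule.span_le.2 ?_) (Submodule.span_mono ?_)
  · rintro _ ⟨k, rfl⟩
    exact hF.charVec_mem hτ hd k
  · rintro _ ⟨i, -, rfl⟩
    exact ⟨κ i, rfl⟩

theorem eventually_differentiableAt {E : Type*} [NormedAddCommGroup E] [NormedSpace 𝕜 E]
    {F : E → 𝕜} {a₀ : E} (h : ContDiffAt 𝕜 ∞ F a₀) : ∀ᶠ a in 𝓝 a₀, DifferentiableAt 𝕜 F a := by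
  have := (h.of_le (m := 1) (by norm_cast)).eventually (by simp)
  filter_upwards [this] with a ha using ha.differentiableAt (by simp)

theorem fderiv_apply_of_hasDerivAt_line {E : Type*} [NormedAddCommGroup E] [NormedSpace 𝕜 E]
    {V : Type*} [NormedAddCommGroup V] [NormedSpace 𝕜 V]
    {Ψ : E → V} {z e : E} {c : V} (hΨ : DifferentiableAt 𝕜 Ψ z)
    (h : HasDerivAt (fun y : 𝕜 => Ψ (z + y • e)) c 0) : fderiv 𝕜 Ψ z e = c := by
  have h1 : HasDerivAt (fun y : 𝕜 => z + y • e) e 0 := by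
    simpa using ((hasDerivAt_id (0 : 𝕜)).smul_const e).const_add z
  have h2 : HasFDerivAt Ψ (fderiv 𝕜 Ψ z) (z + (0 : 𝕜) • e) := by
    simpa using hΨ.hasFDerivAt
  exact (h2.comp_hasDerivAt 0 h1).unique h

/-- The range contains the frame vectors, and modulo these also each constant row `w i`, `i ∉ I`, by
the choice of `x i`; together they form a basis. -/
theorem surjective_fderiv_chart (hyp : IsHyperbolic f g r s Γ)
    (hτ : τ ∈ solutions Γ) {n : ℕ}
    (hn : ∀ i ∈ I, κ i < n) (hd : (charMat f I κ w τ 0).det ≠ 0)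
    {x : Fin (M + 1) → Fin (M + 1) → 𝕜}
    (hx : ∀ i, propagate f τ (-n) (x i) 0 n - w i ∈ charSpan f I κ τ 0) :
    Function.Surjective (fderiv 𝕜 (chart f τ I κ n x) 0) := by
  have hda := (analyticAt_chart (I := I) (κ := κ) hyp hτ n x).differentiableAt
  set L := LinearMap.range (fderiv 𝕜 (chart f τ I κ n x) 0).toLinearMap with hL
  have h1 : charSpan f I κ τ 0 ≤ L := by
    refine Submodule.span_le.2 ?_
    rintro _ ⟨i, hi, rfl⟩
    exact ⟨Pi.single i 1, fderiv_apply_of_hasDerivAt_line hda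
      (hasDerivAt_chart_of_mem hyp hτ (by simp) (by simp) hi (hn i hi))⟩
  have h2 : ∀ i, charMat f I κ w τ 0 i ∈ L := by
    intro i
    by_cases hi : i ∈ I
    · refine h1 (Submodule.subset_span ⟨i, hi, ?_⟩)
      simp [charMat, hi]
    · have h3 : propagate f τ (-n) (x i) 0 n ∈ L :=
        ⟨Pi.single i 1, fderiv_apply_of_hasDerivAt_line hda
          (hasDerivAt_chart_of_notMem hyp hτ hi)⟩
      have h4 := L.sub_mem h3 (h1 (hx i))
      simpa [charMat, hi] using h4
  intro u
  have h5 := mem_span_rows_of_det_updateRow_eq_zero (u := u) hd (I := Finset.univ) (by simp)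
  have h6 : u ∈ L := by
    refine (Submodule.span_le.2 ?_) h5
    rintro _ ⟨i, -, rfl⟩
    exact h2 i
  exact h6

/-- Near a solution at which the frame is a basis there is a nonconstant function of the row
that is annihilated by all the `X_k`, and by the derivatives with respect to the values above. -/
theorem IsFrame.exists_germ (hF : IsFrame f Γ I κ w) (hyp : IsHyperbolic f g r s Γ)
    (hind : HasIndependentVariables Γ) {i₀ : Fin (M + 1)} (hi₀ : i₀ ∉ I) :
    ∃ τ ∈ solutions Γ, ∃ F₀ : (Fin (M + 1) → 𝕜) → 𝕜, ContDiffAt 𝕜 ∞ F₀ (row τ M 0) ∧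
      ¬ Filter.EventuallyConst F₀ (𝓝 (row τ M 0)) ∧
      ∃ n, ∀ᶠ τ' in nearSol Γ M n τ, ∀ k, fderiv 𝕜 F₀ (row τ' M 0) (charVec f τ' M k 0) = 0 ∧
        fderiv 𝕜 F₀ (row τ' M 0) (charVecInv g τ' M k 0) = 0 := by
  -- Starting at height `-n`, the chart passes all the heights `-κ i`. The same `n` is large enough
  -- to compare spans at height `n` in `IsFrame.charVec_mem_of_row_eq`.
  obtain ⟨n, hn⟩ : ∃ n, ∀ i ∈ I, κ i < n :=
    ⟨I.sup κ + 1, fun i hi => Nat.lt_succ_of_le (Finset.le_sup (f := κ) hi)⟩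
  obtain ⟨τ, hτ, hgen⟩ := hF.exists_generic hyp hind (n + 1)
  have hd0 : (charMat f I κ w τ 0).det ≠ 0 := by simpa using hgen 0 (by omega)
  have hx : ∀ i, ∃ x : Fin (M + 1) → 𝕜,
      propagate f τ (-n) x 0 n - w i ∈ charSpan f I κ τ 0 := by
    intro i
    obtain ⟨x, hx⟩ := exists_propagate_sub_mem hyp hind hτ n 0 (w i)
    rw [charSpan_eq_span_range hF hτ hd0, zero_sub] at hx
    exact ⟨x, hx⟩
  choose x hx using hx
  have hsurj := surjective_fderiv_chart hyp hτ hn hd0 hx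
  have hana := analyticAt_chart (I := I) (κ := κ) hyp hτ n x
  have hc0 := chart_zero (I := I) (κ := κ) hyp hτ n x
  obtain ⟨F₀, hsm, hnc, hFΨ, φ, hφ, hΨφ⟩ := exists_coordinate_germ hana hsurj i₀
  rw [hc0] at hsm hnc hφ hΨφ
  refine ⟨τ, hτ, F₀, hsm, hnc, n, ?_⟩
  -- the derivative of `F₀` vanishes along the coordinate lines of the chart
  have hkey : ∀ᶠ z in 𝓝 (0 : Fin (M + 1) → 𝕜),
      (∀ᶠ z' in 𝓝 z, F₀ (chart f τ I κ n x z') = z' i₀) ∧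
        DifferentiableAt 𝕜 F₀ (chart f τ I κ n x z) := by
    have h1 : Filter.Tendsto (chart f τ I κ n x) (𝓝 0) (𝓝 (row τ M 0)) := by
      rw [← hc0]
      exact hana.continuousAt.tendsto
    exact hFΨ.eventually_nhds.and (h1.eventually (eventually_differentiableAt hsm))
  -- solutions through the chart
  have hdet : ∀ᶠ τ' in nearSol Γ M n τ, ∀ i < n + 1, (charMat f I κ w τ' i).det ≠ 0 := by
    have : ∀ i ∈ Finset.range (n + 1), ∀ᶠ τ' in nearSol Γ M n τ,
        (charMat f I κ w τ' (i : ℕ)).det ≠ 0 := fun i hi =>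
      eventually_det_charMat_ne hyp hτ (by omega) (by simp at hi; omega) hn
        (hgen i (by simpa using hi))
    filter_upwards [(Filter.eventually_all_finset _).2 this] with τ' h i hi
    exact h i (by simpa using hi)
  -- The parameters are the chart coordinates `q.1` and the values `q.2` of the column above height
  -- `0`. Here `a` is the row at height `-n`; `b` is the column, read from `q.2` above `0`, from the
  -- row at `-n`, and elsewhere from `τ`, changed by `q.1 i` at the heights `-κ i`.
  let a : (Fin (M + 1) → 𝕜) × (ℤ → 𝕜) → Fin (M + 1) → 𝕜 := fun q =>
    row τ M (-n) + ∑ i, if i ∈ I then 0 else q.1 i • x i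
  let b : (Fin (M + 1) → 𝕜) × (ℤ → 𝕜) → ℤ → 𝕜 := fun q h =>
    if 0 < h then q.2 h else if h = -n then a q 0 else
      τ 0 h + ∑ i, if i ∈ I ∧ h = -κ i then q.1 i else 0
  have ha : Continuous a := by
    refine continuous_const.add (continuous_finsetSum _ fun i _ => ?_)
    split_ifs
    · exact continuous_const
    · fun_prop
  have hb : ∀ h, Continuous (fun q => b q h) := by
    intro h
    dsimp only [b]
    split_ifs
    · fun_prop
    · fun_prop
    · refine continuous_const.add (continuous_finsetSum _ fun i _ => ?_)
      split_ifs
      · fun_prop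
      · exact continuous_const
  have ha0 : a (0, fun i => τ 0 i) = row τ M (-n) := by simp [a]
  have hb0 : ∀ h, b (0, fun i => τ 0 i) h = τ 0 h := by
    intro h
    dsimp only [b]
    split_ifs with h1 h2
    · rfl
    · rw [ha0, h2]
      simp [row]
    · simp
  have hchart : ∀ q, ∀ τ' ∈ solutions Γ, row τ' M (-n) = a q →
      (∀ i, |i - (-n : ℤ)| ≤ (2 * n : ℕ) → τ' 0 i = b q i) →
      (∀ h < n, τ' 0 (-n + (h : ℕ) + 1) =
        τ 0 (-n + (h : ℕ) + 1) + ∑ i, if i ∈ I ∧ n = κ i + h + 1 then q.1 i else 0) ∧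
      row τ' M 0 = chart f τ I κ n x q.1 := by
    intro q τ' hτ' hr hcl
    have hcol : ∀ h < n, τ' 0 (-n + (h : ℕ) + 1) =
        τ 0 (-n + (h : ℕ) + 1) + ∑ i, if i ∈ I ∧ n = κ i + h + 1 then q.1 i else 0 := by
      intro h hh
      rw [hcl _ (abs_le.2 ⟨by push_cast; omega, by push_cast; omega⟩)]
      dsimp only [b]
      rw [if_neg (by omega), if_neg (by omega)]
      congr 1
      refine Finset.sum_congr rfl fun i _ => ?_
      refine if_congr (and_congr_right fun _ => ?_) rfl rfl
      omega
    refine ⟨hcol, ?_⟩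
    have := rowIter_row hyp hτ' (n := n) hr.symm fun h hh => (hcol h hh).symm
    rw [neg_add_cancel] at this
    exact this.symm
  have hex : ∀ᶠ q in 𝓝 ((0 : Fin (M + 1) → 𝕜), fun i : ℤ => τ 0 i), ∃ τ' ∈ solutions Γ,
      (row τ' M (-n) = a q ∧ ∀ i, |i - (-n : ℤ)| ≤ (2 * n : ℕ) → τ' 0 i = b q i) ∧
      ∀ i < n + 1, (charMat f I κ w τ' i).det ≠ 0 := by
    have h1 := eventually_exists_row (p₀ := ((0 : Fin (M + 1) → 𝕜), fun i : ℤ => τ 0 i)) hind hτ M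
      (2 * n) (-n) (a := a) (b := b) ha.continuousAt (fun i _ => (hb i).continuousAt) ha0
      (fun i _ => hb0 i) (fun q => by
        dsimp only [b]
        rw [if_neg (by omega), if_pos rfl])
    have h2 : Filter.Tendsto (fun q : (Fin (M + 1) → 𝕜) × (ℤ → 𝕜) =>
        ((chart f τ I κ n x q.1, fun i : Finset.Icc (-(n : ℤ)) n => b q i) :
          (Fin (M + 1) → 𝕜) × (Finset.Icc (-(n : ℤ)) n → 𝕜)))
        (𝓝 ((0 : Fin (M + 1) → 𝕜), fun i : ℤ => τ 0 i)) (𝓝 (crossMap M n τ)) := by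
      refine Filter.Tendsto.prodMk_nhds ?_ (tendsto_pi_nhds.2 fun i => ?_)
      · rw [← hc0]
        exact hana.continuousAt.tendsto.comp (continuous_fst.tendsto _)
      · have := (hb i).tendsto ((0 : Fin (M + 1) → 𝕜), fun i : ℤ => τ 0 i)
        rwa [hb0] at this
    filter_upwards [h1, h2.eventually (eventually_nearSol.1 hdet)] with q hq hq'
    obtain ⟨τ', hτ', hr, hcl⟩ := hq
    refine ⟨τ', hτ', ⟨hr, hcl⟩, hq' τ' hτ' ?_⟩
    refine Prod.ext (hchart q τ' hτ' hr hcl).2 (funext fun i => ?_)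
    have := Finset.mem_Icc.1 i.2
    exact hcl i (abs_le.2 ⟨by push_cast; omega, by push_cast; omega⟩)
  -- the parameters of a nearby solution
  have hpar : Filter.Tendsto (fun τ' : ℤ → ℤ → 𝕜 =>
      ((φ (row τ' M 0), fun i : ℤ => if 0 < i ∧ i ≤ n then τ' 0 i else τ 0 i) :
        (Fin (M + 1) → 𝕜) × (ℤ → 𝕜))) (nearSol Γ M n τ)
      (𝓝 ((0 : Fin (M + 1) → 𝕜), fun i : ℤ => τ 0 i)) := by
    refine Filter.Tendsto.prodMk_nhds (hφ.comp tendsto_row_zero) (tendsto_pi_nhds.2 fun i => ?_)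
    by_cases hi : 0 < i ∧ i ≤ n
    · simpa only [hi, and_self, if_true] using tendsto_col (by omega) hi.2
    · simpa only [hi, if_false] using tendsto_const_nhds
  filter_upwards [eventually_mem_nearSol, hdet, hpar.eventually hex,
    tendsto_row_zero.eventually hΨφ, (hφ.comp tendsto_row_zero).eventually hkey]
    with τ₁ hτ₁ hd₁ hex₁ hrow₁ hkey₁ k
  -- `τ'` comes from the chart and shares with `τ₁` the row at height `0` and the column at the
  -- heights `1, …, n`, but not necessarily the values below.
  obtain ⟨τ', hτ', ⟨hr, hcl⟩, hd'⟩ := hex₁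
  obtain ⟨hcol, hrow'⟩ := hchart _ τ' hτ' hr hcl
  have hrow : row τ₁ M 0 = row τ' M 0 := by
    rw [hrow']
    exact hrow₁.symm
  -- Along the chart line in a direction `i ∈ I`, `F₀` is the coordinate `z i₀` with `i₀ ≠ i`, hence
  -- constant; the velocity of this line is the frame vector of `τ'`.
  have hann : charSpan f I κ τ' 0 ≤ LinearMap.ker (fderiv 𝕜 F₀ (row τ₁ M 0)).toLinearMap := by
    refine Submodule.span_le.2 ?_
    rintro _ ⟨i, hi, rfl⟩
    have h1 := hasDerivAt_chart_of_mem (x := x) (z := φ (row τ₁ M 0)) hyp hτ' hr hcol hi (hn i hi)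
    have h2 : HasFDerivAt F₀ (fderiv 𝕜 F₀ (row τ₁ M 0)) (chart f τ I κ n x
        (φ (row τ₁ M 0) + (0 : 𝕜) • Pi.single i 1)) := by
      rw [zero_smul, add_zero]
      have := hkey₁.2.hasFDerivAt
      simp only [Function.comp_apply] at this
      rwa [hrow₁] at this ⊢
    have h3 := h2.comp_hasDerivAt (0 : 𝕜) h1
    have hc : Filter.Tendsto (fun y : 𝕜 => φ (row τ₁ M 0) + y • Pi.single i 1) (𝓝 0)
        (𝓝 (φ (row τ₁ M 0))) := by
      have : Continuous (fun y : 𝕜 => φ (row τ₁ M 0) + y • (Pi.single i 1 : Fin (M + 1) → 𝕜)) := by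
        fun_prop
      simpa using this.tendsto 0
    refine h3.unique ((hasDerivAt_const (0 : 𝕜) (φ (row τ₁ M 0) i₀)).congr_of_eventuallyEq ?_)
    filter_upwards [hc.eventually hkey₁.1] with y hy
    simp only [Function.comp_apply]
    rw [hy]
    have : i₀ ≠ i := fun e => hi₀ (e ▸ hi)
    simp [this]
  refine ⟨hann ?_, ?_⟩
  · refine hF.charVec_mem_of_row_eq hyp hind hτ' hτ₁ hn hd' hrow (fun i hi => ?_) k
    rw [hcl _ (abs_le.2 ⟨by push_cast; omega, by push_cast; omega⟩)]
    dsimp only [b]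
    rw [if_pos (by omega), if_pos ⟨by omega, by omega⟩]
  · have hmem := hF.charVecInv_mem hyp hind hτ₁ (by simpa using hd₁ 0 (by omega)) k
    have hle : charSpan f I κ τ₁ 0 ≤ charSpan f I κ τ' 0 := by
      refine Submodule.span_le.2 ?_
      rintro _ ⟨i, -, rfl⟩
      refine hF.charVec_mem_of_row_eq hyp hind hτ' hτ₁ hn hd' hrow (fun i hi => ?_) (κ i)
      rw [hcl _ (abs_le.2 ⟨by push_cast; omega, by push_cast; omega⟩)]
      dsimp only [b]
      rw [if_pos (by omega), if_pos ⟨by omega, by omega⟩]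
    exact hann (hle hmem)

end Germ

/-! ### Transport of the germ to all heights -/

section Transport

variable {𝕜 : Type*} [RCLike 𝕜] {f g r s : 𝕜 → 𝕜 → 𝕜 → 𝕜} {Γ : Set (𝕜 × 𝕜 × 𝕜 × 𝕜)}
  {τ : ℤ → ℤ → 𝕜} {M : ℕ}

/-- The map from rows at height `m` to rows at height `0` given by the lower shifts with the
values of the column `u = 0` of `τ`. -/
def downIter (g : 𝕜 → 𝕜 → 𝕜 → 𝕜) (τ : ℤ → ℤ → 𝕜) : ℕ → (Fin (M + 1) → 𝕜) → Fin (M + 1) → 𝕜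
  | 0, a => a
  | m + 1, a => downIter g τ m (rowMapInv g (a, τ 0 m))

/-- The map from rows at height `-m` to rows at height `0` given by the upper shifts with the
values of the column `u = 0` of `τ`. -/
def upIter (f : 𝕜 → 𝕜 → 𝕜 → 𝕜) (τ : ℤ → ℤ → 𝕜) : ℕ → (Fin (M + 1) → 𝕜) → Fin (M + 1) → 𝕜
  | 0, a => a
  | m + 1, a => upIter f τ m (rowMap f (a, τ 0 (-m)))

theorem downIter_row (hyp : IsHyperbolic f g r s Γ) {τ' : ℤ → ℤ → 𝕜} (hτ' : τ' ∈ solutions Γ)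
    {m : ℕ} (h : ∀ i < m, τ' 0 (i : ℕ) = τ 0 (i : ℕ)) :
    downIter g τ m (row τ' M m) = row τ' M 0 := by
  induction m with
  | zero => rfl
  | succ m ih =>
    rw [downIter, ← h m (by omega)]
    push_cast
    rw [rowMapInv_row hyp hτ', ih fun i hi => h i (by omega)]

theorem upIter_row (hyp : IsHyperbolic f g r s Γ) {τ' : ℤ → ℤ → 𝕜} (hτ' : τ' ∈ solutions Γ)
    {m : ℕ} (h : ∀ i < m, τ' 0 (-(i : ℕ)) = τ 0 (-(i : ℕ))) :
    upIter f τ m (row τ' M (-m)) = row τ' M 0 := by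
  induction m with
  | zero => rfl
  | succ m ih =>
    have e : (-(m : ℤ)) = -((m + 1 : ℕ) : ℤ) + 1 := by push_cast; ring
    rw [upIter, ← h m (by omega)]
    rw [e, rowMap_row hyp hτ', ← e, ih fun i hi => h i (by omega)]

theorem analyticAt_downIter (hyp : IsHyperbolic f g r s Γ) (hτ : τ ∈ solutions Γ) (m : ℕ) :
    AnalyticAt 𝕜 (downIter g τ m) (row τ M m) := by
  induction m with
  | zero => exact analyticAt_id
  | succ m ih =>
    rw [← rowMapInv_row hyp hτ] at ih
    have h := analyticAt_rowMapInv hyp hτ M m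
    push_cast
    have h' : AnalyticAt 𝕜 (fun a : Fin (M + 1) → 𝕜 => rowMapInv g (a, τ 0 m))
        (row τ M (m + 1)) :=
      h.fun_comp (f := fun a => (a, τ 0 m)) (analyticAt_id.prod analyticAt_const)
    exact AnalyticAt.fun_comp (f := fun a => rowMapInv g (a, τ 0 m)) ih h'

theorem analyticAt_upIter (hyp : IsHyperbolic f g r s Γ) (hτ : τ ∈ solutions Γ) (m : ℕ) :
    AnalyticAt 𝕜 (upIter f τ m) (row τ M (-m)) := by
  induction m with
  | zero => exact analyticAt_id
  | succ m ih =>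
    have e : (-(m : ℤ)) = -((m + 1 : ℕ) : ℤ) + 1 := by push_cast; ring
    have h := analyticAt_rowMap hyp hτ M (-((m + 1 : ℕ) : ℤ))
    rw [e, ← rowMap_row hyp hτ] at ih
    rw [← e] at h ih
    have h' : AnalyticAt 𝕜 (fun a : Fin (M + 1) → 𝕜 => rowMap f (a, τ 0 (-m)))
        (row τ M (-((m + 1 : ℕ) : ℤ))) :=
      h.fun_comp (f := fun a => (a, τ 0 (-m))) (analyticAt_id.prod analyticAt_const)
    exact AnalyticAt.fun_comp (f := fun a => rowMap f (a, τ 0 (-m))) ih h'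

theorem hasDerivAt_downIter (hyp : IsHyperbolic f g r s Γ) {τ' : ℤ → ℤ → 𝕜}
    (hτ' : τ' ∈ solutions Γ) {m k : ℕ} (h : ∀ i < m, τ' 0 (i : ℕ) = τ 0 (i : ℕ))
    {a : 𝕜 → Fin (M + 1) → 𝕜} {y : 𝕜} (ha : HasDerivAt a (charVecInv g τ' M k m) y)
    (ha₀ : a y = row τ' M m) :
    HasDerivAt (fun y => downIter g τ m (a y)) (charVecInv g τ' M (k + m) 0) y := by
  induction m generalizing a k with
  | zero => exact ha
  | succ m ih =>
    have h1 := hasDerivAt_rowMapInv hyp hτ' (v := m) ha (hasDerivAt_const y (τ 0 m))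
      (by rw [ha₀]; push_cast; rfl) (h m (by omega)).symm
    rw [zero_smul, add_zero] at h1
    have h2 := ih (k := k + 1) (fun i hi => h i (by omega)) h1 (by
      rw [ha₀, ← h m (by omega)]
      push_cast
      exact rowMapInv_row hyp hτ' M m)
    rw [show k + (m + 1) = k + 1 + m by ring]
    exact h2

theorem hasDerivAt_upIter (hyp : IsHyperbolic f g r s Γ) {τ' : ℤ → ℤ → 𝕜}
    (hτ' : τ' ∈ solutions Γ) {m k : ℕ} (h : ∀ i < m, τ' 0 (-(i : ℕ)) = τ 0 (-(i : ℕ)))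
    {a : 𝕜 → Fin (M + 1) → 𝕜} {y : 𝕜} (ha : HasDerivAt a (charVec f τ' M k (-m)) y)
    (ha₀ : a y = row τ' M (-m)) :
    HasDerivAt (fun y => upIter f τ m (a y)) (charVec f τ' M (k + m) 0) y := by
  induction m generalizing a k with
  | zero => exact ha
  | succ m ih =>
    have e : -((m + 1 : ℕ) : ℤ) + 1 = -(m : ℤ) := by push_cast; ring
    have h1 := hasDerivAt_rowMap hyp hτ' (v := -((m + 1 : ℕ) : ℤ)) ha
      (hasDerivAt_const y (τ 0 (-m))) ha₀ (by rw [e]; exact (h m (by omega)).symm)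
    rw [zero_smul, add_zero, ← charVec_succ, e] at h1
    have h2 := ih (k := k + 1) (fun i hi => h i (by omega)) h1 (by
      have := rowMap_row hyp hτ' M (-((m + 1 : ℕ) : ℤ))
      rw [e] at this
      rw [ha₀, ← h m (by omega), this])
    rw [show k + (m + 1) = k + 1 + m by ring]
    exact h2

/-- A function of a parameter and a variable `y` with vanishing derivative in `y` is locally
independent of `y`. -/
theorem eventually_eq_of_hasDerivAt_zero {Q : Type*} [TopologicalSpace Q] {h : Q → 𝕜 → 𝕜} {q₀ : Q}
    {y₀ : 𝕜} (hd : ∀ᶠ p in 𝓝 (q₀, y₀), HasDerivAt (h p.1) 0 p.2) :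
    ∀ᶠ p in 𝓝 (q₀, y₀), h p.1 p.2 = h p.1 y₀ := by
  rw [nhds_prod_eq] at hd
  obtain ⟨U, hU, V, hV, hUV⟩ := Filter.eventually_prod_iff.1 hd
  obtain ⟨ε, hε, hball⟩ := Metric.mem_nhds_iff.1 hV
  rw [nhds_prod_eq]
  refine Filter.eventually_prod_iff.2 ⟨U, hU, (· ∈ Metric.ball y₀ ε), Metric.ball_mem_nhds y₀ hε,
    fun {q} hq {y} hy => ?_⟩
  have hder : ∀ z ∈ Metric.ball y₀ ε, HasDerivAt (h q) 0 z := fun z hz => hUV hq (hball hz)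
  exact Metric.isOpen_ball.is_const_of_deriv_eq_zero
    (convex_ball y₀ ε).isPreconnected
    (fun z hz => (hder z hz).differentiableAt.differentiableWithinAt)
    (fun z hz => (hder z hz).deriv) hy (Metric.mem_ball_self hε)

variable {n : ℕ} {F₀ : (Fin (M + 1) → 𝕜) → 𝕜}

/-- Varying the column value at height `m` with the row at height `m + 1` fixed moves the row at
height `0` along `charVecInv` of index `m`, which `F₀` annihilates. The nearby data are realised by
a solution that keeps the column of `τ` at the remaining heights considered. -/
theorem eventually_hasDerivAt_downIter (hyp : IsHyperbolic f g r s Γ)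
    (hind : HasIndependentVariables Γ) (hτ : τ ∈ solutions Γ)
    (hF₀ : ContDiffAt 𝕜 ∞ F₀ (row τ M 0))
    (hann : ∀ᶠ τ' in nearSol Γ M n τ, ∀ k,
      fderiv 𝕜 F₀ (row τ' M 0) (charVecInv g τ' M k 0) = 0) (m : ℕ) :
    ∀ᶠ p : (Fin (M + 1) → 𝕜) × 𝕜 in 𝓝 (row τ M (m + 1), τ 0 m),
      HasDerivAt (fun y => F₀ (downIter g τ m (rowMapInv g (p.1, y)))) 0 p.2 := by
  let b : (Fin (M + 1) → 𝕜) × 𝕜 → ℤ → 𝕜 := fun p i =>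
    if i = m + 1 then p.1 0 else if i = m then p.2 else τ 0 i
  have hb : ∀ i, Continuous fun p => b p i := by
    intro i
    dsimp only [b]
    split_ifs <;> fun_prop
  have hb₀ : ∀ i, b (row τ M (m + 1), τ 0 m) i = τ 0 i := by
    intro i
    dsimp only [b]
    split_ifs with h1 h2
    · simp [h1, row]
    · rw [h2]
    · rfl
  have hex := eventually_exists_row (p₀ := (row τ M (m + 1), τ 0 m)) hind hτ M (m + 1 + n) (m + 1)
    (a := Prod.fst) (b := b) continuousAt_fst (fun i _ => (hb i).continuousAt) rfl
    (fun i _ => hb₀ i) (fun p => by simp [b])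
  have hD : Filter.Tendsto (fun p : (Fin (M + 1) → 𝕜) × 𝕜 => downIter g τ m (rowMapInv g p))
      (𝓝 (row τ M (m + 1), τ 0 m)) (𝓝 (row τ M 0)) := by
    have h1 := (analyticAt_rowMapInv hyp hτ M m).continuousAt.tendsto
    rw [rowMapInv_row hyp hτ] at h1
    have h2 := (analyticAt_downIter (M := M) hyp hτ m).continuousAt.tendsto
    rw [downIter_row hyp hτ fun i _ => rfl] at h2
    exact h2.comp h1
  have hcross : Filter.Tendsto (fun p : (Fin (M + 1) → 𝕜) × 𝕜 =>
      ((downIter g τ m (rowMapInv g p), fun i : Finset.Icc (-(n : ℤ)) n => b p i) :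
        (Fin (M + 1) → 𝕜) × (Finset.Icc (-(n : ℤ)) n → 𝕜)))
      (𝓝 (row τ M (m + 1), τ 0 m)) (𝓝 (crossMap M n τ)) := by
    refine hD.prodMk_nhds (tendsto_pi_nhds.2 fun i => ?_)
    have := (hb i).tendsto (row τ M (m + 1), τ 0 m)
    rwa [hb₀] at this
  filter_upwards [hex, hcross.eventually (eventually_nearSol.1 hann),
    hD.eventually (eventually_differentiableAt hF₀)] with p hp hp' hdiff
  obtain ⟨τ', hτ', hrow, hcol⟩ := hp
  have hm : τ' 0 m = p.2 := by
    rw [hcol _ (abs_le.2 ⟨by push_cast; omega, by push_cast; omega⟩)]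
    simp [b]
  have hlow : ∀ i < m, τ' 0 (i : ℕ) = τ 0 (i : ℕ) := by
    intro i hi
    rw [hcol _ (abs_le.2 ⟨by push_cast; omega, by push_cast; omega⟩)]
    dsimp only [b]
    rw [if_neg (by omega), if_neg (by omega)]
  have hrm : rowMapInv g p = row τ' M m := by
    rw [← rowMapInv_row hyp hτ', hrow, hm]
  have hr0 : downIter g τ m (rowMapInv g p) = row τ' M 0 := by
    rw [hrm, downIter_row hyp hτ' hlow]
  have hz := hp' τ' hτ' (Prod.ext hr0.symm (funext fun i => by
    have := Finset.mem_Icc.1 i.2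
    exact hcol i (abs_le.2 ⟨by push_cast; omega, by push_cast; omega⟩))) m
  have h1 := hasDerivAt_rowMapInv hyp hτ' (v := m) (hasDerivAt_const p.2 p.1) (hasDerivAt_id p.2)
    hrow.symm hm.symm
  rw [map_zero, zero_add, one_smul] at h1
  have h2 := hasDerivAt_downIter (τ := τ) (k := 0) hyp hτ' hlow h1 hrm
  rw [zero_add] at h2
  have h3 : HasFDerivAt F₀ (fderiv 𝕜 F₀ (row τ' M 0))
      (downIter g τ m (rowMapInv g (p.1, id p.2))) := by
    have e' : downIter g τ m (rowMapInv g (p.1, id p.2)) = row τ' M 0 := hr0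
    rw [e', ← hr0]
    exact hdiff.hasFDerivAt
  have h4 := h3.comp_hasDerivAt p.2 h2
  rwa [hz] at h4

/-- The mirror image: varying the value at height `-m` with the row at `-m - 1` fixed moves the row
at height `0` along `charVec` of index `m`. -/
theorem eventually_hasDerivAt_upIter (hyp : IsHyperbolic f g r s Γ)
    (hind : HasIndependentVariables Γ) (hτ : τ ∈ solutions Γ)
    (hF₀ : ContDiffAt 𝕜 ∞ F₀ (row τ M 0))
    (hann : ∀ᶠ τ' in nearSol Γ M n τ, ∀ k,
      fderiv 𝕜 F₀ (row τ' M 0) (charVec f τ' M k 0) = 0) (m : ℕ) :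
    ∀ᶠ p : (Fin (M + 1) → 𝕜) × 𝕜 in 𝓝 (row τ M (-m - 1), τ 0 (-m)),
      HasDerivAt (fun y => F₀ (upIter f τ m (rowMap f (p.1, y)))) 0 p.2 := by
  let b : (Fin (M + 1) → 𝕜) × 𝕜 → ℤ → 𝕜 := fun p i =>
    if i = -m - 1 then p.1 0 else if i = -m then p.2 else τ 0 i
  have hb : ∀ i, Continuous fun p => b p i := by
    intro i
    dsimp only [b]
    split_ifs <;> fun_prop
  have hb₀ : ∀ i, b (row τ M (-m - 1), τ 0 (-m)) i = τ 0 i := by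
    intro i
    dsimp only [b]
    split_ifs with h1 h2
    · simp [h1, row]
    · rw [h2]
    · rfl
  have hex := eventually_exists_row (p₀ := (row τ M (-m - 1), τ 0 (-m))) hind hτ M (m + 1 + n)
    (-m - 1) (a := Prod.fst) (b := b) continuousAt_fst (fun i _ => (hb i).continuousAt) rfl
    (fun i _ => hb₀ i) (fun p => by simp [b])
  have e : (-(m : ℤ)) - 1 + 1 = -m := by ring
  have hD : Filter.Tendsto (fun p : (Fin (M + 1) → 𝕜) × 𝕜 => upIter f τ m (rowMap f p))
      (𝓝 (row τ M (-m - 1), τ 0 (-m))) (𝓝 (row τ M 0)) := by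
    have h1 := (analyticAt_rowMap hyp hτ M (-m - 1)).continuousAt.tendsto
    rw [rowMap_row hyp hτ, e] at h1
    have h2 := (analyticAt_upIter (M := M) hyp hτ m).continuousAt.tendsto
    rw [upIter_row hyp hτ fun i _ => rfl] at h2
    exact h2.comp h1
  have hcross : Filter.Tendsto (fun p : (Fin (M + 1) → 𝕜) × 𝕜 =>
      ((upIter f τ m (rowMap f p), fun i : Finset.Icc (-(n : ℤ)) n => b p i) :
        (Fin (M + 1) → 𝕜) × (Finset.Icc (-(n : ℤ)) n → 𝕜)))
      (𝓝 (row τ M (-m - 1), τ 0 (-m))) (𝓝 (crossMap M n τ)) := by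
    refine hD.prodMk_nhds (tendsto_pi_nhds.2 fun i => ?_)
    have := (hb i).tendsto (row τ M (-m - 1), τ 0 (-m))
    rwa [hb₀] at this
  filter_upwards [hex, hcross.eventually (eventually_nearSol.1 hann),
    hD.eventually (eventually_differentiableAt hF₀)] with p hp hp' hdiff
  obtain ⟨τ', hτ', hrow, hcol⟩ := hp
  have hm : τ' 0 (-m) = p.2 := by
    rw [hcol _ (abs_le.2 ⟨by push_cast; omega, by push_cast; omega⟩)]
    dsimp only [b]
    rw [if_neg (by omega), if_pos rfl]
  have hlow : ∀ i < m, τ' 0 (-(i : ℕ)) = τ 0 (-(i : ℕ)) := by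
    intro i hi
    rw [hcol _ (abs_le.2 ⟨by push_cast; omega, by push_cast; omega⟩)]
    dsimp only [b]
    rw [if_neg (by omega), if_neg (by omega)]
  have hrm : rowMap f p = row τ' M (-m) := by
    have := rowMap_row hyp hτ' M (-m - 1)
    rwa [hrow, e, hm] at this
  have hr0 : upIter f τ m (rowMap f p) = row τ' M 0 := by
    rw [hrm, upIter_row hyp hτ' hlow]
  have hz := hp' τ' hτ' (Prod.ext hr0.symm (funext fun i => by
    have := Finset.mem_Icc.1 i.2
    exact hcol i (abs_le.2 ⟨by push_cast; omega, by push_cast; omega⟩))) m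
  have h1 := hasDerivAt_rowMap hyp hτ' (v := -m - 1) (hasDerivAt_const p.2 p.1)
    (hasDerivAt_id p.2) hrow.symm (by rw [e]; exact hm.symm)
  rw [map_zero, zero_add, one_smul, ← charVec_zero, e] at h1
  have h2 := hasDerivAt_upIter (τ := τ) (k := 0) hyp hτ' hlow h1 hrm
  rw [zero_add] at h2
  have h3 : HasFDerivAt F₀ (fderiv 𝕜 F₀ (row τ' M 0))
      (upIter f τ m (rowMap f (p.1, id p.2))) := by
    have e' : upIter f τ m (rowMap f (p.1, id p.2)) = row τ' M 0 := hr0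
    rw [e', ← hr0]
    exact hdiff.hasFDerivAt
  have h4 := h3.comp_hasDerivAt p.2 h2
  rwa [hz] at h4

/-- The invariant whose restriction to the height `0` is `F₀`, transported along `τ`. -/
noncomputable def transport (f g : 𝕜 → 𝕜 → 𝕜 → 𝕜) (τ : ℤ → ℤ → 𝕜)
    (F₀ : (Fin (M + 1) → 𝕜) → 𝕜) (v : ℤ) (a : Fin (M + 1) → 𝕜) : 𝕜 :=
  if 0 ≤ v then F₀ (downIter g τ v.toNat a) else F₀ (upIter f τ (-v).toNat a)

theorem transport_natCast (m : ℕ) (a : Fin (M + 1) → 𝕜) :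
    transport f g τ F₀ m a = F₀ (downIter g τ m a) := by
  simp [transport]

theorem transport_neg_natCast (m : ℕ) (a : Fin (M + 1) → 𝕜) :
    transport f g τ F₀ (-m) a = F₀ (upIter f τ m a) := by
  rcases m with _ | m
  · simp [transport, upIter, downIter]
  · rw [transport, if_neg (by omega)]
    simp

/-- At each step `transport` inserts the column value of `τ` instead of the actual one, which is
`p.1 0` on the way down and `p.2` on the way up. By the vanishing derivatives the result does not
depend on this value; with the actual one inserted, the two sides agree. -/
theorem eventually_transport_rowMap (hyp : IsHyperbolic f g r s Γ)
    (hind : HasIndependentVariables Γ) (hτ : τ ∈ solutions Γ)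
    (hF₀ : ContDiffAt 𝕜 ∞ F₀ (row τ M 0))
    (hann : ∀ᶠ τ' in nearSol Γ M n τ, ∀ k, fderiv 𝕜 F₀ (row τ' M 0) (charVec f τ' M k 0) = 0 ∧
        fderiv 𝕜 F₀ (row τ' M 0) (charVecInv g τ' M k 0) = 0) (v : ℤ) :
    ∀ᶠ p in 𝓝 (row τ M v, τ 0 (v + 1)),
      transport f g τ F₀ (v + 1) (rowMap f p) = transport f g τ F₀ v p.1 := by
  obtain ⟨m, rfl | hm⟩ : ∃ m : ℕ, v = m ∨ v = -m - 1 := by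
    rcases le_or_gt 0 v with h | h
    · exact ⟨v.toNat, Or.inl (by omega)⟩
    · exact ⟨(-v - 1).toNat, Or.inr (by omega)⟩
  · have h1 := eventually_eq_of_hasDerivAt_zero (h := fun a y =>
      F₀ (downIter g τ m (rowMapInv g (a, y)))) (eventually_hasDerivAt_downIter hyp hind hτ hF₀
        (hann.mono fun τ' h k => (h k).2) m)
    have h2 : Filter.Tendsto (fun p : (Fin (M + 1) → 𝕜) × 𝕜 => (rowMap f p, p.1 0))
        (𝓝 (row τ M m, τ 0 (m + 1))) (𝓝 (row τ M (m + 1), τ 0 m)) := by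
      refine Filter.Tendsto.prodMk_nhds ?_ ?_
      · rw [← rowMap_row hyp hτ]
        exact (analyticAt_rowMap hyp hτ M m).continuousAt.tendsto
      · have : Continuous (fun p : (Fin (M + 1) → 𝕜) × 𝕜 => p.1 0) := by fun_prop
        exact this.tendsto (row τ M m, τ 0 (m + 1))
    filter_upwards [h2.eventually h1, eventually_rowMapInv_rowMap hyp hind hτ M m] with p hp hp'
    rw [hp'] at hp
    rw [transport_natCast, hp]
    exact_mod_cast transport_natCast (m + 1) (rowMap f p)
  · have h1 := eventually_eq_of_hasDerivAt_zero (h := fun a y =>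
      F₀ (upIter f τ m (rowMap f (a, y)))) (eventually_hasDerivAt_upIter hyp hind hτ hF₀
        (hann.mono fun τ' h k => (h k).1) m)
    have e1 : v + 1 = -m := by omega
    have e2 : v = -((m + 1 : ℕ) : ℤ) := by push_cast; omega
    rw [e1, hm]
    filter_upwards [h1] with p hp
    rw [transport_neg_natCast, ← hm, e2, transport_neg_natCast]
    exact hp

theorem contDiffAt_transport (hyp : IsHyperbolic f g r s Γ) (hτ : τ ∈ solutions Γ)
    (hF₀ : ContDiffAt 𝕜 ∞ F₀ (row τ M 0)) (v : ℤ) :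
    ContDiffAt 𝕜 ∞ (transport f g τ F₀ v) (row τ M v) := by
  rcases le_or_gt 0 v with h | h
  · obtain ⟨m, rfl⟩ := Int.eq_ofNat_of_zero_le h
    have h1 := (analyticAt_downIter (M := M) hyp hτ m).contDiffAt (n := ∞)
    rw [← downIter_row (M := M) (τ := τ) (m := m) hyp hτ fun i _ => rfl] at hF₀
    exact (hF₀.comp _ h1).congr_of_eventuallyEq
      (Filter.Eventually.of_forall fun a => transport_natCast m a)
  · obtain ⟨m, rfl⟩ : ∃ m : ℕ, v = -m := ⟨(-v).toNat, by omega⟩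
    have h1 := (analyticAt_upIter (M := M) hyp hτ m).contDiffAt (n := ∞)
    rw [← upIter_row (M := M) (τ := τ) (m := m) hyp hτ fun i _ => rfl] at hF₀
    exact (hF₀.comp _ h1).congr_of_eventuallyEq
      (Filter.Eventually.of_forall fun a => transport_neg_natCast m a)

theorem admitsNontrivialInvariant_of_isFiniteDimensional (hyp : IsHyperbolic f g r s Γ)
    (hind : HasIndependentVariables Γ) (h : IsFiniteDimensional f g Γ) :
    AdmitsNontrivialInvariant f Γ := by
  -- The bound `M` on the dimension serves as the order of the invariant: rows of `M + 1` entries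
  -- leave room for a direction outside the span. The invariant built below has no column variables,
  -- so `K = 0`.
  obtain ⟨M, hM⟩ := h
  obtain ⟨I, κ, w, ⟨i₀, hi₀⟩, hF⟩ := exists_isFrame hind (det_charVec_eq_zero hyp hind hM)
  obtain ⟨τ, hτ, F₀, hsm, hnc, n, hann⟩ := hF.exists_germ hyp hind hi₀
  refine ⟨τ, hτ, M, 0, fun v p => transport f g τ F₀ v p.1, ⟨fun v => ?_, fun v => ?_⟩, 0,
    fun hc => hnc ?_⟩
  · exact ContDiffAt.comp (g := transport f g τ F₀ v) (f := Prod.fst) _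
      (contDiffAt_transport hyp hτ hsm v) contDiffAt_fst
  · have hcont : Continuous (fun q : (ℕ → 𝕜) × (ℕ → 𝕜) =>
        ((fun j : Fin (M + 1) => q.1 j, q.2 0) : (Fin (M + 1) → 𝕜) × 𝕜)) := by fun_prop
    have ht := hcont.tendsto (fun j : ℕ => τ j v, fun k : ℕ => τ 0 (v + 1 + k))
    have hbase : ((fun j : Fin (M + 1) => τ (j : ℕ) v, τ 0 (v + 1 + (0 : ℕ))) :
        (Fin (M + 1) → 𝕜) × 𝕜) = (row τ M v, τ 0 (v + 1)) := Prod.ext rfl (by simp)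
    change Filter.Tendsto _ _ (𝓝 ((fun j : Fin (M + 1) => τ (j : ℕ) v,
      τ 0 (v + 1 + (0 : ℕ))) : (Fin (M + 1) → 𝕜) × 𝕜)) at ht
    rw [hbase] at ht
    filter_upwards [ht.eventually (eventually_transport_rowMap hyp hind hτ hsm hann v)] with q hq
    rw [rowMap_eq] at hq
    exact hq
  · have ht : Filter.Tendsto (fun a : Fin (M + 1) → 𝕜 =>
        ((a, fun k : Fin 0 => τ 0 (0 + 1 + (k : ℕ))) : (Fin (M + 1) → 𝕜) × (Fin 0 → 𝕜)))
        (𝓝 (row τ M 0)) (𝓝 (fun j => τ (j : ℕ) 0, fun k => τ 0 (0 + 1 + (k : ℕ)))) :=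
      Filter.tendsto_id.prodMk_nhds tendsto_const_nhds
    have := hc.comp_tendsto ht
    simpa [Function.comp_def, transport, downIter] using this

end Transport

/-! ### From an invariant with column variables to germs of functions of rows -/

section Reduction

variable {𝕜 : Type*} [RCLike 𝕜] {f g r s : 𝕜 → 𝕜 → 𝕜 → 𝕜} {Γ : Set (𝕜 × 𝕜 × 𝕜 × 𝕜)}
  {τ : ℤ → ℤ → 𝕜} {M K : ℕ}

theorem continuousAt_rowIter (hyp : IsHyperbolic f g r s Γ) (hτ : τ ∈ solutions Γ) {v : ℤ}
    {P : Type*} [TopologicalSpace P] {a : P → Fin (M + 1) → 𝕜}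
    {b : P → ℕ → 𝕜} {p₀ : P} (n : ℕ) (ha : ContinuousAt a p₀)
    (hb : ∀ i < n, ContinuousAt (fun p => b p i) p₀)
    (ha₀ : a p₀ = row τ M v) (hb₀ : ∀ i < n, b p₀ i = τ 0 (v + i + 1)) :
    ContinuousAt (fun p => rowIter f (a p) (b p) n) p₀ := by
  induction n with
  | zero => exact ha
  | succ n ih =>
    have h1 := ih (fun i hi => hb i (by omega)) fun i hi => hb₀ i (by omega)
    have h2 := (analyticAt_rowMap hyp hτ M (v + n)).continuousAt
    rw [← rowIter_row hyp hτ ha₀ fun i hi => hb₀ i (by omega), ← hb₀ n (by omega)] at h2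
    exact ContinuousAt.comp (f := fun p => (rowIter f (a p) (b p) n, b p n)) h2
      (h1.prodMk (hb n (by omega)))

/-- The column of `τ` above the height `v`. -/
def colAbove (τ : ℤ → ℤ → 𝕜) (v : ℤ) : ℕ → 𝕜 := fun k => τ 0 (v + 1 + k)

/-- Iterating a relation between consecutive heights. -/
theorem eventually_rowIter_eq (hyp : IsHyperbolic f g r s Γ) (hτ : τ ∈ solutions Γ)
    {Φ : ℤ → (Fin (M + 1) → 𝕜) × (ℕ → 𝕜) → 𝕜}
    (h : ∀ v, ∀ᶠ p in 𝓝 (row τ M v, colAbove τ v),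
      Φ (v + 1) (rowMap f (p.1, p.2 0), fun k => p.2 (k + 1)) = Φ v p) (v : ℤ) (m : ℕ) :
    ∀ᶠ p in 𝓝 (row τ M v, colAbove τ v),
      Φ (v + m) (rowIter f p.1 p.2 m, fun k => p.2 (k + m)) = Φ v p := by
  induction m with
  | zero => simp [rowIter]
  | succ m ih =>
    have ht : Filter.Tendsto (fun p : (Fin (M + 1) → 𝕜) × (ℕ → 𝕜) =>
        (rowIter f p.1 p.2 m, fun k => p.2 (k + m))) (𝓝 (row τ M v, colAbove τ v))
        (𝓝 (row τ M (v + m), colAbove τ (v + m))) := by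
      refine Filter.Tendsto.prodMk_nhds ?_ (tendsto_pi_nhds.2 fun k => ?_)
      · have hb : ∀ i < m, (row τ M v, colAbove τ v).2 i = τ 0 (v + i + 1) := by
          intro i _
          simp only [colAbove]
          congr 1
          ring
        have := continuousAt_rowIter (M := M) (p₀ := (row τ M v, colAbove τ v)) hyp hτ (v := v)
          (a := Prod.fst) (b := Prod.snd) m continuousAt_fst (fun i _ => by fun_prop) rfl hb
        rw [← rowIter_row hyp hτ rfl hb]
        exact this.tendsto
      · have : Continuous (fun p : (Fin (M + 1) → 𝕜) × (ℕ → 𝕜) => p.2 (k + m)) := by fun_prop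
        have := this.tendsto (row τ M v, colAbove τ v)
        have e : colAbove τ (v + m) k = colAbove τ v (k + m) := by
          simp only [colAbove]
          congr 1
          push_cast
          ring
        rw [e]
        exact this
    filter_upwards [ih, ht.eventually (h (v + m))] with p h1 h2
    rw [← h1, ← h2, rowIter]
    push_cast
    rw [add_assoc, zero_add]
    congr 3
    funext k
    rw [add_right_comm, add_assoc]

variable {F : ℤ → (Fin (M + 1) → 𝕜) × (Fin K → 𝕜) → 𝕜}

/-- The relation between consecutive heights in terms of finite rows. -/
theorem IsInvariantNear.eventually_rowMap (hF : IsInvariantNear f τ M K F) (v : ℤ) :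
    ∀ᶠ p in 𝓝 (row τ M v, colAbove τ v),
      F (v + 1) (rowMap f (p.1, p.2 0), fun k => p.2 (k + 1)) = F v (p.1, fun k => p.2 k) := by
  -- The defining relation holds near an infinite row, so finite rows are continued by the entries
  -- of `τ`; `F` does not read them.
  let ext : (Fin (M + 1) → 𝕜) → ℕ → 𝕜 := fun a j => if h : j < M + 1 then a ⟨j, h⟩ else τ j v
  have hext : Continuous ext := by
    refine continuous_pi fun j => ?_
    dsimp only [ext]
    split_ifs <;> fun_prop
  have hext' : ∀ a, (fun j : Fin (M + 1) => ext a j) = a := by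
    intro a
    funext j
    exact dif_pos j.2
  have ht : Filter.Tendsto (fun p : (Fin (M + 1) → 𝕜) × (ℕ → 𝕜) => (ext p.1, p.2))
      (𝓝 (row τ M v, colAbove τ v)) (𝓝 (fun j : ℕ => τ j v, fun k : ℕ => τ 0 (v + 1 + k))) := by
    have hc : Continuous (fun p : (Fin (M + 1) → 𝕜) × (ℕ → 𝕜) => (ext p.1, p.2)) := by fun_prop
    have e : (fun j : ℕ => τ j v) = ext (row τ M v) := by
      funext j
      dsimp only [ext]
      split_ifs <;> rfl
    rw [e]
    exact hc.tendsto _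
  filter_upwards [ht.eventually (hF.2 v)] with p hp
  rw [hext'] at hp
  rw [← hp, ← rowMap_eq, hext']

/-- An invariant does not depend on the column. -/
theorem IsInvariantNear.eventually_eq (hyp : IsHyperbolic f g r s Γ)
    (hind : HasIndependentVariables Γ) (hτ : τ ∈ solutions Γ) (hF : IsInvariantNear f τ M K F)
    (v : ℤ) :
    ∀ᶠ p : (Fin (M + 1) → 𝕜) × (Fin K → 𝕜) in 𝓝 (row τ M v, fun k => colAbove τ v k),
      F v p = F v (p.1, fun k => colAbove τ v k) := by
  -- The relation is iterated from `K` steps below. There the column arguments of `F` are the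
  -- heights `u + 1, …, u + K`, so the column above `u + K`, which the left side reads, does not
  -- occur.
  obtain ⟨u, rfl⟩ : ∃ u, v = u + K := ⟨v - K, by ring⟩
  set σ := shift 0 u τ with hσdef
  have hσ : σ ∈ solutions Γ := shift_mem hτ 0 u
  have hrowσ : ∀ i, row σ M i = row τ M (i + u) := fun i => row_shift u i
  have hcolσ : ∀ i, σ 0 i = τ 0 (i + u) := fun i => by simp [σ, shift]
  -- The heights `u + 1, …, u + K - 1` carry the values of `τ`, the height `u + K` the first entry
  -- of the given row, and the next `K` heights the given column.
  let b : (Fin (M + 1) → 𝕜) × (Fin K → 𝕜) → ℕ → 𝕜 := fun p k =>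
    if h : k < K then (if k + 1 = K then p.1 0 else colAbove τ u k) else
      if h' : k - K < K then p.2 ⟨k - K, h'⟩ else colAbove τ u k
  have hb : ∀ k, Continuous fun p => b p k := by
    intro k
    dsimp only [b]
    split_ifs <;> fun_prop
  have hdown : ContinuousAt (downIter g σ K) (row τ M (u + K)) := by
    have := (analyticAt_downIter (M := M) hyp hσ K).continuousAt
    rwa [hrowσ, add_comm (K : ℤ) u] at this
  have hdown0 : downIter g σ K (row τ M (u + K)) = row τ M u := by
    have := downIter_row (M := M) (τ := σ) (m := K) hyp hσ fun i _ => rfl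
    rwa [hrowσ, hrowσ, add_comm (K : ℤ) u, zero_add] at this
  have hb0 : ∀ k, b (row τ M (u + K), fun k => colAbove τ (u + K) k) k = colAbove τ u k := by
    intro k
    dsimp only [b]
    split_ifs with h1 h2 h3
    · simp only [row, colAbove, Fin.val_zero, Nat.cast_zero]
      congr 1
      omega
    · rfl
    · simp only [colAbove]
      congr 1
      omega
    · rfl
  have ht : Filter.Tendsto (fun p : (Fin (M + 1) → 𝕜) × (Fin K → 𝕜) =>
      (downIter g σ K p.1, b p)) (𝓝 (row τ M (u + K), fun k => colAbove τ (u + K) k))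
      (𝓝 (row τ M u, colAbove τ u)) := by
    refine Filter.Tendsto.prodMk_nhds ?_ (tendsto_pi_nhds.2 fun k => ?_)
    · have := hdown.tendsto.comp (continuous_fst.tendsto
        ((row τ M (u + K), fun k => colAbove τ (u + K) k) :
          (Fin (M + 1) → 𝕜) × (Fin K → 𝕜)))
      rwa [hdown0] at this
    · have := (hb k).tendsto (row τ M (u + K), fun k => colAbove τ (u + K) k)
      rwa [hb0] at this
  have hex := eventually_exists_row (p₀ := ((row τ M (u + K), fun k => colAbove τ (u + K) k) :
    (Fin (M + 1) → 𝕜) × (Fin K → 𝕜))) hind hσ M K K (a := Prod.fst)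
    (b := fun p i => if i = K then p.1 0 else σ 0 i) continuousAt_fst
    (fun i _ => by split_ifs <;> fun_prop)
    (by rw [hrowσ, add_comm (K : ℤ) u])
    (fun i _ => by
      dsimp only
      split_ifs with h
      · rw [hcolσ, h, add_comm]
        simp [row]
      · rfl) (fun p => by simp)
  have hiter := eventually_rowIter_eq hyp hτ (Φ := fun v p => F v (p.1, fun k => p.2 k))
    (fun v => hF.eventually_rowMap v) u K
  have hmain : ∀ᶠ p : (Fin (M + 1) → 𝕜) × (Fin K → 𝕜) in
      𝓝 (row τ M (u + K), fun k => colAbove τ (u + K) k),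
      F (u + K) p = F u (downIter g σ K p.1, fun k => b (p.1, 0) k) := by
    filter_upwards [ht.eventually hiter, hex] with p hp hp'
    obtain ⟨σ', hσ', hrow, hcol⟩ := hp'
    have h1 : downIter g σ K p.1 = row σ' M 0 := by
      rw [← hrow]
      refine downIter_row hyp hσ' fun i hi => ?_
      rw [hcol _ (abs_le.2 ⟨by omega, by omega⟩), if_neg (by omega)]
    have h2 : rowIter f (downIter g σ K p.1) (b p) K = p.1 := by
      rw [rowIter_row hyp hσ' (v := 0) h1, zero_add, hrow]
      intro i hi
      rw [hcol _ (abs_le.2 ⟨by omega, by omega⟩)]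
      dsimp only [b]
      rw [dif_pos hi]
      refine if_congr (by omega) rfl ?_
      rw [hcolσ, colAbove]
      congr 1
      ring
    have h3 : (fun k : Fin K => b p (k + K)) = p.2 := by
      funext k
      simp [b]
    have h4 : (fun k : Fin K => b p k) = fun k : Fin K => b (p.1, 0) k := by
      funext k
      simp [b]
    rw [h2, h3, h4] at hp
    exact hp
  have ht2 : Filter.Tendsto (fun p : (Fin (M + 1) → 𝕜) × (Fin K → 𝕜) =>
      ((p.1, fun k => colAbove τ (u + K) k) : (Fin (M + 1) → 𝕜) × (Fin K → 𝕜)))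
      (𝓝 (row τ M (u + K), fun k => colAbove τ (u + K) k))
      (𝓝 (row τ M (u + K), fun k => colAbove τ (u + K) k)) := by
    have : Continuous (fun p : (Fin (M + 1) → 𝕜) × (Fin K → 𝕜) =>
      ((p.1, fun k => colAbove τ (u + K) k) : (Fin (M + 1) → 𝕜) × (Fin K → 𝕜))) := by fun_prop
    exact this.tendsto _
  filter_upwards [hmain, ht2.eventually hmain] with p h1 h2
  rw [h1, h2]

/-- A family of germs of functions of the rows of `τ` at all heights, invariant under the upper
shift. -/
structure IsRowInvariant (f : 𝕜 → 𝕜 → 𝕜 → 𝕜) (τ : ℤ → ℤ → 𝕜) (M : ℕ)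
    (G : ℤ → (Fin (M + 1) → 𝕜) → 𝕜) : Prop where
  contDiffAt : ∀ v, ContDiffAt 𝕜 ∞ (G v) (row τ M v)
  eventually_eq : ∀ v, ∀ᶠ p in 𝓝 (row τ M v, τ 0 (v + 1)), G (v + 1) (rowMap f p) = G v p.1

/-- The column arguments are frozen at the values of `τ`. The shift relation survives because, by
`IsInvariantNear.eventually_eq`, their actual values do not matter. -/
theorem IsInvariantNear.isRowInvariant (hyp : IsHyperbolic f g r s Γ)
    (hind : HasIndependentVariables Γ) (hτ : τ ∈ solutions Γ) (hF : IsInvariantNear f τ M K F) :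
    IsRowInvariant f τ M (fun v a => F v (a, fun k => colAbove τ v k)) := by
  refine ⟨fun v => ?_, fun v => ?_⟩
  · exact ContDiffAt.comp (g := F v) (f := fun a => (a, fun k : Fin K => colAbove τ v k)) _
      (hF.1 v) (contDiffAt_id.prodMk contDiffAt_const)
  · let b : (Fin (M + 1) → 𝕜) × 𝕜 → ℕ → 𝕜 := fun p k => if k = 0 then p.2 else colAbove τ v k
    have hb : Continuous b := by
      refine continuous_pi fun k => ?_
      dsimp only [b]
      split_ifs <;> fun_prop
    have hb0 : b (row τ M v, τ 0 (v + 1)) = colAbove τ v := by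
      funext k
      dsimp only [b]
      split_ifs with h
      · simp [colAbove, h]
      · rfl
    have ht : Filter.Tendsto (fun p : (Fin (M + 1) → 𝕜) × 𝕜 => (p.1, b p))
        (𝓝 (row τ M v, τ 0 (v + 1))) (𝓝 (row τ M v, colAbove τ v)) := by
      rw [← hb0]
      exact (continuous_fst.prodMk hb).tendsto _
    have ht2 : Filter.Tendsto (fun p : (Fin (M + 1) → 𝕜) × (ℕ → 𝕜) =>
        ((p.1, fun k => p.2 k) : (Fin (M + 1) → 𝕜) × (Fin K → 𝕜)))
        (𝓝 (row τ M v, colAbove τ v)) (𝓝 (row τ M v, fun k => colAbove τ v k)) := by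
      have : Continuous (fun p : (Fin (M + 1) → 𝕜) × (ℕ → 𝕜) =>
        ((p.1, fun k => p.2 k) : (Fin (M + 1) → 𝕜) × (Fin K → 𝕜))) := by fun_prop
      exact this.tendsto (row τ M v, colAbove τ v)
    filter_upwards [ht.eventually (hF.eventually_rowMap v),
      (ht2.comp ht).eventually (hF.eventually_eq hyp hind hτ v)] with p h1 h2
    simp only [Function.comp_apply] at h2
    rw [← h2, ← h1]
    have e1 : b p 0 = p.2 := by simp [b]
    rw [e1]
    congr 2
    funext k
    simp only [b, colAbove, Nat.add_one_ne_zero, if_false]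
    congr 1
    push_cast
    ring

theorem IsRowInvariant.shift {G : ℤ → (Fin (M + 1) → 𝕜) → 𝕜} (hG : IsRowInvariant f τ M G)
    (w : ℤ) : IsRowInvariant f (shift 0 w τ) M (fun v => G (v + w)) := by
  have hcol : ∀ i, DiscreteHyperbolic.shift 0 w τ 0 i = τ 0 (i + w) := fun i => by
    simp [DiscreteHyperbolic.shift]
  refine ⟨fun v => ?_, fun v => ?_⟩
  · rw [row_shift]
    exact hG.contDiffAt _
  · have := hG.eventually_eq (v + w)
    rwa [row_shift, hcol, add_right_comm]

theorem IsRowInvariant.eventually_rowIter (hyp : IsHyperbolic f g r s Γ) (hτ : τ ∈ solutions Γ)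
    {G : ℤ → (Fin (M + 1) → 𝕜) → 𝕜} (hG : IsRowInvariant f τ M G) (k : ℕ) :
    ∀ᶠ p in 𝓝 (row τ M (-k), colAbove τ (-k)), G 0 (rowIter f p.1 p.2 k) = G (-k) p.1 := by
  have h := eventually_rowIter_eq hyp hτ (Φ := fun v p => G v p.1) (fun v => ?_) (-k) k
  · simpa using h
  · have hc : Continuous (fun p : (Fin (M + 1) → 𝕜) × (ℕ → 𝕜) => (p.1, p.2 0)) := by fun_prop
    have ht := hc.tendsto (row τ M v, colAbove τ v)
    have e : colAbove τ v 0 = τ 0 (v + 1) := by simp [colAbove]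
    simp only [e] at ht
    exact ht.eventually (hG.eventually_eq v)

theorem eventuallyConst_of_fderiv_single {ι : Type*} [Fintype ι] [DecidableEq ι]
    {F : (ι → 𝕜) → 𝕜} {a₀ : ι → 𝕜} (hF : ContDiffAt 𝕜 ∞ F a₀)
    (h : ∀ j, ∀ᶠ a in 𝓝 a₀, fderiv 𝕜 F a (Pi.single j 1) = 0) :
    Filter.EventuallyConst F (𝓝 a₀) := by
  have h1 : ∀ᶠ a in 𝓝 a₀, DifferentiableAt 𝕜 F a ∧ fderiv 𝕜 F a = 0 := by
    filter_upwards [eventually_differentiableAt hF, Filter.eventually_all.2 h] with a ha ha'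
    refine ⟨ha, ?_⟩
    exact ContinuousLinearMap.coe_injective
      (LinearMap.pi_ext' fun j => LinearMap.ext_ring (by simpa using ha' j))
  obtain ⟨ε, hε, hball⟩ := Metric.eventually_nhds_iff_ball.1 h1
  refine Filter.eventuallyConst_iff_exists_eventuallyEq.2 ⟨F a₀, ?_⟩
  filter_upwards [Metric.ball_mem_nhds a₀ hε] with a ha
  exact Metric.isOpen_ball.is_const_of_fderiv_eq_zero (𝕜 := 𝕜)
    (convex_ball a₀ ε).isPreconnected
    (fun z hz => (hball z hz).1.differentiableWithinAt)
    (fun z hz => (hball z hz).2) ha (Metric.mem_ball_self hε)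

/-- A nontrivial invariant gives an invariant of the rows with a leading variable. -/
theorem exists_isRowInvariant (hyp : IsHyperbolic f g r s Γ) (hind : HasIndependentVariables Γ)
    (h : AdmitsNontrivialInvariant f Γ) :
    ∃ τ ∈ solutions Γ, ∃ (M : ℕ) (G : ℤ → (Fin (M + 1) → 𝕜) → 𝕜), IsRowInvariant f τ M G ∧
      ∃ j₀ : Fin (M + 1),
        (¬ ∀ᶠ a in 𝓝 (row τ M 0), fderiv 𝕜 (G 0) a (Pi.single j₀ 1) = 0) ∧
        ∀ j, j₀ < j → ∀ᶠ a in 𝓝 (row τ M 0), fderiv 𝕜 (G 0) a (Pi.single j 1) = 0 := by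
  classical
  obtain ⟨τ, hτ, M, K, F, hF, v₀, hv₀⟩ := h
  have hG := hF.isRowInvariant hyp hind hτ
  set G : ℤ → (Fin (M + 1) → 𝕜) → 𝕜 := fun v a => F v (a, fun k => colAbove τ v k) with hGdef
  -- The leading index is maximal over all heights at once. Translating a height where its
  -- derivative is not identically zero to `0` keeps the vanishing of the higher derivatives.
  let J : Finset (Fin (M + 1)) := Finset.univ.filter fun j =>
    ∃ v, ¬ ∀ᶠ a in 𝓝 (row τ M v), fderiv 𝕜 (G v) a (Pi.single j 1) = 0
  have hJ : J.Nonempty := by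
    by_contra hcon
    rw [Finset.not_nonempty_iff_eq_empty] at hcon
    apply hv₀
    have hc : Filter.EventuallyConst (G v₀) (𝓝 (row τ M v₀)) := by
      refine eventuallyConst_of_fderiv_single (hG.contDiffAt v₀) fun j => ?_
      by_contra hj
      have : j ∈ J := Finset.mem_filter.2 ⟨Finset.mem_univ _, v₀, hj⟩
      simp [hcon] at this
    have hc' := hc.comp_tendsto (continuous_fst.tendsto
      ((row τ M v₀, fun k => colAbove τ v₀ k) : (Fin (M + 1) → 𝕜) × (Fin K → 𝕜)))
    refine hc'.congr ?_
    filter_upwards [hF.eventually_eq hyp hind hτ v₀] with p hp using hp.symm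
  obtain ⟨j₀, hj₀, hmax⟩ := Finset.exists_max_image J id hJ
  obtain ⟨-, v₁, hv₁⟩ := Finset.mem_filter.1 hj₀
  refine ⟨DiscreteHyperbolic.shift 0 v₁ τ, shift_mem hτ 0 v₁, M, _, hG.shift v₁, j₀, ?_, ?_⟩
  · simpa only [row_shift, zero_add] using hv₁
  · intro j hj
    simp only [row_shift, zero_add]
    by_contra hcon
    exact absurd (hmax j (Finset.mem_filter.2 ⟨Finset.mem_univ _, v₁, hcon⟩)) (not_le.2 hj)

end Reduction

/-! ### Coefficients of vector fields near the domain of the dynamical variables -/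

section Coefficients

variable {𝕜 : Type*} [RCLike 𝕜] {f g r s : 𝕜 → 𝕜 → 𝕜 → 𝕜} {Γ : Set (𝕜 × 𝕜 × 𝕜 × 𝕜)}
  {τ : ℤ → ℤ → 𝕜} {H G : (ℤ → 𝕜) → 𝕜}

/-- The coordinates with indices in `S`. -/
def coordRestr (𝕜 : Type*) [RCLike 𝕜] (S : Finset ℤ) : (ℤ → 𝕜) →L[𝕜] (S → 𝕜) :=
  ContinuousLinearMap.pi fun i => ContinuousLinearMap.proj (i : ℤ)

theorem coordRestr_single_of_notMem {S : Finset ℤ} {i : ℤ} (h : i ∉ S) :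
    coordRestr 𝕜 S (Pi.single i 1) = 0 := by
  funext p
  exact Pi.single_eq_of_ne (ne_of_mem_of_not_mem p.2 h) _

/-- The coordinates with indices in `S` replaced by given values. -/
def coordExt (S : Finset ℤ) (x : ℤ → 𝕜) (z : S → 𝕜) : ℤ → 𝕜 :=
  fun i => if h : i ∈ S then z ⟨i, h⟩ else x i

theorem coordRestr_coordExt (S : Finset ℤ) (x : ℤ → 𝕜) (z : S → 𝕜) :
    coordRestr 𝕜 S (coordExt S x z) = z := by
  funext p
  exact dif_pos p.2

theorem coordExt_coordRestr (S : Finset ℤ) (x : ℤ → 𝕜) :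
    coordExt S x (coordRestr 𝕜 S x) = x := by
  funext i
  unfold coordExt
  split_ifs <;> rfl

theorem continuous_coordExt (S : Finset ℤ) (x : ℤ → 𝕜) : Continuous (coordExt S x) := by
  refine continuous_pi fun i => ?_
  unfold coordExt
  split_ifs <;> fun_prop

/-- Functions that near every point of the domain of the dynamical variables are given by one
function of finitely many coordinates, analytic at these points. -/
def IsCoeff (Γ : Set (𝕜 × 𝕜 × 𝕜 × 𝕜)) (H : (ℤ → 𝕜) → 𝕜) : Prop :=
  ∃ (S : Finset ℤ) (φ : (S → 𝕜) → 𝕜), ∀ x₀ ∈ points Γ,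
    AnalyticAt 𝕜 φ (coordRestr 𝕜 S x₀) ∧ ∀ᶠ x in 𝓝 x₀, H x = φ (coordRestr 𝕜 S x)

/-- The converse is not claimed. Brackets differentiate coefficients in the full coordinate space,
where only finitely many coordinates at a time are known to be free to vary within the domain; hence
`IsCoeff` prescribes a function on whole neighbourhoods. -/
theorem IsCoeff.isDynamicalFunction (h : IsCoeff Γ H) : IsDynamicalFunction Γ H := by
  obtain ⟨S, φ, hφ⟩ := h
  exact ⟨S, φ, fun x hx => ⟨(hφ x hx).1, (hφ x hx).2.self_of_nhds⟩⟩

theorem IsCoeff.congr (h : IsCoeff Γ H) (hG : ∀ x₀ ∈ points Γ, ∀ᶠ x in 𝓝 x₀, G x = H x) :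
    IsCoeff Γ G := by
  obtain ⟨S, φ, hφ⟩ := h
  refine ⟨S, φ, fun x hx => ⟨(hφ x hx).1, ?_⟩⟩
  filter_upwards [(hφ x hx).2, hG x hx] with y h1 h2 using h2.trans h1

theorem IsCoeff.const (c : 𝕜) : IsCoeff Γ (fun _ => c) :=
  ⟨∅, fun _ => c, fun _ _ => ⟨analyticAt_const, by simp⟩⟩

theorem IsCoeff.comp₂ (hH : IsCoeff Γ H) (hG : IsCoeff Γ G) {op : 𝕜 × 𝕜 → 𝕜}
    (hop : ∀ p, AnalyticAt 𝕜 op p) : IsCoeff Γ (fun x => op (H x, G x)) := by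
  classical
  obtain ⟨S, φ, hφ⟩ := hH
  obtain ⟨S', ψ, hψ⟩ := hG
  refine ⟨S ∪ S', fun z => op (φ (subRestr 𝕜 Finset.subset_union_left z),
    ψ (subRestr 𝕜 Finset.subset_union_right z)), fun x hx => ⟨?_, ?_⟩⟩
  · refine AnalyticAt.fun_comp (hop _) (AnalyticAt.prod ?_ ?_)
    · exact AnalyticAt.fun_comp (f := subRestr 𝕜 Finset.subset_union_left) (hφ x hx).1
        (ContinuousLinearMap.analyticAt _ _)
    · exact AnalyticAt.fun_comp (f := subRestr 𝕜 Finset.subset_union_right) (hψ x hx).1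
        (ContinuousLinearMap.analyticAt _ _)
  · filter_upwards [(hφ x hx).2, (hψ x hx).2] with y h1 h2
    rw [h1, h2]
    rfl

theorem IsCoeff.add (hH : IsCoeff Γ H) (hG : IsCoeff Γ G) : IsCoeff Γ (fun x => H x + G x) :=
  hH.comp₂ hG (op := fun p => p.1 + p.2) fun _ => analyticAt_fst.add analyticAt_snd

theorem IsCoeff.sub (hH : IsCoeff Γ H) (hG : IsCoeff Γ G) : IsCoeff Γ (fun x => H x - G x) :=
  hH.comp₂ hG (op := fun p => p.1 - p.2) fun _ => analyticAt_fst.sub analyticAt_snd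

theorem IsCoeff.mul (hH : IsCoeff Γ H) (hG : IsCoeff Γ G) : IsCoeff Γ (fun x => H x * G x) :=
  hH.comp₂ hG (op := fun p => p.1 * p.2) fun _ => analyticAt_fst.mul analyticAt_snd

theorem IsCoeff.sum {ι : Type*} (I : Finset ι) {H : ι → (ℤ → 𝕜) → 𝕜}
    (hH : ∀ i ∈ I, IsCoeff Γ (H i)) : IsCoeff Γ (fun x => ∑ i ∈ I, H i x) := by
  classical
  induction I using Finset.induction_on with
  | empty => simpa using IsCoeff.const 0
  | insert i I hi ih =>
    simp only [Finset.sum_insert hi]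
    exact (hH i (by simp)).add (ih fun j hj => hH j (by simp [hj]))

theorem partialT_eq_fderiv {S : Finset ℤ} {φ : (S → 𝕜) → 𝕜} {x : ℤ → 𝕜}
    (hφ : DifferentiableAt 𝕜 φ (coordRestr 𝕜 S x))
    (h : ∀ᶠ x' in 𝓝 x, H x' = φ (coordRestr 𝕜 S x')) (i : ℕ) :
    partialT i H x = fderiv 𝕜 φ (coordRestr 𝕜 S x) (coordRestr 𝕜 S (Pi.single (i : ℤ) 1)) := by
  have hc : Continuous fun y : 𝕜 => Function.update x (i : ℤ) y :=
    continuous_const.update _ continuous_id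
  have ht := hc.tendsto (x i)
  rw [Function.update_eq_self] at ht
  have hu : ∀ y : 𝕜, Function.update x (i : ℤ) y = x + (y - x i) • Pi.single (i : ℤ) (1 : 𝕜) := by
    intro y
    funext l
    rcases eq_or_ne l i with rfl | hl
    · simp
    · simp [hl]
  have hd : HasDerivAt (fun y : 𝕜 => coordRestr 𝕜 S (Function.update x (i : ℤ) y))
      (coordRestr 𝕜 S (Pi.single (i : ℤ) 1)) (x i) := by
    simp only [hu, map_add, map_smul]
    simpa using (((hasDerivAt_id (x i)).sub_const (x i)).smul_const
      (coordRestr 𝕜 S (Pi.single (i : ℤ) (1 : 𝕜)))).const_add (coordRestr 𝕜 S x)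
  have hφ' : HasFDerivAt φ (fderiv 𝕜 φ (coordRestr 𝕜 S x))
      (coordRestr 𝕜 S (Function.update x (i : ℤ) (x i))) := by
    rw [Function.update_eq_self]
    exact hφ.hasFDerivAt
  exact ((hφ'.comp_hasDerivAt (x i) hd).congr_of_eventuallyEq (ht.eventually h)).deriv

theorem IsCoeff.partialT (hH : IsCoeff Γ H) (i : ℕ) : IsCoeff Γ (partialT i H) := by
  obtain ⟨S, φ, hφ⟩ := hH
  refine ⟨S, fun z => fderiv 𝕜 φ z (coordRestr 𝕜 S (Pi.single (i : ℤ) 1)),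
    fun x hx => ⟨((ContinuousLinearMap.apply 𝕜 𝕜
      (coordRestr 𝕜 S (Pi.single (i : ℤ) (1 : 𝕜)))).analyticAt _).fun_comp (hφ x hx).1.fderiv, ?_⟩⟩
  filter_upwards [(hφ x hx).2.eventually_nhds,
    (coordRestr 𝕜 S).continuous.tendsto x |>.eventually (hφ x hx).1.eventually_analyticAt]
    with y h1 h2
  exact partialT_eq_fderiv h2.differentiableAt h1 i

/-- The vector `∑_{i < n} Y(i) e_i` at `x`. -/
def VField.trunc (Y : VField 𝕜) (n : ℕ) (x : ℤ → 𝕜) : ℤ → 𝕜 :=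
  ∑ i ∈ Finset.range n, Y i x • Pi.single (i : ℤ) 1

theorem VField.trunc_natCast (Y : VField 𝕜) {n i : ℕ} (x : ℤ → 𝕜) (hi : i < n) :
    Y.trunc n x i = Y i x := by
  rw [VField.trunc, Finset.sum_apply, Finset.sum_eq_single_of_mem i (Finset.mem_range.2 hi)]
  · simp
  · intro l _ hl
    have : (i : ℤ) ≠ l := by exact_mod_cast hl.symm
    simp [this]

/-- Near the points of the domain, `Y H` is a finite sum, and it is the derivative of `H` in the
direction of the truncations of `Y`. -/
theorem IsCoeff.exists_apply_eq (hH : IsCoeff Γ H) (Y : VField 𝕜) :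
    ∃ n₀ : ℕ, ∀ x₀ ∈ points Γ, ∀ᶠ x in 𝓝 x₀,
      Y.apply H x = ∑ i ∈ Finset.range n₀, Y i x * DiscreteHyperbolic.partialT i H x ∧
      ∀ n ≥ n₀, HasDerivAt (fun t : 𝕜 => H (x + t • Y.trunc n x)) (Y.apply H x) 0 := by
  obtain ⟨S, φ, hφ⟩ := hH
  -- `H` depends near the domain on the coordinates in `S` only, so components of `Y` with index at
  -- least `n₀` contribute nothing.
  obtain ⟨n₀, hn₀⟩ : ∃ n₀ : ℕ, ∀ i ∈ S, i < n₀ := by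
    obtain ⟨b, hb⟩ := S.bddAbove
    exact ⟨b.toNat + 1, fun i hi => by have := hb hi; omega⟩
  refine ⟨n₀, fun x₀ hx₀ => ?_⟩
  filter_upwards [(hφ x₀ hx₀).2.eventually_nhds,
    (coordRestr 𝕜 S).continuous.tendsto x₀ |>.eventually (hφ x₀ hx₀).1.eventually_analyticAt]
    with x h1 h2
  have hp := partialT_eq_fderiv h2.differentiableAt h1
  have hsum : ∀ n ≥ n₀, Y.apply H x =
      ∑ i ∈ Finset.range n, Y i x * DiscreteHyperbolic.partialT i H x := by
    intro n hn
    refine finsum_eq_sum_of_support_subset _ fun i hi => ?_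
    rw [Finset.coe_range, Set.mem_Iio]
    by_contra hcon
    refine hi ?_
    dsimp only
    rw [hp, coordRestr_single_of_notMem fun h => hcon (by have := hn₀ _ h; omega), map_zero,
      mul_zero]
  refine ⟨hsum n₀ le_rfl, fun n hn => ?_⟩
  have hd : HasDerivAt (fun t : 𝕜 => coordRestr 𝕜 S (x + t • Y.trunc n x))
      (coordRestr 𝕜 S (Y.trunc n x)) 0 := by
    simp only [map_add, map_smul]
    simpa using ((hasDerivAt_id (0 : 𝕜)).smul_const
      (coordRestr 𝕜 S (Y.trunc n x))).const_add (coordRestr 𝕜 S x)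
  have hφ' : HasFDerivAt φ (fderiv 𝕜 φ (coordRestr 𝕜 S x))
      (coordRestr 𝕜 S (x + (0 : 𝕜) • Y.trunc n x)) := by
    rw [zero_smul, add_zero]
    exact h2.differentiableAt.hasFDerivAt
  have hc : Continuous fun t : 𝕜 => x + t • Y.trunc n x := by fun_prop
  have ht := hc.tendsto 0
  rw [zero_smul, add_zero] at ht
  have h3 := (hφ'.comp_hasDerivAt (0 : 𝕜) hd).congr_of_eventuallyEq (ht.eventually h1)
  refine h3.congr_deriv ?_
  rw [hsum n hn, VField.trunc, map_sum, map_sum]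
  exact Finset.sum_congr rfl fun i _ => by rw [map_smul, map_smul, hp, smul_eq_mul]

theorem IsCoeff.apply {Y : VField 𝕜} (hY : ∀ i, IsCoeff Γ (Y i)) (hH : IsCoeff Γ H) :
    IsCoeff Γ (Y.apply H) := by
  obtain ⟨n₀, hn₀⟩ := hH.exists_apply_eq Y
  refine (IsCoeff.sum (Finset.range n₀) fun i _ => (hY i).mul (hH.partialT i)).congr
    fun x₀ hx₀ => ?_
  filter_upwards [hn₀ x₀ hx₀] with x hx using hx.1

theorem IsCoeff.isCyl (hH : IsCoeff Γ H) : IsCyl Γ (fun τ => H (stair τ)) :=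
  hH.isDynamicalFunction.isCyl

/-- The identity theorem for coefficients. -/
theorem IsCoeff.eq_zero_of_frequently (hind : HasIndependentVariables Γ) (hH : IsCoeff Γ H)
    {x₀ : ℤ → 𝕜} (hx₀ : x₀ ∈ points Γ) (h : ∃ᶠ x in 𝓝 x₀, ∀ᶠ x' in 𝓝 x, H x' = 0) :
    ∀ x ∈ points Γ, H x = 0 := by
  classical
  obtain ⟨τ₀, hτ₀, rfl⟩ := hx₀
  have hcyl := hH.isCyl
  obtain ⟨S, φ, hφ⟩ := hH
  obtain ⟨ha, he⟩ := hφ _ ⟨τ₀, hτ₀, rfl⟩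
  obtain ⟨ε, hε, hball⟩ := Metric.eventually_nhds_iff_ball.1 ha.eventually_analyticAt
  have hin : ∀ᶠ x in 𝓝 (stair τ₀),
      coordRestr 𝕜 S x ∈ Metric.ball (coordRestr 𝕜 S (stair τ₀)) ε :=
    (coordRestr 𝕜 S).continuous.tendsto _ |>.eventually (Metric.ball_mem_nhds _ hε)
  -- The point `x` need not lie in the domain. It lies in a ball around `x₀`, in the coordinates of
  -- `S`, where `φ` is analytic; so `φ` vanishes on the ball, and from there on the whole domain.
  obtain ⟨x, hx, hxe, hxb⟩ := (h.and_eventually (he.eventually_nhds.and hin)).exists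
  have hz : φ =ᶠ[𝓝 (coordRestr 𝕜 S x)] 0 := by
    have ht := (continuous_coordExt S x).tendsto (coordRestr 𝕜 S x)
    rw [coordExt_coordRestr] at ht
    filter_upwards [ht.eventually hx, ht.eventually hxe] with z h1 h2
    rw [h1, coordRestr_coordExt] at h2
    exact h2.symm
  have hzero : Set.EqOn φ 0 (Metric.ball (coordRestr 𝕜 S (stair τ₀)) ε) :=
    AnalyticOnNhd.eqOn_zero_of_preconnected_of_eventuallyEq_zero (fun z hz => hball z hz)
      (convex_ball _ ε).isPreconnected hxb hz
  have hfin := hcyl.eq_zero_of_eventually hind (S := S.image stairPos) (τ₀ := τ₀)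
    (fun p hp => by
      obtain ⟨n, -, rfl⟩ := Finset.mem_image.1 hp
      exact stairPos_cross n) hτ₀ ?_
  · rintro _ ⟨τ, hτ, rfl⟩
    exact hfin τ hτ
  · have hc : Continuous fun (z : {p // p ∈ S.image stairPos} → 𝕜) (i : S) =>
        z ⟨stairPos i, Finset.mem_image_of_mem _ i.2⟩ := by fun_prop
    have e : ∀ τ : ℤ → ℤ → 𝕜, (fun i : S => restr (S.image stairPos) τ
        ⟨stairPos i, Finset.mem_image_of_mem _ i.2⟩) = coordRestr 𝕜 S (stair τ) := by
      intro τ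
      funext i
      exact (stair_eq (τ := τ) (i : ℤ)).symm
    have ht := hc.tendsto (restr (S.image stairPos) τ₀)
    simp only [e] at ht
    filter_upwards [ht.eventually (Metric.ball_mem_nhds _ hε)] with z hz τ hτ hτz
    rw [(hφ _ ⟨τ, hτ, rfl⟩).2.self_of_nhds]
    refine hzero ?_
    rw [← e τ, hτz]
    exact hz

theorem eventually_exists_stair (hind : HasIndependentVariables Γ) (hτ : τ ∈ solutions Γ)
    (S : Finset ℤ) :
    ∀ᶠ x in 𝓝 (stair τ), ∃ τ' ∈ solutions Γ, ∀ i ∈ S, x i = stair τ' i := by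
  classical
  have hex := eventually_exists_solution hind hτ (p₀ := stair τ) (S.image stairPos)
    (fun p hp => by
      obtain ⟨n, -, rfl⟩ := Finset.mem_image.1 hp
      exact stairPos_cross n) (fun x q => x (Function.invFun stairPos q))
    (fun q _ => (continuous_apply _).continuousAt) (fun q hq => by
      obtain ⟨n, -, rfl⟩ := Finset.mem_image.1 hq
      rw [Function.leftInverse_invFun stairPos_injective, stair_eq])
  filter_upwards [hex] with x hx
  obtain ⟨τ', hτ', h'⟩ := hx
  refine ⟨τ', hτ', fun i hi => ?_⟩
  have := h' _ (Finset.mem_image_of_mem _ hi)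
  rw [Function.leftInverse_invFun stairPos_injective] at this
  exact this.symm.trans (stair_eq i).symm

/-- A coefficient that vanishes on the domain vanishes near the domain. -/
theorem IsCoeff.eventually_eq_zero (hind : HasIndependentVariables Γ) (hH : IsCoeff Γ H)
    (h : ∀ x ∈ points Γ, H x = 0) {x₀ : ℤ → 𝕜} (hx₀ : x₀ ∈ points Γ) :
    ∀ᶠ x in 𝓝 x₀, H x = 0 := by
  obtain ⟨τ₀, hτ₀, rfl⟩ := hx₀
  obtain ⟨S, φ, hφ⟩ := hH
  filter_upwards [eventually_exists_stair hind hτ₀ S, (hφ _ ⟨τ₀, hτ₀, rfl⟩).2] with x hx hx'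
  obtain ⟨τ', hτ', h'⟩ := hx
  have e : coordRestr 𝕜 S x = coordRestr 𝕜 S (stair τ') := funext fun i => h' i i.2
  rw [hx', e, ← (hφ _ ⟨τ', hτ', rfl⟩).2.self_of_nhds]
  exact h _ ⟨τ', hτ', rfl⟩

end Coefficients

/-! ### The generators: analytic coefficients and annihilation of row invariants -/

section Generators

variable {𝕜 : Type*} [RCLike 𝕜] {f g r s : 𝕜 → 𝕜 → 𝕜 → 𝕜} {Γ : Set (𝕜 × 𝕜 × 𝕜 × 𝕜)}
  {τ : ℤ → ℤ → 𝕜} {M : ℕ}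

/-- A property of functions of a parameter that is stable under substitution into `g`
passes to the entries of `rowDown`. -/
theorem rowDown_property {P : Type*} (Q : (P → 𝕜) → Prop) (p₀ : P)
    (hQ : ∀ t tu tv tuv, (t, tu, tv, tuv) ∈ Γ → ∀ H₁ H₂ H₃ : P → 𝕜, Q H₁ → Q H₂ → Q H₃ →
      H₁ p₀ = t → H₂ p₀ = tv → H₃ p₀ = tuv → Q (fun p => g (H₁ p) (H₂ p) (H₃ p)))
    (hyp : IsHyperbolic f g r s Γ) (hτ : τ ∈ solutions Γ) {X : P → ℤ → 𝕜} {k j : ℕ}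
    (hX : ∀ i : ℤ, -(k : ℤ) ≤ i → i ≤ j → Q (fun p => X p i))
    (hX₀ : ∀ i : ℤ, -(k : ℤ) ≤ i → i ≤ j → X p₀ i = stair τ i) :
    Q (fun p => rowDown g (X p) k j) := by
  induction k generalizing j with
  | zero => exact hX j (by simp) le_rfl
  | succ k ih =>
    push_cast at hX hX₀
    refine prevRow_property Q p₀ hQ hyp hτ (v := -((k : ℤ) + 1))
      (fun i hi => ih (fun l hl hl' => hX l (by omega) (by omega))
        (fun l hl hl' => hX₀ l (by omega) (by omega)))
      (hX _ (by omega) (by omega)) (fun i hi => ?_) ?_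
    · rw [rowDown_solution hyp hτ fun l hl hl' => hX₀ l (by omega) (by omega)]
      congr 1
      ring
    · rw [hX₀ _ (by omega) (by omega), stair_neg_succ]

theorem analyticAt_deriv_param {E : Type*} [NormedAddCommGroup E] [NormedSpace 𝕜 E]
    {ψ : E × 𝕜 → 𝕜} {ℓ : E → 𝕜} {z₀ : E} (hψ : AnalyticAt 𝕜 ψ (z₀, ℓ z₀))
    (hℓ : AnalyticAt 𝕜 ℓ z₀) : AnalyticAt 𝕜 (fun z => deriv (fun y => ψ (z, y)) (ℓ z)) z₀ := by
  have h1 : AnalyticAt 𝕜 (fun z => fderiv 𝕜 ψ (z, ℓ z) (0, 1)) z₀ :=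
    ((ContinuousLinearMap.apply 𝕜 𝕜 ((0, 1) : E × 𝕜)).analyticAt _).fun_comp
      (AnalyticAt.fun_comp (f := fun z => (z, ℓ z)) hψ.fderiv (analyticAt_id.prod hℓ))
  refine h1.congr ?_
  have ht : Filter.Tendsto (fun z => (z, ℓ z)) (𝓝 z₀) (𝓝 (z₀, ℓ z₀)) :=
    (continuousAt_id.prodMk hℓ.continuousAt).tendsto
  filter_upwards [ht.eventually hψ.eventually_analyticAt] with z hz
  exact (hz.differentiableAt.hasFDerivAt.comp_hasDerivAt (ℓ z)
    ((hasDerivAt_const (ℓ z) z).prodMk (hasDerivAt_id (ℓ z)))).deriv.symm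

theorem IsCoeff.charField (hyp : IsHyperbolic f g r s Γ) (hind : HasIndependentVariables Γ)
    (k j : ℕ) : IsCoeff Γ (charField f g (k + 1) j) := by
  classical
  set S : Finset ℤ := Finset.Icc (-((k : ℤ) + 1)) j with hS
  have hE : ∀ (x : ℤ → 𝕜) (i : ℤ), -((k : ℤ) + 1) ≤ i → i ≤ j →
      coordExt S 0 (coordRestr 𝕜 S x) i = x i := by
    intro x i h1 h2
    exact dif_pos (Finset.mem_Icc.2 ⟨h1, h2⟩)
  -- Coefficient `j` of `X_{k+1}` reads near the domain only the coordinates from `-(k + 1)` to `j`;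
  -- the zeros filled in elsewhere do not matter.
  refine ⟨S, fun z => DiscreteHyperbolic.charField f g (k + 1) j (coordExt S 0 z), ?_⟩
  rintro _ ⟨τ, hτ, rfl⟩
  refine ⟨?_, ?_⟩
  · set z₀ := coordRestr 𝕜 S (stair τ) with hz₀
    have hEa : ∀ (i : ℤ) (p : (S → 𝕜) × 𝕜),
        AnalyticAt 𝕜 (fun p : (S → 𝕜) × 𝕜 => coordExt S 0 p.1 i) p := by
      intro i p
      unfold coordExt
      split_ifs with h
      · exact ((ContinuousLinearMap.proj (R := 𝕜) (φ := fun _ : S => 𝕜) ⟨i, h⟩).comp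
          (ContinuousLinearMap.fst 𝕜 (S → 𝕜) 𝕜)).analyticAt _
      · exact analyticAt_const
    have hℓ : AnalyticAt 𝕜 (fun z : S → 𝕜 => coordExt S 0 z (1 - ((k + 1 : ℕ) : ℤ))) z₀ :=
      AnalyticAt.fun_comp (f := fun z : S → 𝕜 => (z, (0 : 𝕜))) (hEa _ (z₀, 0))
        (analyticAt_id.prod analyticAt_const)
    have hψ : AnalyticAt 𝕜 (fun p : (S → 𝕜) × 𝕜 => rowIter f
        (fun l : Fin (j + 1) => rowDown g (coordExt S 0 p.1) (k + 1) l)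
        (fun i : ℕ => if i = 0 then p.2 else coordExt S 0 p.1 ((i : ℤ) - k)) (k + 1)
        (Fin.last j)) (z₀, coordExt S 0 z₀ (1 - ((k + 1 : ℕ) : ℤ))) := by
      refine analyticAt_pi_iff.1 (analyticAt_rowIter hyp hτ (v := -((k : ℤ) + 1)) (k + 1)
        (analyticAt_pi_iff.2 fun l => ?_) (fun i hi => ?_) ?_ fun i hi => ?_) _
      · refine rowDown_property (fun H => AnalyticAt 𝕜 H
          (z₀, coordExt S 0 z₀ (1 - ((k + 1 : ℕ) : ℤ))))
          (z₀, coordExt S 0 z₀ (1 - ((k + 1 : ℕ) : ℤ))) ?_ hyp hτ (fun i _ _ => hEa i _) ?_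
        · intro t tu tv tuv h H₁ H₂ H₃ h1 h2 h3 e1 e2 e3
          exact hyp.analyticAt_comp_g h h1 h2 h3 e1 e2 e3
        · intro i h1 h2
          exact hE _ i (by push_cast at h1; omega) (by omega)
      · split_ifs
        · exact analyticAt_snd
        · exact hEa _ _
      · funext l
        dsimp only
        rw [rowDown_solution hyp hτ fun i h1 h2 => hE _ i (by push_cast at h1; omega) (by omega)]
        simp [row]
      · exact column_eq (fun l h1 h2 => hE _ l h1 (by omega)) hi
    refine (analyticAt_deriv_param hψ hℓ).congr (Filter.Eventually.of_forall fun z => ?_)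
    refine congrArg (fun c : 𝕜 → 𝕜 => deriv c (coordExt S 0 z (1 - ((k + 1 : ℕ) : ℤ)))) ?_
    funext y
    exact (congrFun (rowUp_update_eq_rowIter (M := j) (f := f) _ (coordExt S 0 z) k (k + 1) y)
      (Fin.last j)).symm
  · filter_upwards [eventually_exists_stair hind hτ S] with x hx
    obtain ⟨τ', hτ', h'⟩ := hx
    have e : ∀ i : ℤ, -((k : ℤ) + 1) ≤ i → i ≤ j → x i = stair τ' i := fun i h1 h2 =>
      h' i (Finset.mem_Icc.2 ⟨h1, h2⟩)
    have e1 := charField_eq_charVec hyp hτ' e (Fin.last j)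
    have e2 := charField_eq_charVec hyp hτ' (fun i h1 h2 => (hE x i h1 h2).trans (e i h1 h2))
      (Fin.last j)
    exact e1.trans e2.symm

/-- The segment of length `M + 1` of the coordinates, starting at `t_m`. -/
def window (M m : ℕ) (x : ℤ → 𝕜) : Fin (M + 1) → 𝕜 := fun l => x ((m + l : ℕ) : ℤ)

theorem continuous_window (M m : ℕ) : Continuous (window (𝕜 := 𝕜) M m) := by
  unfold window
  fun_prop

theorem row_shift_left (m : ℕ) (v : ℤ) (l : ℕ) :
    shift (-m) 0 τ ((m + l : ℕ) : ℤ) v = τ l v := by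
  simp only [shift, add_zero]
  congr 1
  push_cast
  ring

theorem window_stair_shift (m : ℕ) : window M m (stair (shift (-m) 0 τ)) = row τ M 0 := by
  funext l
  rw [window, stair_natCast, row_shift_left, row]

/-- `G` is annihilated, as a function of `t_m, …, t_{m+M}`, by the vector field `Z` at `x`. -/
def Annihilates (G : (Fin (M + 1) → 𝕜) → 𝕜) (m : ℕ) (Z : VField 𝕜) (x : ℤ → 𝕜) : Prop :=
  fderiv 𝕜 G (window M m x) (fun l => Z (m + l) x) = 0

/-- The entries from `m` on evolve by themselves once the column `u = m` is known: it takes the role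
of `u = 0`. -/
theorem window_rowUp (a b : ℕ → 𝕜) (m k : ℕ) :
    (fun l : Fin (M + 1) => rowUp f a b k (m + l)) =
      rowIter f (fun l : Fin (M + 1) => a (m + l)) (fun i => rowUp f a b (i + 1) m) k := by
  induction k with
  | zero => rfl
  | succ k ih =>
    have h : ∀ (a : ℕ → 𝕜) (b : 𝕜) (l : ℕ), nextRow f a b (m + l) =
        nextRow f (fun i => a (m + i)) (nextRow f a b m) l := by
      intro a b l
      induction l with
      | zero => rfl
      | succ l ihl => rw [← add_assoc, nextRow, nextRow, ihl]; rfl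
    rw [rowIter, ← ih]
    exact (funext fun l : Fin (M + 1) => h _ _ _).trans
      (rowMap_eq (M := M) (fun i => rowUp f a b k (m + i)) _).symm

/-- After `k + 1` upper shifts `G 0` equals `G (-(k + 1))` of the lowest row, whatever column was
used; the value `t_v` varied in `X_{k+1}` influences that column but not the lowest row. The
horizontal translation puts the germ at the variables `t_m, …, t_{m+M}`. -/
theorem IsRowInvariant.eventually_annihilates_charField (hyp : IsHyperbolic f g r s Γ)
    (hind : HasIndependentVariables Γ) (hτ : τ ∈ solutions Γ)
    {G : ℤ → (Fin (M + 1) → 𝕜) → 𝕜} (hG : IsRowInvariant f τ M G) (k m : ℕ) :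
    ∀ᶠ x in 𝓝 (stair (DiscreteHyperbolic.shift (-m) 0 τ)),
      Annihilates (G 0) m (DiscreteHyperbolic.charField f g (k + 1)) x := by
  set σ := DiscreteHyperbolic.shift (-m) 0 τ with hσdef
  have hσ : σ ∈ solutions Γ := shift_mem hτ _ _
  have hσrow : ∀ (l : ℕ) (v : ℤ), σ ((m + l : ℕ) : ℤ) v = τ l v := fun l v =>
    row_shift_left m v l
  let up : (ℤ → 𝕜) → 𝕜 → ℕ → ℕ → 𝕜 := fun x y n => rowUp f (rowDown g x (k + 1))
    (Function.update (fun i : ℕ => x ((i : ℤ) - (k + 1 : ℕ))) 1 y) n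
  let p₀ : (ℤ → 𝕜) × 𝕜 := (stair σ, stair σ (1 - ((k + 1 : ℕ) : ℤ)))
  have hdown : ∀ j : ℕ, ContinuousAt (fun p : (ℤ → 𝕜) × 𝕜 => rowDown g p.1 (k + 1) j) p₀ := by
    intro j
    refine rowDown_property (fun H => ContinuousAt H p₀) p₀ ?_ hyp hσ (fun i _ _ => by fun_prop)
      fun i _ _ => rfl
    intro t tu tv tuv h H₁ H₂ H₃ h1 h2 h3 e1 e2 e3
    exact hyp.continuousAt_comp_g h h1 h2 h3 e1 e2 e3
  have hdown₀ : ∀ j : ℕ, rowDown g (stair σ) (k + 1) j = σ j (-((k : ℤ) + 1)) := by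
    intro j
    rw [rowDown_solution hyp hσ fun i _ _ => rfl]
    push_cast
    rfl
  have hup : ∀ n ≤ k + 1, ∀ j, ContinuousAt (fun p : (ℤ → 𝕜) × 𝕜 => up p.1 p.2 n j) p₀ ∧
      up p₀.1 p₀.2 n j = σ j (-((k : ℤ) + 1) + n) := by
    intro n hn j
    have e : ∀ p : (ℤ → 𝕜) × 𝕜, up p.1 p.2 n j = rowIter f
        (fun l : Fin (j + 1) => rowDown g p.1 (k + 1) l)
        (fun i : ℕ => if i = 0 then p.2 else p.1 ((i : ℤ) - k)) n (Fin.last j) := fun p =>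
      congrFun (rowUp_update_eq_rowIter (M := j) (f := f) _ p.1 k n p.2) (Fin.last j)
    have ha₀ : (fun l : Fin (j + 1) => rowDown g p₀.1 (k + 1) l) =
        row σ j (-((k : ℤ) + 1)) := funext fun l => hdown₀ l
    refine ⟨?_, ?_⟩
    · simp only [e]
      refine continuousAt_pi.1 (continuousAt_rowIter hyp hσ (v := -((k : ℤ) + 1)) n
        (continuousAt_pi.2 fun l => hdown l) (fun i _ => ?_) ha₀ fun i hi =>
          column_eq (fun _ _ _ => rfl) (by omega)) _
      split_ifs <;> fun_prop
    · exact rowUp_rowDown_solution hyp hσ hn fun _ _ _ => rfl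
  -- The column `u = m` met during the `k + 1` steps; the later entries are filled from `τ` only to
  -- stay near it.
  let b : (ℤ → 𝕜) × 𝕜 → ℕ → 𝕜 := fun p i =>
    if i < k + 1 then up p.1 p.2 (i + 1) m else colAbove τ (-(k + 1 : ℕ)) i
  have ht : Filter.Tendsto (fun p : (ℤ → 𝕜) × 𝕜 =>
      ((fun l : Fin (M + 1) => rowDown g p.1 (k + 1) (m + l)), b p)) (𝓝 p₀)
      (𝓝 (row τ M (-(k + 1 : ℕ)), colAbove τ (-(k + 1 : ℕ)))) := by
    refine Filter.Tendsto.prodMk_nhds (tendsto_pi_nhds.2 fun l => ?_)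
      (tendsto_pi_nhds.2 fun i => ?_)
    · have := (hdown (m + l)).tendsto
      rw [hdown₀, hσrow] at this
      simpa [row] using this
    · dsimp only [b]
      split_ifs with h
      · have := (hup (i + 1) (by omega) m).1.tendsto
        rw [(hup (i + 1) (by omega) m).2] at this
        have e : σ m (-((k : ℤ) + 1) + (i + 1 : ℕ)) = colAbove τ (-(k + 1 : ℕ)) i := by
          have := hσrow 0 (-((k : ℤ) + 1) + (i + 1 : ℕ))
          rw [add_zero] at this
          rw [this, colAbove]
          congr 1
          push_cast
          ring
        rwa [e] at this
      · exact tendsto_const_nhds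
  have hconst := ht.eventually (hG.eventually_rowIter hyp hτ (k + 1))
  have hc : Continuous fun x : ℤ → 𝕜 => (x, x (1 - ((k + 1 : ℕ) : ℤ))) := by fun_prop
  have hdiff : ∀ᶠ x in 𝓝 (stair σ), DifferentiableAt 𝕜 (G 0) (window M m x) := by
    have := (continuous_window M m).tendsto (stair σ)
    rw [window_stair_shift] at this
    exact this.eventually (eventually_differentiableAt (hG.contDiffAt 0))
  filter_upwards [(hc.tendsto (stair σ)).eventually hconst.eventually_nhds, hdiff,
    eventually_exists_stair hind hσ (Finset.Icc (-((k : ℤ) + 1)) ((m + M : ℕ) : ℤ))]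
    with x h1 h2 h3
  obtain ⟨σ', hσ', h'⟩ := h3
  have hx : ∀ i : ℤ, -((k : ℤ) + 1) ≤ i → i ≤ ((m + M : ℕ) : ℤ) → x i = stair σ' i :=
    fun i hi hi' => h' i (Finset.mem_Icc.2 ⟨hi, hi'⟩)
  set y₀ := x (1 - ((k + 1 : ℕ) : ℤ)) with hy₀
  have hd := hasDerivAt_rowUp hyp hσ' hx
  have hd' : HasDerivAt (fun y (l : Fin (M + 1)) => up x y (k + 1) (m + l))
      (fun l => DiscreteHyperbolic.charField f g (k + 1) (m + l) x) y₀ := by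
    refine hasDerivAt_pi.2 fun l => ?_
    have := hasDerivAt_pi.1 hd ⟨m + l, by omega⟩
    rwa [← charField_eq_charVec hyp hσ' hx] at this
  have hval : (fun l : Fin (M + 1) => up x y₀ (k + 1) (m + l)) = window M m x := by
    funext l
    refine (rowUp_rowDown_solution hyp hσ' le_rfl fun i h1 h2 => hx i h1 (by omega)).trans ?_
    rw [window, hx _ (by omega) (by omega), stair_natCast]
    congr 1
    push_cast
    ring
  have hconst' : ∀ᶠ y in 𝓝 y₀, G 0 (fun l : Fin (M + 1) => up x y (k + 1) (m + l)) =
      G (-(k + 1 : ℕ)) (fun l : Fin (M + 1) => rowDown g x (k + 1) (m + l)) := by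
    have hcy : Continuous fun y : 𝕜 => (x, y) := by fun_prop
    filter_upwards [(hcy.tendsto y₀).eventually h1] with y hy
    rw [← hy]
    dsimp only [up]
    rw [window_rowUp]
    congr 1
    exact rowIter_congr fun i hi => (if_pos hi).symm
  have h4 : HasFDerivAt (G 0) (fderiv 𝕜 (G 0) (window M m x))
      (fun l : Fin (M + 1) => up x y₀ (k + 1) (m + l)) := by
    rw [hval]
    exact h2.hasFDerivAt
  exact (h4.comp_hasDerivAt y₀ hd').unique
    ((hasDerivAt_const y₀ _).congr_of_eventuallyEq hconst')

end Generators

/-! ### Brackets, linear relations over the coefficients, and the bound on the dimension -/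

section Annihilation

variable {𝕜 : Type*} [RCLike 𝕜] {f g r s : 𝕜 → 𝕜 → 𝕜 → 𝕜} {Γ : Set (𝕜 × 𝕜 × 𝕜 × 𝕜)}
  {τ : ℤ → ℤ → 𝕜} {M m : ℕ} {F : (Fin (M + 1) → 𝕜) → 𝕜} {x₀ : ℤ → 𝕜} {X Y : VField 𝕜}

theorem eventually_contDiffAt_two {E : Type*} [NormedAddCommGroup E] [NormedSpace 𝕜 E]
    {F : E → 𝕜} {a₀ : E} (h : ContDiffAt 𝕜 ∞ F a₀) : ∀ᶠ a in 𝓝 a₀, ContDiffAt 𝕜 2 F a :=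
  (h.of_le (m := 2) (by norm_cast)).eventually (by simp)

/-- The derivative along `Y` of the relation `X F = 0`. -/
theorem eventually_fderiv_fderiv_add_eq_zero (hx₀ : x₀ ∈ points Γ)
    (hF : ContDiffAt 𝕜 ∞ F (window M m x₀)) (hX : ∀ j, IsCoeff Γ (X j))
    (hXF : ∀ᶠ x in 𝓝 x₀, Annihilates F m X x) (Y : VField 𝕜) :
    ∀ᶠ x in 𝓝 x₀, fderiv 𝕜 (fderiv 𝕜 F) (window M m x) (fun l => Y (m + l) x)
        (fun l => X (m + l) x) +
      fderiv 𝕜 F (window M m x) (fun l => Y.apply (X (m + l)) x) = 0 := by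
  choose N hN using fun l : Fin (M + 1) => (hX (m + l)).exists_apply_eq Y
  -- Large enough for the truncation of `Y` to differentiate all the coefficients concerned
  -- correctly and to contain every component of the window.
  set n := Finset.univ.sup N + (m + M + 1) with hn
  have hNn : ∀ l, N l ≤ n := fun l => (Finset.le_sup (Finset.mem_univ l)).trans (by omega)
  have hN' := Filter.eventually_all.2 fun l => hN l x₀ hx₀
  filter_upwards [hN', hXF.eventually_nhds,
    ((continuous_window M m).tendsto x₀).eventually (eventually_contDiffAt_two hF)]
    with x h1 h2 h3
  have hc : Continuous fun t : 𝕜 => x + t • Y.trunc n x := by fun_prop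
  have ht := hc.tendsto 0
  rw [zero_smul, add_zero] at ht
  have hw : HasDerivAt (fun t : 𝕜 => window M m (x + t • Y.trunc n x))
      (fun l => Y (m + l) x) 0 := by
    refine hasDerivAt_pi.2 fun l => ?_
    have : ∀ t : 𝕜, window M m (x + t • Y.trunc n x) l = window M m x l + t * Y (m + l) x := by
      intro t
      simp only [window, Pi.add_apply, Pi.smul_apply, smul_eq_mul]
      rw [Y.trunc_natCast x (by omega)]
    simp only [this]
    simpa using ((hasDerivAt_id (0 : 𝕜)).mul_const (Y (m + l) x)).const_add (window M m x l)
  have hX' : HasDerivAt (fun (t : 𝕜) (l : Fin (M + 1)) => X (m + l) (x + t • Y.trunc n x))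
      (fun l => Y.apply (X (m + l)) x) 0 :=
    hasDerivAt_pi.2 fun l => (h1 l).2 n (hNn l)
  have hF' : HasFDerivAt (fderiv 𝕜 F) (fderiv 𝕜 (fderiv 𝕜 F) (window M m x))
      (window M m (x + (0 : 𝕜) • Y.trunc n x)) := by
    rw [zero_smul, add_zero]
    exact ((h3.fderiv_right (m := 1) (by norm_num)).differentiableAt (by simp)).hasFDerivAt
  have hF'' : HasDerivAt (fun t : 𝕜 => fderiv 𝕜 F (window M m (x + t • Y.trunc n x)))
      (fderiv 𝕜 (fderiv 𝕜 F) (window M m x) fun l => Y (m + l) x) 0 :=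
    hF'.comp_hasDerivAt (0 : 𝕜) hw
  have h4 := hF''.clm_apply hX'
  have h5 : HasDerivAt (fun t : 𝕜 => fderiv 𝕜 F (window M m (x + t • Y.trunc n x))
      fun l => X (m + l) (x + t • Y.trunc n x)) 0 0 :=
    (hasDerivAt_const (0 : 𝕜) (0 : 𝕜)).congr_of_eventuallyEq (ht.eventually h2)
  have h6 := h4.unique h5
  rw [zero_smul, add_zero] at h6
  exact h6

/-- Each of the relations `X F = 0` and `Y F = 0`, valid near the point, is differentiated along the
other field. In the difference the second derivatives of `F` cancel by symmetry, and the bracket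
applied to `F` remains. -/
theorem eventually_annihilates_bracket (hx₀ : x₀ ∈ points Γ)
    (hF : ContDiffAt 𝕜 ∞ F (window M m x₀)) (hX : ∀ j, IsCoeff Γ (X j))
    (hY : ∀ j, IsCoeff Γ (Y j)) (hXF : ∀ᶠ x in 𝓝 x₀, Annihilates F m X x)
    (hYF : ∀ᶠ x in 𝓝 x₀, Annihilates F m Y x) :
    ∀ᶠ x in 𝓝 x₀, Annihilates F m (X.bracket Y) x := by
  filter_upwards [eventually_fderiv_fderiv_add_eq_zero hx₀ hF hX hXF Y,
    eventually_fderiv_fderiv_add_eq_zero hx₀ hF hY hYF X,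
    ((continuous_window M m).tendsto x₀).eventually (eventually_contDiffAt_two hF)]
    with x h1 h2 h3
  have hs := h3.isSymmSndFDerivAt (by simp)
  have e : (fun l : Fin (M + 1) => X.bracket Y (m + l) x) =
      (fun l : Fin (M + 1) => X.apply (Y (m + l)) x) - fun l : Fin (M + 1) => Y.apply (X (m + l)) x := rfl
  rw [Annihilates, e, map_sub]
  rw [hs.eq] at h1
  linear_combination h2 - h1

/-- Regularity and annihilation are carried through one induction, since brackets can be
differentiated only for regular coefficients. All translates `m` are kept because they determine the
components of arbitrarily high index. -/
theorem CharAlgebra.isCoeff_and_annihilates (hyp : IsHyperbolic f g r s Γ)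
    (hind : HasIndependentVariables Γ) (hτ : τ ∈ solutions Γ)
    {G : ℤ → (Fin (M + 1) → 𝕜) → 𝕜} (hG : IsRowInvariant f τ M G) {Z : VField 𝕜}
    (hZ : CharAlgebra f g Z) : (∀ j, IsCoeff Γ (Z j)) ∧
      ∀ m : ℕ, ∀ᶠ x in 𝓝 (stair (shift (-m) 0 τ)), Annihilates (G 0) m Z x := by
  induction hZ with
  | gen k hk =>
    obtain ⟨k, rfl⟩ : ∃ k', k = k' + 1 := ⟨k - 1, by omega⟩
    exact ⟨IsCoeff.charField hyp hind k,
      hG.eventually_annihilates_charField hyp hind hτ k⟩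
  | add X Y _ _ hX hY =>
    refine ⟨fun j => (hX.1 j).add (hY.1 j), fun m => ?_⟩
    filter_upwards [hX.2 m, hY.2 m] with x h1 h2
    refine (map_add _ _ _).trans ?_
    rw [Annihilates] at h1 h2
    rw [h1, h2, add_zero]
  | smul c X _ hX =>
    refine ⟨fun j => (IsCoeff.const c).mul (hX.1 j), fun m => ?_⟩
    filter_upwards [hX.2 m] with x h1
    have e : (fun l : Fin (M + 1) => (c • X) (m + l) x) =
        c • fun l : Fin (M + 1) => X (m + l) x := rfl
    rw [Annihilates] at h1 ⊢
    rw [e, map_smul, h1, smul_zero]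
  | bracket X Y _ _ hX hY =>
    refine ⟨fun j => (IsCoeff.apply hX.1 (hY.1 j)).sub (IsCoeff.apply hY.1 (hX.1 j)),
      fun m => ?_⟩
    refine eventually_annihilates_bracket ⟨_, shift_mem hτ _ _, rfl⟩ ?_ hX.1 hY.1 (hX.2 m)
      (hY.2 m)
    rw [window_stair_shift]
    exact hG.contDiffAt 0

/-- The ring of coefficients, as functions on the domain of the dynamical variables. -/
def coeffRing (Γ : Set (𝕜 × 𝕜 × 𝕜 × 𝕜)) : Subring (points Γ → 𝕜) where
  carrier := {a | ∃ H, IsCoeff Γ H ∧ ∀ x : points Γ, a x = H x}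
  mul_mem' := by
    rintro a b ⟨H, hH, ha⟩ ⟨K, hK, hb⟩
    exact ⟨_, hH.mul hK, fun x => by rw [Pi.mul_apply, ha, hb]⟩
  one_mem' := ⟨_, IsCoeff.const 1, fun _ => rfl⟩
  add_mem' := by
    rintro a b ⟨H, hH, ha⟩ ⟨K, hK, hb⟩
    exact ⟨_, hH.add hK, fun x => by rw [Pi.add_apply, ha, hb]⟩
  zero_mem' := ⟨_, IsCoeff.const 0, fun _ => rfl⟩
  neg_mem' := by
    rintro a ⟨H, hH, ha⟩
    exact ⟨_, (IsCoeff.const 0).sub hH, fun x => by rw [Pi.neg_apply, ha, zero_sub]⟩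

theorem isDomain_coeffRing (hind : HasIndependentVariables Γ) : IsDomain (coeffRing Γ) := by
  obtain ⟨τ₀, hτ₀⟩ := solutions_nonempty hind
  have : Nonempty (points Γ) := ⟨⟨stair τ₀, τ₀, hτ₀, rfl⟩⟩
  have : NoZeroDivisors (coeffRing Γ) := by
    refine ⟨?_⟩
    rintro ⟨a, H, hH, ha⟩ ⟨b, K, hK, hb⟩ hab
    refine or_iff_not_imp_right.2 fun hb0 => ?_
    obtain ⟨⟨_, τ₁, hτ₁, rfl⟩, hne⟩ : ∃ x, b x ≠ 0 := by
      by_contra hcon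
      push Not at hcon
      exact hb0 (Subtype.ext (funext hcon))
    rw [hb] at hne
    have h := hH.isCyl.eq_zero_of_mul_eq_zero hind hK.isCyl (fun τ hτ => ?_) hτ₁ hne
    · refine Subtype.ext (funext ?_)
      rintro ⟨_, τ, hτ, rfl⟩
      exact (ha _).trans (h τ hτ)
    · have := congrFun (congrArg Subtype.val hab) ⟨stair τ, τ, hτ, rfl⟩
      rw [← ha ⟨stair τ, τ, hτ, rfl⟩, ← hb ⟨stair τ, τ, hτ, rfl⟩]
      exact this
  exact NoZeroDivisors.to_isDomain _

/-- A system of `M + 1` linear equations in `M + 2` unknowns over the coefficients has a nonzero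
solution. -/
theorem exists_linear_relation (hind : HasIndependentVariables Γ)
    {A : Fin (M + 2) → Fin (M + 1) → (ℤ → 𝕜) → 𝕜} (hA : ∀ i j, IsCoeff Γ (A i j)) :
    ∃ H : Fin (M + 2) → (ℤ → 𝕜) → 𝕜, (∀ i, IsCoeff Γ (H i)) ∧
      (∃ i, ∃ x ∈ points Γ, H i x ≠ 0) ∧
      ∀ j, ∀ x ∈ points Γ, ∑ i, H i x * A i j x = 0 := by
  have := isDomain_coeffRing hind
  -- A zero row makes the system square with zero determinant, which over a domain yields a nonzero
  -- kernel vector.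
  let B : Matrix (Fin (M + 2)) (Fin (M + 2)) (coeffRing Γ) := fun j i =>
    if h : (j : ℕ) < M + 1 then ⟨fun x => A i ⟨j, h⟩ x, _, hA i ⟨j, h⟩, fun _ => rfl⟩ else 0
  have hB : B.det = 0 := Matrix.det_eq_zero_of_row_eq_zero (Fin.last _) fun i => by simp [B]
  obtain ⟨v, hv, hBv⟩ := Matrix.exists_mulVec_eq_zero_iff.2 hB
  choose H hH hvH using fun i => (v i).2
  refine ⟨H, hH, ?_, fun j x hx => ?_⟩
  · by_contra hcon
    push Not at hcon
    refine hv (funext fun i => Subtype.ext (funext fun x => ?_))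
    rw [hvH]
    exact hcon i x x.2
  · have h1 := congrFun (congrArg Subtype.val (congrFun hBv j.castSucc)) ⟨x, hx⟩
    simp only [Matrix.mulVec, dotProduct, AddSubmonoidClass.coe_finsetSum, Finset.sum_apply,
      MulMemClass.coe_mul, Pi.mul_apply, Pi.zero_apply, ZeroMemClass.coe_zero] at h1
    rw [← h1]
    refine Finset.sum_congr rfl fun i _ => ?_
    rw [hvH, mul_comm]
    congr 1
    have : B j.castSucc i = ⟨fun x => A i j x, _, hA i j, fun _ => rfl⟩ := dif_pos j.2
    rw [this]

/-- A coefficient annihilating the leading derivative vanishes. -/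
theorem IsCoeff.eq_zero_of_leading (hind : HasIndependentVariables Γ) (hτ : τ ∈ solutions Γ)
    {F : (Fin (M + 1) → 𝕜) → 𝕜} (hF : ContDiffAt 𝕜 ∞ F (row τ M 0)) {j₀ : Fin (M + 1)}
    (hj₀ : ¬ ∀ᶠ a in 𝓝 (row τ M 0), fderiv 𝕜 F a (Pi.single j₀ 1) = 0)
    {H : (ℤ → 𝕜) → 𝕜} (hH : IsCoeff Γ H)
    (h : ∀ᶠ x in 𝓝 (stair (shift (-m) 0 τ)),
      H x * fderiv 𝕜 F (window M m x) (Pi.single j₀ 1) = 0) :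
    ∀ x ∈ points Γ, H x = 0 := by
  set x₀ := stair (shift (-m) 0 τ) with hx₀
  have hw := (continuous_window M m).tendsto x₀
  rw [window_stair_shift] at hw
  -- The window of coordinates may be varied freely with the others fixed, so if the leading
  -- derivative vanished for all `x` near `x₀`, it would vanish for all rows near that of `τ`.
  have hfreq : ∃ᶠ x in 𝓝 x₀, fderiv 𝕜 F (window M m x) (Pi.single j₀ 1) ≠ 0 := by
    intro hcon
    simp only [not_not] at hcon
    apply hj₀
    let e : (Fin (M + 1) → 𝕜) → ℤ → 𝕜 := fun a i =>
      if h : (m : ℤ) ≤ i ∧ i < m + (M + 1 : ℕ) then a ⟨(i - m).toNat, by omega⟩ else x₀ i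
    have he : Continuous e := by
      refine continuous_pi fun i => ?_
      dsimp only [e]
      split_ifs <;> fun_prop
    have hew : ∀ a, window M m (e a) = a := by
      intro a
      funext l
      have hl : (m : ℤ) ≤ ((m + l : ℕ) : ℤ) ∧ ((m + l : ℕ) : ℤ) < m + (M + 1 : ℕ) := by omega
      refine (dif_pos hl).trans (congrArg a (Fin.ext ?_))
      simp
    have he₀ : e (row τ M 0) = x₀ := by
      funext i
      dsimp only [e]
      split_ifs with hi
      · rw [← window_stair_shift (τ := τ) m, window]
        congr 1
        simp only
        omega
      · rfl
    have ht := he.tendsto (row τ M 0)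
    rw [he₀] at ht
    filter_upwards [ht.eventually hcon] with a ha
    rwa [hew] at ha
  refine hH.eq_zero_of_frequently hind ⟨_, shift_mem hτ _ _, rfl⟩
    ((hfreq.and_eventually (h.eventually_nhds.and
      (hw.eventually (eventually_contDiffAt_two hF)))).mono ?_)
  rintro x ⟨h1, h2, h3⟩
  have hc : ContinuousAt (fun x => fderiv 𝕜 F (window M m x) (Pi.single j₀ 1)) x :=
    (ContinuousAt.comp (f := window M m) (x := x) (h3.continuousAt_fderiv (by simp))
      (continuous_window M m).continuousAt).clm_apply continuousAt_const
  filter_upwards [h2, hc.eventually_ne h1] with x' h4 h5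
  exact (mul_eq_zero.1 h4).resolve_right h5

theorem isFiniteDimensional_of_admitsNontrivialInvariant (hyp : IsHyperbolic f g r s Γ)
    (hind : HasIndependentVariables Γ) (h : AdmitsNontrivialInvariant f Γ) :
    IsFiniteDimensional f g Γ := by
  obtain ⟨τ, hτ, M, G, hG, j₀, hj₀, hgt⟩ := exists_isRowInvariant hyp hind h
  -- The relation is between `M + 2` elements and is chosen to kill the components `0, …, M`; the
  -- translates of `G 0` have to kill all the others.
  refine ⟨M + 1, fun Z hZ => ?_⟩
  have hZc := fun i => (hZ i).isCoeff_and_annihilates hyp hind hτ hG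
  obtain ⟨H, hH, hne, hrel⟩ := exists_linear_relation hind
    (A := fun i (j : Fin (M + 1)) => Z i j) fun i j => (hZc i).1 j
  refine ⟨H, fun i => (hH i).isDynamicalFunction, hne, ?_⟩
  set z : VField 𝕜 := fun j x => ∑ i, H i x * Z i j x with hz
  have hzc : ∀ j, IsCoeff Γ (z j) := fun j =>
    IsCoeff.sum Finset.univ fun i _ => (hH i).mul ((hZc i).1 j)
  have hzA : ∀ m : ℕ, ∀ᶠ x in 𝓝 (stair (shift (-m) 0 τ)), Annihilates (G 0) m z x := by
    intro m
    filter_upwards [Filter.eventually_all.2 fun i => (hZc i).2 m] with x hx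
    have e : (fun l : Fin (M + 1) => z (m + l) x) =
        ∑ i, H i x • fun l : Fin (M + 1) => Z i (m + l) x := by
      funext l
      simp [hz]
    rw [Annihilates, e, map_sum]
    refine Finset.sum_eq_zero fun i _ => ?_
    rw [map_smul, hx i, smul_zero]
  suffices hzero : ∀ j, ∀ x ∈ points Γ, z j x = 0 from fun x hx j => hzero j x hx
  intro j
  induction j using Nat.strong_induction_on with
  | _ j ih =>
    rcases lt_or_ge j (M + 1) with hj | hj
    · exact hrel ⟨j, hj⟩
    · obtain ⟨m, rfl⟩ : ∃ m, j = m + j₀ := ⟨j - j₀, by omega⟩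
      refine (hzc _).eq_zero_of_leading (m := m) hind hτ (hG.contDiffAt 0) hj₀ ?_
      have hx₀ : stair (shift (-m) 0 τ) ∈ points Γ := ⟨_, shift_mem hτ _ _, rfl⟩
      have hw := (continuous_window M m).tendsto (stair (shift (-m) 0 τ))
      rw [window_stair_shift] at hw
      have hl : ∀ l : Fin (M + 1), l ≠ j₀ → ∀ᶠ x in 𝓝 (stair (shift (-m) 0 τ)),
          z (m + l) x * fderiv 𝕜 (G 0) (window M m x) (Pi.single l 1) = 0 := by
        intro l hl
        rcases lt_or_gt_of_ne hl with hl | hl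
        · filter_upwards [(hzc (m + l)).eventually_eq_zero hind
            (ih _ (Nat.add_lt_add_left hl m)) hx₀] with x hx
          rw [hx, zero_mul]
        · filter_upwards [hw.eventually (hgt l hl)] with x hx
          rw [hx, mul_zero]
      filter_upwards [hzA m, Filter.eventually_all.2 fun l : {l // l ≠ j₀} => hl l l.2]
        with x h1 h2
      rw [Annihilates, pi_eq_sum_univ' (fun l : Fin (M + 1) => z (m + l) x), map_sum,
        Finset.sum_eq_single j₀] at h1
      · rwa [map_smul, smul_eq_mul] at h1
      · intro l _ hlj
        rw [map_smul]
        exact h2 ⟨l, hlj⟩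
      · simp

end Annihilation

end DiscreteHyperbolic

theorem theorem1 {𝕜 : Type*} [RCLike 𝕜] (f g r s : 𝕜 → 𝕜 → 𝕜 → 𝕜)
    (Γ : Set (𝕜 × 𝕜 × 𝕜 × 𝕜))
    (hyp : DiscreteHyperbolic.IsHyperbolic f g r s Γ)
    (hind : DiscreteHyperbolic.HasIndependentVariables Γ) :
    DiscreteHyperbolic.AdmitsNontrivialInvariant f Γ ↔
      DiscreteHyperbolic.IsFiniteDimensional f g Γ := by
  exact ⟨DiscreteHyperbolic.isFiniteDimensional_of_admitsNontrivialInvariant hyp hind,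
    DiscreteHyperbolic.admitsNontrivialInvariant_of_isFiniteDimensional hyp hind⟩
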